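/- Let $P$ be a finite set of points in the Euclidean plane. Call four distinct points $p,q,r,s$ lying on a common circle a symmetric quadruple if $pr$ and $qs$ are the diagonals of the quadrilateral $pqrs$ (i.e. the segments $pr$ and $qs$ meet) and these diagonals have the same length. A triangulation of $P$ is a geometric simplicial complex whose vertex set is exactly $P$ and whose underlying space is the convex hull of $P$; for a triangulation $\tau$, let $A(\tau)$ be the list of all angles of all triangles of $\tau$, with multiplicity, sorted from smallest to largest. A max-min angle Delaunay triangulation of $P$ is a triangulation $\tau$ of $P$ such that $A(\tau) \ge A(\tau')$ in the lexicographic order for every triangulation $\tau'$ of $P$. If $P$ contains no symmetric quadruple, then $P$ has exactly one max-min angle Delaunay triangulation. -/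

import Mathlib

noncomputable section

namespace MaxMinAngle

/-- The Euclidean plane. -/
abbrev Plane : Type := EuclideanSpace ℝ (Fin 2)

/-- `p q r s` is a symmetric quadruple: the four points are distinct and lie on a common circle,
`pr` and `qs` are the diagonals of the quadrilateral `pqrs` (that is, these two segments meet),
and the two diagonals have the same length. -/
structure IsSymmetricQuadruple (p q r s : Plane) : Prop where
  distinct : [p, q, r, s].Nodup
  concyclic : EuclideanGeometry.Cospherical {p, q, r, s}
  diagonals_meet : (segment ℝ p r ∩ segment ℝ q s).Nonempty
  diagonals_eq : dist p r = dist q s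

/-- A triangulation of the finite point set `P`: a geometric simplicial complex whose vertices are
exactly the points of `P` and whose faces cover exactly the convex hull of `P`. -/
structure IsTriangulation (P : Finset Plane) (τ : Geometry.SimplicialComplex ℝ Plane) : Prop where
  vertices_eq : τ.vertices = (P : Set Plane)
  space_eq : τ.space = convexHull ℝ (P : Set Plane)

/-- The angle of the triangle `t` at its vertex `v`, that is `∠ x v y` where `x`, `y` are the two
other vertices. For a triangle the set below has exactly one element. -/
def cornerAngle (t : Finset Plane) (v : Plane) : ℝ :=
  sSup {θ : ℝ | ∃ x ∈ t, ∃ y ∈ t, x ≠ v ∧ y ≠ v ∧ x ≠ y ∧ θ = EuclideanGeometry.angle x v y}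

theorem cornerAngle_eq {t : Finset Plane} {x v y : Plane} (ht : ∀ z, z ∈ t ↔ z = x ∨ z = v ∨ z = y)
    (hxv : x ≠ v) (hyv : y ≠ v) (hxy : x ≠ y) :
    cornerAngle t v = EuclideanGeometry.angle x v y := by
  have h : {θ : ℝ | ∃ x ∈ t, ∃ y ∈ t, x ≠ v ∧ y ≠ v ∧ x ≠ y ∧ θ = EuclideanGeometry.angle x v y}
      = {EuclideanGeometry.angle x v y} := by
    ext θ
    simp only [Set.mem_ofPred_eq, Set.mem_singleton_iff]
    constructor
    · rintro ⟨a, ha, b, hb, hav, hbv, hab, rfl⟩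
      rcases (ht a).1 ha with rfl | rfl | rfl <;> rcases (ht b).1 hb with rfl | rfl | rfl <;>
        first
          | rfl
          | exact absurd rfl hav
          | exact absurd rfl hbv
          | exact absurd rfl hab
          | exact EuclideanGeometry.angle_comm _ _ _
    · rintro rfl
      exact ⟨x, (ht x).2 (by simp), y, (ht y).2 (by simp), hxv, hyv, hxy, rfl⟩
  rw [cornerAngle, h, csSup_singleton]

/-- The three angles of the triangle `t`. -/
def triangleAngles (t : Finset Plane) : Multiset ℝ :=
  t.val.map (cornerAngle t)

open Classical in
/-- The triangles of `τ` (a triangulation of `P`), each given by its three vertices. -/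
def triangles (P : Finset Plane) (τ : Geometry.SimplicialComplex ℝ Plane) :
    Finset (Finset Plane) :=
  (P.powersetCard 3).filter (fun t => t ∈ τ.faces)

/-- The angles of all the triangles of `τ`, with multiplicity. -/
def angles (P : Finset Plane) (τ : Geometry.SimplicialComplex ℝ Plane) : Multiset ℝ :=
  (triangles P τ).val.bind triangleAngles

/-- The list `A(τ)` of all the angles of `τ`, sorted from smallest to largest. -/
def angleList (P : Finset Plane) (τ : Geometry.SimplicialComplex ℝ Plane) : List ℝ :=
  (angles P τ).sort (· ≤ ·)

/-- `τ` is a max-min angle Delaunay triangulation of `P`: among all the triangulations of `P`, it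
has the largest sorted angle list. The order on `List ℝ` is the lexicographic one. -/
structure IsMaxMinAngleDelaunay (P : Finset Plane) (τ : Geometry.SimplicialComplex ℝ Plane) :
    Prop where
  isTriangulation : IsTriangulation P τ
  angleList_le : ∀ τ' : Geometry.SimplicialComplex ℝ Plane, IsTriangulation P τ' →
    angleList P τ' ≤ angleList P τ

end MaxMinAngle

end

/-!
The proof works with the finite set of triangles of a triangulation (`IsTri`) instead of the
simplicial complex; for a planar point set the two notions correspond to each other
(`IsTri.complex`, `IsTriangulation.isTri`, `IsTriangulation.eq_of_triangles_eq`). Collinear points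
have one triangulation only. There are finitely many sets of triangles, and at least one of them is
a triangulation (`exists_isTri`: a regular triangulation for a generic perturbation of `|x|²`), so
that a max-min angle Delaunay triangulation exists. Its set of triangles is optimal (`Opt`): no
triangulation with as many triangles has a larger list of angles. Optimality passes to every part
of the triangulation that is itself a triangulation of some of the points (`Opt.sub`).

Let `T` be optimal. If the circumcircle of a triangle contained the opposite vertex of a neighbor in
its interior, flipping the common edge would give larger angles, so `T` is locally Delaunay
(`Opt.incirc_nonpos`), hence Delaunay by a walk through the triangles (`Opt.delaunay`). Therefore
the points of `P` on the circumcircle of a triangle `t` of `T` are triangulated by a part of `T`,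
and by a part of any other optimal triangulation (`IsTri.cell`), and it suffices to prove uniqueness
for concyclic points `K` without symmetric quadruples (`Opt.subset_of_concyclic`).

Parametrize the circle by half the central angle, so that the angles of inscribed triangles are
parameter differences (`Frame`). Each angle belongs to a directed edge, the opposite one. So the
angles of a triangulation of `K` are those of the boundary edges, which do not depend on the
triangulation, and two angles `w` and `π - w` for each diagonal (`Inscribed.angleMul_eq`). This has
three consequences.
* Two optimal triangulations `U` and `V` of `K` have diagonals of the same lengths
  (`Inscribed.exists_diag_dist_eq`).
* No triangle `c a b` of `U` has three diagonals as sides (`Opt.not_three_diags`): if a shortest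
  diagonal lies beyond `a b`, all the triangles beyond `a b` and the triangle itself can be replaced
  by the fan with apex `c`, whose diagonals separate `a` from `b` and are longer than the shortest
  one.
* `U` and `V` have a common diagonal (`Opt.exists_common_diag`). Otherwise the longest diagonal of
  `U` and an equally long diagonal of `V` do not cross, because there is no symmetric quadruple, and
  maximality forces them to share an endpoint. The triangles on their long sides have a side on the
  boundary, and the remaining two sides of these triangles cross each other. The longer of them
  has no counterpart of the same length in the other triangulation (`false_of_matching`).

A common diagonal splits `K` and both triangulations, and the uniqueness follows by induction on
the number of points.
-/

noncomputable section

namespace MaxMinAngle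

open MeasureTheory Filter Topology
open scoped Classical

/-! ### Affine functions and orientation in the plane -/

/-- The real function `f` on the plane is affine, in coordinates. -/
def IsAff (f : Plane → ℝ) : Prop := ∃ α β γ : ℝ, ∀ x, f x = α * x 0 + β * x 1 + γ

theorem plane_ext {x y : Plane} (h0 : x 0 = y 0) (h1 : x 1 = y 1) : x = y := by
  ext i; fin_cases i <;> assumption

namespace IsAff

variable {f g : Plane → ℝ}

theorem sub (hf : IsAff f) (hg : IsAff g) : IsAff (fun x => f x - g x) := by
  obtain ⟨α, β, γ, hf⟩ := hf
  obtain ⟨α', β', γ', hg⟩ := hg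
  exact ⟨α - α', β - β', γ - γ', fun x => by simp only [hf, hg]; ring⟩

theorem neg (hf : IsAff f) : IsAff (fun x => - f x) := by
  obtain ⟨α, β, γ, hf⟩ := hf
  exact ⟨-α, -β, -γ, fun x => by simp only [hf]; ring⟩

theorem combo (hf : IsAff f) {a b : ℝ} (hab : a + b = 1) (x y : Plane) :
    f (a • x + b • y) = a * f x + b * f y := by
  obtain ⟨α, β, γ, hf⟩ := hf
  have hb : b = 1 - a := by linarith
  subst hb
  simp only [hf, PiLp.add_apply, PiLp.smul_apply, smul_eq_mul]
  ring

theorem map_sum (hf : IsAff f) (s : Finset Plane) (w : Plane → ℝ) (hw : ∑ q ∈ s, w q = 1) :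
    f (∑ q ∈ s, w q • q) = ∑ q ∈ s, w q * f q := by
  obtain ⟨α, β, γ, hf⟩ := hf
  have h0 : ∀ i, (∑ q ∈ s, w q • q : Plane) i = ∑ q ∈ s, w q * q i := by
    intro i; simp [WithLp.ofLp_sum, Finset.sum_apply]
  have : ∑ q ∈ s, w q * f q = α * (∑ q ∈ s, w q * q 0) + β * (∑ q ∈ s, w q * q 1)
      + γ * ∑ q ∈ s, w q := by
    simp only [hf, Finset.mul_sum, ← Finset.sum_add_distrib]
    exact Finset.sum_congr rfl fun q _ => by ring
  rw [this, hf, h0, h0, hw]; ring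

theorem continuous (hf : IsAff f) : Continuous f := by
  obtain ⟨α, β, γ, hf⟩ := hf
  rw [show f = fun x => α * x 0 + β * x 1 + γ from funext hf]
  fun_prop

theorem convex_nonneg (hf : IsAff f) : Convex ℝ {x | 0 ≤ f x} := by
  intro x hx y hy a b ha hb hab
  simp only [Set.mem_ofPred_eq] at *
  rw [hf.combo hab]
  positivity

theorem nonneg_of_mem (hf : IsAff f) {s : Set Plane} (hs : ∀ p ∈ s, 0 ≤ f p) {x : Plane}
    (hx : x ∈ convexHull ℝ s) : 0 ≤ f x :=
  convexHull_min (fun p hp => hs p hp) hf.convex_nonneg hx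

theorem nonpos_of_mem (hf : IsAff f) {s : Set Plane} (hs : ∀ p ∈ s, f p ≤ 0) {x : Plane}
    (hx : x ∈ convexHull ℝ s) : f x ≤ 0 := by
  have := hf.neg.nonneg_of_mem (s := s) (fun p hp => by simpa using hs p hp) hx
  linarith

theorem zero_of_mem (hf : IsAff f) {s : Set Plane} (hs : ∀ p ∈ s, f p = 0) {x : Plane}
    (hx : x ∈ convexHull ℝ s) : f x = 0 :=
  le_antisymm (hf.nonpos_of_mem (fun p hp => (hs p hp).le) hx)
    (hf.nonneg_of_mem (fun p hp => (hs p hp).ge) hx)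

/-- A point of a convex hull at which a function, affine and nonnegative on the generators,
vanishes lies in the hull of those generators at which the function vanishes. -/
theorem mem_face (hf : IsAff f) {s : Finset Plane} (hs : ∀ p ∈ s, 0 ≤ f p) {x : Plane}
    (hx : x ∈ convexHull ℝ (s : Set Plane)) (hx0 : f x ≤ 0) :
    x ∈ convexHull ℝ {p | p ∈ s ∧ f p = 0} := by
  classical
  obtain ⟨w, hw0, hw1, hwx⟩ := Finset.mem_convexHull'.1 hx
  have hsum : ∑ q ∈ s, w q * f q = 0 := by
    refine le_antisymm ?_ (Finset.sum_nonneg fun q hq => mul_nonneg (hw0 q hq) (hs q hq))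
    rw [← hf.map_sum s w hw1, hwx]; exact hx0
  have hz := (Finset.sum_eq_zero_iff_of_nonneg
    (fun q hq => mul_nonneg (hw0 q hq) (hs q hq))).1 hsum
  have hz' : ∀ q ∈ s, q ∉ s.filter (fun p => f p = 0) → w q = 0 := by
    intro q hq hq'
    have : f q ≠ 0 := fun h => hq' (Finset.mem_filter.2 ⟨hq, h⟩)
    exact (mul_eq_zero.1 (hz q hq)).resolve_right this
  have hset : {p | p ∈ s ∧ f p = 0} = ((s.filter (fun p => f p = 0) : Finset Plane) : Set Plane) := by
    ext; simp
  rw [hset]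
  refine Finset.mem_convexHull'.2 ⟨w, fun y hy => hw0 y (Finset.mem_filter.1 hy).1, ?_, ?_⟩
  · rw [Finset.sum_subset (Finset.filter_subset _ _) hz', hw1]
  · rw [Finset.sum_subset (Finset.filter_subset _ _) (fun q hq hq' => by rw [hz' q hq hq', zero_smul]),
      hwx]

theorem volume_zero (hf : IsAff f) {p q : Plane} (hpq : f p ≠ f q) :
    volume {x | f x = 0} = 0 := by
  obtain ⟨α, β, γ, hf⟩ := hf
  let φ : Plane →ₗ[ℝ] ℝ := α • LinearMap.proj 0 ∘ₗ (WithLp.linearEquiv 2 ℝ (Fin 2 → ℝ)).toLinearMap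
    + β • LinearMap.proj 1 ∘ₗ (WithLp.linearEquiv 2 ℝ (Fin 2 → ℝ)).toLinearMap
  have hφ : ∀ x : Plane, φ x = α * x 0 + β * x 1 := fun x => by simp [φ]
  let L : AffineSubspace ℝ Plane :=
    (AffineSubspace.mk' (-γ : ℝ) ⊥).comap φ.toAffineMap
  have hL : ∀ x, x ∈ L ↔ f x = 0 := by
    intro x
    simp only [L, AffineSubspace.mem_comap, AffineSubspace.mem_mk', LinearMap.coe_toAffineMap, hφ, hf,
      vsub_eq_sub, Submodule.mem_bot]
    constructor <;> intro h <;> linarith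
  have hne : L ≠ ⊤ := by
    intro h
    have h1 := (hL p).1 (h ▸ AffineSubspace.mem_top _ _ _)
    have h2 := (hL q).1 (h ▸ AffineSubspace.mem_top _ _ _)
    exact hpq (h1.trans h2.symm)
  have := Measure.addHaar_affineSubspace (volume : Measure Plane) L hne
  rwa [show ((L : Set Plane)) = {x | f x = 0} from Set.ext hL] at this

end IsAff

/-- Twice the signed area of the triangle `a b c`. -/
def orient (a b c : Plane) : ℝ := (b 0 - a 0) * (c 1 - a 1) - (b 1 - a 1) * (c 0 - a 0)

theorem isAff_orient (a b : Plane) : IsAff (orient a b) :=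
  ⟨-(b 1 - a 1), b 0 - a 0, (b 1 - a 1) * a 0 - (b 0 - a 0) * a 1, fun x => by
    unfold orient; ring⟩

theorem orient_rot (a b c : Plane) : orient b c a = orient a b c := by unfold orient; ring
theorem orient_rot' (a b c : Plane) : orient c a b = orient a b c := by unfold orient; ring
theorem orient_swap (a b c : Plane) : orient b a c = - orient a b c := by unfold orient; ring
theorem orient_swap' (a b c : Plane) : orient a c b = - orient a b c := by unfold orient; ring
@[simp] theorem orient_left (a b : Plane) : orient a b a = 0 := by unfold orient; ring
@[simp] theorem orient_right (a b : Plane) : orient a b b = 0 := by unfold orient; ring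
@[simp] theorem orient_same (a b : Plane) : orient a a b = 0 := by unfold orient; ring

theorem orient_ne {a b c : Plane} (h : orient a b c ≠ 0) : a ≠ b ∧ b ≠ c ∧ a ≠ c := by
  refine ⟨?_, ?_, ?_⟩ <;> rintro rfl <;> simp at h

theorem orient_add (a b c x : Plane) :
    orient a b x + orient b c x + orient c a x = orient a b c := by unfold orient; ring

theorem exists_orient_ne {a b : Plane} (hab : a ≠ b) : ∃ c, orient a b c ≠ 0 := by
  by_contra! h
  apply hab
  have h0 := h (!₂[a 0 - (b 1 - a 1), a 1 + (b 0 - a 0)])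
  simp only [orient, Matrix.cons_val_zero, Matrix.cons_val_one] at h0
  have : (b 0 - a 0) ^ 2 + (b 1 - a 1) ^ 2 = 0 := by linarith
  have h1 : b 0 - a 0 = 0 := by nlinarith [sq_nonneg (b 0 - a 0), sq_nonneg (b 1 - a 1)]
  have h2 : b 1 - a 1 = 0 := by nlinarith [sq_nonneg (b 0 - a 0), sq_nonneg (b 1 - a 1)]
  exact plane_ext (by linarith) (by linarith)

theorem volume_line {a b : Plane} (hab : a ≠ b) : volume {x | orient a b x = 0} = 0 := by
  obtain ⟨c, hc⟩ := exists_orient_ne hab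
  exact (isAff_orient a b).volume_zero (p := c) (q := a) (by simpa using hc)

/-- Barycentric coordinates with respect to a nondegenerate triangle. -/
theorem bary {a b c : Plane} (h : orient a b c ≠ 0) (x : Plane) :
    x = (orient b c x / orient a b c) • a + (orient c a x / orient a b c) • b
      + (orient a b x / orient a b c) • c := by
  apply plane_ext <;>
  · simp only [PiLp.add_apply, PiLp.smul_apply, smul_eq_mul]
    field_simp
    unfold orient; ring

theorem IsAff.bary {f : Plane → ℝ} (hf : IsAff f) (a b c x : Plane) :
    orient a b c * f x = orient b c x * f a + orient c a x * f b + orient a b x * f c := by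
  obtain ⟨α, β, γ, hf⟩ := hf
  simp only [hf]; unfold orient; ring

theorem mem_convexHull_triple {a b c x : Plane} :
    x ∈ convexHull ℝ ({a, b, c} : Set Plane) ↔
      ∃ α β γ : ℝ, 0 ≤ α ∧ 0 ≤ β ∧ 0 ≤ γ ∧ α + β + γ = 1 ∧ x = α • a + β • b + γ • c := by
  constructor
  · intro hx
    rw [convexHull_insert (by simp), convexHull_pair, mem_convexJoin] at hx
    obtain ⟨a', ha', y, ⟨s, t, hs, ht, hst, rfl⟩, ⟨u, v, hu, hv, huv, rfl⟩⟩ := hx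
    obtain rfl : a' = a := ha'
    refine ⟨u, v * s, v * t, hu, by positivity, by positivity, ?_, ?_⟩
    · rw [add_assoc, ← mul_add, hst, mul_one, huv]
    · rw [smul_add, smul_smul, smul_smul, add_assoc]
  · rintro ⟨α, β, γ, hα, hβ, hγ, h1, rfl⟩
    have hc := convex_convexHull ℝ ({a, b, c} : Set Plane)
    have hsub := subset_convexHull ℝ ({a, b, c} : Set Plane)
    have := hc.sum_mem (t := Finset.univ) (w := ![α, β, γ]) (z := ![a, b, c])
      (by intro i _; fin_cases i <;> simpa)
      (by simp [Fin.sum_univ_three, h1])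
      (by intro i _; fin_cases i <;> exact hsub (by simp))
    simpa [Fin.sum_univ_three] using this

theorem mem_triangle {a b c : Plane} (h : 0 < orient a b c) {x : Plane} :
    x ∈ convexHull ℝ ({a, b, c} : Set Plane) ↔
      0 ≤ orient a b x ∧ 0 ≤ orient b c x ∧ 0 ≤ orient c a x := by
  constructor
  · intro hx
    refine ⟨(isAff_orient a b).nonneg_of_mem ?_ hx, (isAff_orient b c).nonneg_of_mem ?_ hx,
      (isAff_orient c a).nonneg_of_mem ?_ hx⟩
    · rintro p (rfl | rfl | rfl) <;> simp [h.le]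
    · rintro p (rfl | rfl | rfl)
      · rw [orient_rot]; exact h.le
      · simp
      · simp
    · rintro p (rfl | rfl | rfl)
      · simp
      · rw [orient_rot']; exact h.le
      · simp
  · rintro ⟨h1, h2, h3⟩
    refine mem_convexHull_triple.2 ⟨_, _, _, ?_, ?_, ?_, ?_, bary h.ne' x⟩
    · positivity
    · positivity
    · positivity
    · rw [← add_div, ← add_div, div_eq_one_iff_eq h.ne', ← orient_add a b c x]; ring

theorem volume_convexHull_of_subset_pair {s : Set Plane} {a b : Plane} (hs : s ⊆ {a, b}) :
    volume (convexHull ℝ s) = 0 := by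
  obtain ⟨c, d, hcd, hab⟩ : ∃ c d : Plane, c ≠ d ∧ ∀ p ∈ s, orient c d p = 0 := by
    by_cases hab : a = b
    · subst hab
      obtain ⟨e, he⟩ := exists_ne a
      refine ⟨a, e, he.symm, fun p hp => ?_⟩
      rcases hs hp with rfl | rfl <;> simp
    · refine ⟨a, b, hab, fun p hp => ?_⟩
      rcases hs hp with rfl | rfl <;> simp
  exact measure_mono_null (fun x hx => (isAff_orient c d).zero_of_mem hab hx) (volume_line hcd)

/-- Two segments with the endpoints of each strictly separated by the line of the other cross. -/
theorem exists_crossing {a b c d : Plane} (hc : orient a b c < 0) (hd : 0 < orient a b d)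
    (ha : 0 < orient c d a) (hb : orient c d b < 0) :
    ∃ x, x ∈ openSegment ℝ a b ∧ x ∈ openSegment ℝ c d := by
  set A := orient c d a
  set B := orient c d b
  have hAB : 0 < A - B := by linarith
  have hsum : orient a b d - orient a b c = A - B := by
    simp only [A, B]; unfold orient; ring
  refine ⟨(-B / (A - B)) • a + (A / (A - B)) • b, ⟨_, _, ?_, ?_, ?_, rfl⟩,
    ⟨orient a b d / (A - B), -orient a b c / (A - B), ?_, ?_, ?_, ?_⟩⟩
  · exact div_pos (by linarith) hAB
  · exact div_pos ha hAB
  · field_simp; ring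
  · exact div_pos hd hAB
  · exact div_pos (by linarith) hAB
  · rw [← add_div, div_eq_one_iff_eq hAB.ne', ← hsum]; ring
  · apply plane_ext <;>
    · simp only [PiLp.add_apply, PiLp.smul_apply, smul_eq_mul]
      field_simp
      simp only [A, B]; unfold orient; ring

/-! ### Convex hulls of finite sets on a line -/

/-- Two finite sets on a common line, neither of whose hulls contains a further point of the
other one, have hulls that meet in the hull of their intersection. -/
theorem convexHull_inter_of_line {f : Plane → ℝ} (hf : IsAff f) {p q : Plane} (hpq : f p ≠ f q)
    {s t : Finset Plane} (hs : ∀ x ∈ s, f x = 0) (ht : ∀ x ∈ t, f x = 0)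
    (hst : ∀ x ∈ t, x ∈ convexHull ℝ (s : Set Plane) → x ∈ s)
    (hts : ∀ x ∈ s, x ∈ convexHull ℝ (t : Set Plane) → x ∈ t) {x : Plane}
    (hxs : x ∈ convexHull ℝ (s : Set Plane)) (hxt : x ∈ convexHull ℝ (t : Set Plane)) :
    x ∈ convexHull ℝ ((s : Set Plane) ∩ t) := by
  have hfx : f x = 0 := hf.zero_of_mem hs hxs
  obtain ⟨α, β, γ, hf'⟩ := id hf
  have hαβ : 0 < α ^ 2 + β ^ 2 := by
    rcases eq_or_ne α 0 with h | h
    · rcases eq_or_ne β 0 with h' | h'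
      · exact absurd (by rw [hf', hf', h, h']; ring) hpq
      · positivity
    · positivity
  -- a coordinate on the line
  let g : Plane → ℝ := fun x => -β * x 0 + α * x 1
  have hg : IsAff g := ⟨-β, α, 0, fun x => by simp [g]⟩
  have hinj : ∀ y z, f y = 0 → f z = 0 → g y = g z → y = z := by
    intro y z hy hz h
    rw [hf'] at hy hz
    simp only [g] at h
    have e0 : (α ^ 2 + β ^ 2) * (y 0 - z 0) = 0 := by linear_combination α * (hy - hz) - β * h
    have e1 : (α ^ 2 + β ^ 2) * (y 1 - z 1) = 0 := by linear_combination β * (hy - hz) + α * h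
    have e0 := (mul_eq_zero.1 e0).resolve_left hαβ.ne'
    have e1 := (mul_eq_zero.1 e1).resolve_left hαβ.ne'
    exact plane_ext (by linarith) (by linarith)
  have hseg : ∀ y a b, f y = 0 → f a = 0 → f b = 0 → g a ≤ g y → g y ≤ g b →
      y ∈ segment ℝ a b := by
    intro y a b hy ha hb h1 h2
    rcases eq_or_lt_of_le (h1.trans h2) with h | h
    · rw [hinj y a hy ha (by linarith)]; exact left_mem_segment _ _ _
    · have hd : 0 < g b - g a := by linarith
      refine ⟨(g b - g y) / (g b - g a), (g y - g a) / (g b - g a), div_nonneg (by linarith) hd.le,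
        div_nonneg (by linarith) hd.le, by field_simp; ring, ?_⟩
      have h1' : (g b - g y) / (g b - g a) + (g y - g a) / (g b - g a) = 1 := by field_simp; ring
      refine hinj _ _ ?_ hy ?_
      · rw [hf.combo h1', ha, hb]; ring
      · rw [hg.combo h1']; field_simp; ring
  have hsne : s.Nonempty := by
    by_contra h
    rw [Finset.not_nonempty_iff_eq_empty] at h
    simp [h] at hxs
  have htne : t.Nonempty := by
    by_contra h
    rw [Finset.not_nonempty_iff_eq_empty] at h
    simp [h] at hxt
  obtain ⟨M, hM, hMs⟩ := s.exists_max_image g hsne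
  obtain ⟨m, hm, hms⟩ := s.exists_min_image g hsne
  obtain ⟨M', hM', hMt⟩ := t.exists_max_image g htne
  obtain ⟨m', hm', hmt⟩ := t.exists_min_image g htne
  have bound : ∀ (u : Finset Plane) (C : ℝ), (∀ y ∈ u, g y ≤ C) → x ∈ convexHull ℝ (u : Set Plane) →
      g x ≤ C := by
    intro u C hu hxu
    have hgc : IsAff (fun y => g y - C) := ⟨-β, α, -C, fun y => by simp only [g]; ring⟩
    have := hgc.nonpos_of_mem (fun y hy => by have := hu y hy; linarith) hxu
    linarith
  have bound' : ∀ (u : Finset Plane) (C : ℝ), (∀ y ∈ u, C ≤ g y) → x ∈ convexHull ℝ (u : Set Plane) →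
      C ≤ g x := by
    intro u C hu hxu
    have hgc : IsAff (fun y => g y - C) := ⟨-β, α, -C, fun y => by simp only [g]; ring⟩
    have := hgc.nonneg_of_mem (fun y hy => by have := hu y hy; linarith) hxu
    linarith
  have x1 := bound s _ hMs hxs
  have x2 := bound t _ hMt hxt
  have x3 := bound' s _ hms hxs
  have x4 := bound' t _ hmt hxt
  have segs : ∀ {y}, f y = 0 → g m ≤ g y → g y ≤ g M → y ∈ convexHull ℝ (s : Set Plane) :=
    fun hy h1 h2 => segment_subset_convexHull hm hM
      (hseg _ _ _ hy (hs _ hm) (hs _ hM) h1 h2)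
  have segt : ∀ {y}, f y = 0 → g m' ≤ g y → g y ≤ g M' → y ∈ convexHull ℝ (t : Set Plane) :=
    fun hy h1 h2 => segment_subset_convexHull hm' hM'
      (hseg _ _ _ hy (ht _ hm') (ht _ hM') h1 h2)
  obtain ⟨B, hBs, hBt, hB⟩ : ∃ B, B ∈ s ∧ B ∈ t ∧ g x ≤ g B := by
    rcases le_total (g M) (g M') with h | h
    · exact ⟨M, hM, hts M hM (segt (hs _ hM) (by linarith) h), x1⟩
    · exact ⟨M', hst M' hM' (segs (ht _ hM') (by linarith) h), hM', x2⟩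
  obtain ⟨A, hAs, hAt, hA⟩ : ∃ A, A ∈ s ∧ A ∈ t ∧ g A ≤ g x := by
    rcases le_total (g m') (g m) with h | h
    · exact ⟨m, hm, hts m hm (segt (hs _ hm) h (by linarith)), x3⟩
    · exact ⟨m', hst m' hm' (segs (ht _ hm') h (by linarith)), hm', x4⟩
  exact segment_subset_convexHull (s := (s : Set Plane) ∩ t) ⟨hAs, hAt⟩ ⟨hBs, hBt⟩
    (hseg _ _ _ hfx (hs _ hAs) (hs _ hBs) hA hB)

/-! ### Triangulations as sets of triangles -/

/-- The convex hull of a finite set of points. -/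
abbrev hull (s : Finset Plane) : Set Plane := convexHull ℝ (s : Set Plane)

theorem isClosed_hull (s : Finset Plane) : IsClosed (hull s) :=
  (s.finite_toSet.isCompact_convexHull (𝕜 := ℝ)).isClosed

theorem hull_mono {s t : Finset Plane} (h : s ⊆ t) : hull s ⊆ hull t :=
  convexHull_mono (Finset.coe_subset.2 h)

theorem hull_triple (a b c : Plane) :
    hull {a, b, c} = convexHull ℝ ({a, b, c} : Set Plane) := by
  simp [hull]

/-- `t` is the vertex set of a nondegenerate triangle; its vertices can then be listed in
counterclockwise order. -/
def Nondeg (t : Finset Plane) : Prop := ∃ a b c, t = {a, b, c} ∧ 0 < orient a b c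

theorem nondeg_triple {a b c : Plane} (h : orient a b c ≠ 0) : Nondeg {a, b, c} := by
  rcases h.lt_or_gt with h | h
  · refine ⟨b, a, c, ?_, by rw [orient_swap]; linarith⟩
    ext; simp; tauto
  · exact ⟨a, b, c, rfl, h⟩

theorem Nondeg.card {t : Finset Plane} (h : Nondeg t) : t.card = 3 := by
  obtain ⟨a, b, c, rfl, h⟩ := h
  obtain ⟨h1, h2, h3⟩ := orient_ne h.ne'
  exact Finset.card_eq_three.2 ⟨a, b, c, h1, h3, h2, rfl⟩

theorem Nondeg.third {t : Finset Plane} (h : Nondeg t) {a b : Plane} (ha : a ∈ t) (hb : b ∈ t)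
    (hab : a ≠ b) : ∃ c, t = {a, b, c} ∧ orient a b c ≠ 0 := by
  obtain ⟨x, y, z, rfl, h⟩ := h
  have e1 : orient y z x ≠ 0 := by rw [orient_rot]; exact h.ne'
  have e2 : orient z x y ≠ 0 := by rw [orient_rot']; exact h.ne'
  have e3 : orient y x z ≠ 0 := by rw [orient_swap]; simpa using h.ne'
  have e4 : orient x z y ≠ 0 := by rw [orient_swap']; simpa using h.ne'
  have e5 : orient z y x ≠ 0 := by rw [orient_swap]; simpa using e1
  simp only [Finset.mem_insert, Finset.mem_singleton] at ha hb
  rcases ha with rfl | rfl | rfl <;> rcases hb with rfl | rfl | rfl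
  · exact absurd rfl hab
  · exact ⟨z, rfl, h.ne'⟩
  · exact ⟨y, by ext; simp; tauto, e4⟩
  · exact ⟨z, by ext; simp; tauto, e3⟩
  · exact absurd rfl hab
  · exact ⟨x, by ext; simp; tauto, e1⟩
  · exact ⟨y, by ext; simp; tauto, e2⟩
  · exact ⟨x, by ext; simp; tauto, e5⟩
  · exact absurd rfl hab

theorem Nondeg.orient_ne {t : Finset Plane} (h : Nondeg t) {a b c : Plane} (ht : t = {a, b, c}) :
    orient a b c ≠ 0 := by
  have hc := h.card
  rw [ht] at hc
  have hab : a ≠ b := by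
    rintro rfl
    have := Finset.card_le_two (a := a) (b := c)
    simp at hc; omega
  obtain ⟨d, hd, hne⟩ := h.third (a := a) (b := b) (by simp [ht]) (by simp [ht]) hab
  have : d ∈ t := by simp [hd]
  rw [ht] at this
  simp only [Finset.mem_insert, Finset.mem_singleton] at this
  rcases this with rfl | rfl | rfl
  · simp at hne
  · simp at hne
  · exact hne

theorem Nondeg.interior_nonempty {t : Finset Plane} (h : Nondeg t) :
    (interior (hull t)).Nonempty := by
  obtain ⟨a, b, c, rfl, h⟩ := h
  set x : Plane := (1 / 3 : ℝ) • a + (1 / 3 : ℝ) • b + (1 / 3 : ℝ) • c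
  refine ⟨x, mem_interior.2 ⟨{y | 0 < orient a b y} ∩ {y | 0 < orient b c y} ∩
    {y | 0 < orient c a y}, ?_, ?_, ?_⟩⟩
  · rintro y ⟨⟨h1, h2⟩, h3⟩
    rw [hull_triple]
    exact (mem_triangle h).2 ⟨le_of_lt h1, le_of_lt h2, le_of_lt h3⟩
  · exact ((isOpen_lt continuous_const (isAff_orient a b).continuous).inter
      (isOpen_lt continuous_const (isAff_orient b c).continuous)).inter
      (isOpen_lt continuous_const (isAff_orient c a).continuous)
  · have e : ∀ u v, orient u v x = (orient u v a + orient u v b + orient u v c) / 3 := by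
      intro u v
      simp only [x, orient, PiLp.add_apply, PiLp.smul_apply, smul_eq_mul]; ring
    refine ⟨⟨?_, ?_⟩, ?_⟩ <;> simp only [Set.mem_ofPred_eq, e, orient_left, orient_right]
    · linarith
    · rw [orient_rot]; linarith
    · rw [orient_rot']; linarith

theorem not_isAff_const_of_nondeg {f : Plane → ℝ} (hf : IsAff f) {t : Finset Plane} (ht : Nondeg t)
    {C : ℝ} (h : ∀ p ∈ t, f p = C) (x : Plane) : f x = C := by
  obtain ⟨a, b, c, rfl, h0⟩ := ht
  have := hf.bary a b c x
  rw [h a (by simp), h b (by simp), h c (by simp), ← add_mul, ← add_mul] at this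
  have e := orient_add a b c x
  have : orient a b c * (f x - C) = 0 := by linear_combination this + C * e
  linarith [(mul_eq_zero.1 this).resolve_left h0.ne']

/-- Two nondegenerate triangles that overlap in a null set, neither containing a further vertex of
the other one, intersect in a common face. -/
theorem hull_inter_hull_subset {s t : Finset Plane} (hs : Nondeg s) (ht : Nondeg t)
    (h0 : volume (hull s ∩ hull t) = 0)
    (hst : ∀ x ∈ t, x ∈ hull s → x ∈ s) (hts : ∀ x ∈ s, x ∈ hull t → x ∈ t) :
    hull s ∩ hull t ⊆ convexHull ℝ ((s : Set Plane) ∩ t) := by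
  have hdisj : Disjoint (interior (hull s)) (interior (hull t)) := by
    rw [Set.disjoint_iff_inter_eq_empty]
    by_contra hne
    have hpos := (isOpen_interior.inter isOpen_interior).measure_pos volume
      (Set.nonempty_iff_ne_empty.2 hne)
    exact hpos.ne' (measure_mono_null
      (Set.inter_subset_inter interior_subset interior_subset) h0)
  have cs : Convex ℝ (hull s) := convex_convexHull ℝ _
  have ct : Convex ℝ (hull t) := convex_convexHull ℝ _
  obtain ⟨φ, u, hφs, hφt⟩ := geometric_hahn_banach_open_open cs.interior isOpen_interior
    ct.interior isOpen_interior hdisj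
  have clos : ∀ {r : Finset Plane}, Nondeg r → hull r ⊆ closure (interior (hull r)) := by
    intro r hr
    rw [(convex_convexHull ℝ _).closure_interior_eq_closure_of_nonempty_interior
      hr.interior_nonempty]
    exact subset_closure
  have hs' : ∀ x ∈ hull s, φ x ≤ u := fun x hx =>
    closure_minimal (fun y hy => (hφs y hy).le) (isClosed_le φ.continuous continuous_const)
      (clos hs hx)
  have ht' : ∀ x ∈ hull t, u ≤ φ x := fun x hx =>
    closure_minimal (fun y hy => (hφt y hy).le) (isClosed_le continuous_const φ.continuous)
      (clos ht hx)
  let f : Plane → ℝ := fun x => φ x - u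
  have hf : IsAff f := by
    refine ⟨φ (EuclideanSpace.single 0 1), φ (EuclideanSpace.single 1 1), -u, fun x => ?_⟩
    have : x = x 0 • EuclideanSpace.single (0 : Fin 2) (1 : ℝ)
        + x 1 • EuclideanSpace.single (1 : Fin 2) (1 : ℝ) := by
      apply plane_ext <;> simp
    simp only [f]
    conv_lhs => rw [this]
    simp only [map_add, map_smul, smul_eq_mul]; ring
  obtain ⟨p, hp⟩ := hs.interior_nonempty
  obtain ⟨q, hq⟩ := ht.interior_nonempty
  have hpq : f p ≠ f q := by
    have := hφs p hp; have := hφt q hq; simp only [f]; intro h; linarith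
  rintro x ⟨hxs, hxt⟩
  have hfx : φ x = u := le_antisymm (hs' x hxs) (ht' x hxt)
  have x1 : x ∈ hull (s.filter (fun p => f p = 0)) := by
    have := hf.neg.mem_face (s := s)
      (fun p hp => by have := hs' p (subset_convexHull ℝ _ hp); simp only [f]; linarith) hxs
      (by simp only [f]; linarith)
    convert this using 2
    ext; simp
  have x2 : x ∈ hull (t.filter (fun p => f p = 0)) := by
    have := hf.mem_face (s := t)
      (fun p hp => by have := ht' p (subset_convexHull ℝ _ hp); simp only [f]; linarith) hxt
      (by simp only [f]; linarith)
    convert this using 2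
    ext; simp
  have := convexHull_inter_of_line hf hpq (s := s.filter (fun p => f p = 0))
    (t := t.filter (fun p => f p = 0)) (fun x hx => (Finset.mem_filter.1 hx).2)
    (fun x hx => (Finset.mem_filter.1 hx).2)
    (fun x hx hx' => by
      rw [Finset.mem_filter] at hx ⊢
      exact ⟨hst x hx.1 (hull_mono (Finset.filter_subset _ _) hx'), hx.2⟩)
    (fun x hx hx' => by
      rw [Finset.mem_filter] at hx ⊢
      exact ⟨hts x hx.1 (hull_mono (Finset.filter_subset _ _) hx'), hx.2⟩) x1 x2
  refine convexHull_mono ?_ this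
  intro y hy
  simp only [Finset.coe_filter, Set.mem_inter_iff, Set.mem_ofPred_eq] at hy
  exact ⟨hy.1.1, hy.2.1⟩

/-- `T` is the set of triangles of a triangulation of `P`: nondegenerate triangles with vertices in
`P` and no other points of `P`, overlapping in null sets and covering almost all of the convex hull
of `P`. If `P` lies on a line then only `T = ∅` qualifies. -/
structure IsTri (P : Finset Plane) (T : Finset (Finset Plane)) : Prop where
  nondeg : ∀ t ∈ T, Nondeg t
  subset : ∀ t ∈ T, t ⊆ P
  empty : ∀ t ∈ T, ∀ p ∈ P, p ∈ hull t → p ∈ t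
  disj : ∀ s ∈ T, ∀ t ∈ T, s ≠ t → volume (hull s ∩ hull t) = 0
  cover : volume (hull P \ ⋃ t ∈ T, hull t) = 0

/-- If a point in the open segment `a b` lies in the hull of some vertices of a triangle with the
edge `a b`, then `a` and `b` are among these vertices. -/
theorem Nondeg.mem_of_openSegment {t u : Finset Plane} (ht : Nondeg t) (hut : u ⊆ t) {a b y : Plane}
    (ha : a ∈ t) (hb : b ∈ t) (hab : a ≠ b) (hy : y ∈ openSegment ℝ a b) (hyu : y ∈ hull u) :
    a ∈ u ∧ b ∈ u := by
  have key : ∀ a b, a ∈ t → b ∈ t → a ≠ b → y ∈ openSegment ℝ a b → a ∈ u := by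
    intro a b ha hb hab hy
    by_contra hau
    obtain ⟨c, rfl, hc⟩ := ht.third ha hb hab
    have h0 : orient b c y = 0 := by
      refine (isAff_orient b c).zero_of_mem (s := (u : Set Plane)) (fun p hp => ?_) hyu
      have := hut hp
      simp only [Finset.mem_insert, Finset.mem_singleton] at this
      rcases this with rfl | rfl | rfl
      · exact absurd hp hau
      · simp
      · simp
    obtain ⟨r, r', hr, hr', hrr, rfl⟩ := hy
    rw [(isAff_orient b c).combo hrr, orient_left, orient_rot] at h0
    have := mul_ne_zero hr.ne' hc
    exact this (by linarith)
  exact ⟨key a b ha hb hab hy, key b a hb ha hab.symm (by rwa [openSegment_symm])⟩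

namespace IsTri

variable {P Q : Finset Plane} {T : Finset (Finset Plane)}

theorem inter (h : IsTri P T) {s t : Finset Plane} (hs : s ∈ T) (ht : t ∈ T) :
    hull s ∩ hull t ⊆ convexHull ℝ ((s : Set Plane) ∩ t) := by
  by_cases hst : s = t
  · subst hst; simp [hull]
  · exact hull_inter_hull_subset (h.nondeg s hs) (h.nondeg t ht) (h.disj s hs t ht hst)
      (fun x hx => h.empty s hs x (h.subset t ht hx)) (fun x hx => h.empty t ht x (h.subset s hs hx))

theorem isClosed_iUnion (T : Finset (Finset Plane)) : IsClosed (⋃ t ∈ T, hull t) :=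
  T.finite_toSet.isClosed_biUnion fun t _ => isClosed_hull t

theorem full_cover (h : IsTri P T) {t : Finset Plane} (ht : Nondeg t) (htP : t ⊆ P) {x : Plane}
    (hx : x ∈ hull P) : ∃ s ∈ T, x ∈ hull s := by
  by_contra! hcon
  have hx' : x ∈ (⋃ t ∈ T, hull t)ᶜ := by simpa using hcon
  have hop := (isClosed_iUnion T).isOpen_compl
  have hcl : x ∈ closure (interior (hull P)) := by
    rw [(convex_convexHull ℝ _).closure_interior_eq_closure_of_nonempty_interior
      (ht.interior_nonempty.mono (interior_mono (hull_mono htP)))]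
    exact subset_closure hx
  have hne := mem_closure_iff.1 hcl _ hop hx'
  have hpos := (hop.inter isOpen_interior).measure_pos volume hne
  refine hpos.ne' (measure_mono_null ?_ h.cover)
  rintro y ⟨hy1, hy2⟩
  exact ⟨interior_subset hy2, hy1⟩

/-- Replacing the triangles of a triangulated subset of `P` by another triangulation of it. -/
theorem replace (h : IsTri P T) (hQ : Q ⊆ P) {W F : Finset (Finset Plane)} (hWT : W ⊆ T)
    (hW : IsTri Q W) (hF : IsTri Q F) : IsTri P (T \ W ∪ F) where
  nondeg t ht := by
    rcases Finset.mem_union.1 ht with ht | ht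
    · exact h.nondeg t (Finset.mem_sdiff.1 ht).1
    · exact hF.nondeg t ht
  subset t ht := by
    rcases Finset.mem_union.1 ht with ht | ht
    · exact h.subset t (Finset.mem_sdiff.1 ht).1
    · exact (hF.subset t ht).trans hQ
  empty t ht p hp hpt := by
    rcases Finset.mem_union.1 ht with ht | ht
    · exact h.empty t (Finset.mem_sdiff.1 ht).1 p hp hpt
    · have hpQ : p ∈ hull Q := hull_mono (hF.subset t ht) hpt
      obtain ⟨w, hw, hpw⟩ := hW.full_cover (hF.nondeg t ht) (hF.subset t ht) hpQ
      exact hF.empty t ht p (hW.subset w hw (h.empty w (hWT hw) p hp hpw)) hpt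
  disj := by
    have key : ∀ s ∈ T \ W, ∀ t ∈ F, volume (hull s ∩ hull t) = 0 := by
      intro s hs t ht
      rw [Finset.mem_sdiff] at hs
      have : hull s ∩ hull t ⊆ (hull Q \ ⋃ w ∈ W, hull w) ∪ ⋃ w ∈ W, hull s ∩ hull w := by
        rintro x ⟨hxs, hxt⟩
        by_cases hx : x ∈ ⋃ w ∈ W, hull w
        · right
          simp only [Set.mem_iUnion] at hx ⊢
          obtain ⟨w, hw, hxw⟩ := hx
          exact ⟨w, hw, hxs, hxw⟩
        · exact Or.inl ⟨hull_mono (hF.subset t ht) hxt, hx⟩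
      refine measure_mono_null this (measure_union_null hW.cover
        ((measure_biUnion_null_iff W.countable_toSet).2 ?_))
      intro w hw
      exact h.disj s hs.1 w (hWT hw) (fun e => hs.2 (e ▸ hw))
    intro s hs t ht hst
    rcases Finset.mem_union.1 hs with hs | hs <;> rcases Finset.mem_union.1 ht with ht | ht
    · exact h.disj s (Finset.mem_sdiff.1 hs).1 t (Finset.mem_sdiff.1 ht).1 hst
    · exact key s hs t ht
    · rw [Set.inter_comm]; exact key t ht s hs
    · exact hF.disj s hs t ht hst
  cover := by
    refine measure_mono_null ?_ (measure_union_null h.cover hF.cover)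
    rintro x ⟨hx, hxn⟩
    simp only [Set.mem_iUnion, not_exists, Finset.mem_union, Finset.mem_sdiff] at hxn
    by_cases hx' : x ∈ ⋃ t ∈ T, hull t
    · right
      simp only [Set.mem_iUnion] at hx'
      obtain ⟨t, ht, hxt⟩ := hx'
      have htW : t ∈ W := by
        by_contra htW
        exact hxn t (Or.inl ⟨ht, htW⟩) hxt
      refine ⟨hull_mono (hW.subset t htW) hxt, ?_⟩
      simp only [Set.mem_iUnion, not_exists]
      exact fun s hs => hxn s (Or.inr hs)
    · exact Or.inl ⟨hx, hx'⟩

/-- The part of a triangulation on one side of a line that passes through no triangle. -/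
theorem split (h : IsTri P T) {f : Plane → ℝ} (hf : IsAff f) {p q : Plane} (hpq : f p ≠ f q)
    (hT : ∀ t ∈ T, (∀ x ∈ t, 0 ≤ f x) ∨ (∀ x ∈ t, f x ≤ 0)) (hQ : Q = P.filter (fun x => 0 ≤ f x)) :
    IsTri Q (T.filter (fun t => t ⊆ Q)) where
  nondeg t ht := h.nondeg t (Finset.mem_filter.1 ht).1
  subset t ht := (Finset.mem_filter.1 ht).2
  empty t ht p hp := h.empty t (Finset.mem_filter.1 ht).1 p (by
    rw [hQ] at hp; exact (Finset.mem_filter.1 hp).1)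
  disj s hs t ht := h.disj s (Finset.mem_filter.1 hs).1 t (Finset.mem_filter.1 ht).1
  cover := by
    refine measure_mono_null ?_ (measure_union_null h.cover (hf.volume_zero hpq))
    rintro x ⟨hx, hxn⟩
    have hxP : x ∈ hull P := hull_mono (hQ ▸ Finset.filter_subset _ _) hx
    by_cases hx' : x ∈ ⋃ t ∈ T, hull t
    · right
      simp only [Set.mem_iUnion] at hx'
      obtain ⟨t, ht, hxt⟩ := hx'
      have h0 : 0 ≤ f x := hf.nonneg_of_mem (s := (Q : Set Plane))
        (fun y hy => by rw [hQ] at hy; exact (Finset.mem_filter.1 hy).2) hx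
      rcases hT t ht with ht' | ht'
      · exfalso
        apply hxn
        simp only [Set.mem_iUnion]
        refine ⟨t, Finset.mem_filter.2 ⟨ht, fun y hy => ?_⟩, hxt⟩
        rw [hQ]
        exact Finset.mem_filter.2 ⟨h.subset t ht hy, ht' y hy⟩
      · exact le_antisymm (hf.nonpos_of_mem ht' hxt) h0
    · exact Or.inl ⟨hxP, hx'⟩

/-- Edges of a triangulation do not cross. -/
theorem not_cross (h : IsTri P T) {s t : Finset Plane} (hs : s ∈ T) (ht : t ∈ T) {a b c d x : Plane}
    (ha : a ∈ s) (hb : b ∈ s) (hab : a ≠ b) (hc : c ∈ t) (hd : d ∈ t) (hcd : c ≠ d)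
    (hx : x ∈ openSegment ℝ a b) (hx' : x ∈ openSegment ℝ c d) :
    a = c ∨ a = d ∨ b = c ∨ b = d := by
  have hxs : x ∈ hull s := (convex_convexHull ℝ _).openSegment_subset
    (subset_convexHull ℝ _ ha) (subset_convexHull ℝ _ hb) hx
  have hxt : x ∈ hull t := (convex_convexHull ℝ _).openSegment_subset
    (subset_convexHull ℝ _ hc) (subset_convexHull ℝ _ hd) hx'
  have hst : x ∈ hull (s ∩ t) := by
    have := h.inter hs ht ⟨hxs, hxt⟩
    rwa [← Finset.coe_inter] at this
  have h2 := (h.nondeg t ht).mem_of_openSegment Finset.inter_subset_right hc hd hcd hx' hst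
  by_contra! hne
  have hsub : ({a, b, c, d} : Finset Plane) ⊆ s := by
    intro y hy
    simp only [Finset.mem_insert, Finset.mem_singleton] at hy
    rcases hy with rfl | rfl | rfl | rfl
    · exact ha
    · exact hb
    · exact (Finset.mem_inter.1 h2.1).1
    · exact (Finset.mem_inter.1 h2.2).1
  have h4 : ({a, b, c, d} : Finset Plane).card = 4 := by
    rw [Finset.card_insert_of_notMem, Finset.card_insert_of_notMem, Finset.card_pair hcd]
    · simp [hne.2.2.1, hne.2.2.2]
    · simp [hab, hne.1, hne.2.1]
  have := Finset.card_le_card hsub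
  rw [(h.nondeg s hs).card, h4] at this
  omega

/-- A triangle edge with points of `P` beyond it belongs to a second triangle on that side. -/
theorem neighbor (h : IsTri P T) {a b c q : Plane} (ht : {a, b, c} ∈ T) (hc : 0 < orient a b c)
    (hq : q ∈ P) (hq0 : orient a b q < 0) : ∃ d, {a, b, d} ∈ T ∧ orient a b d < 0 := by
  have hab := (orient_ne hc.ne').1
  have hP := h.subset _ ht
  have haP : a ∈ P := hP (by simp)
  have hbP : b ∈ P := hP (by simp)
  set y : Plane := (1 / 2 : ℝ) • a + (1 / 2 : ℝ) • b with hy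
  have hyseg : y ∈ openSegment ℝ a b := ⟨1 / 2, 1 / 2, by norm_num, by norm_num, by norm_num, rfl⟩
  have hyP : y ∈ hull P := (convex_convexHull ℝ _).openSegment_subset
    (subset_convexHull ℝ _ haP) (subset_convexHull ℝ _ hbP) hyseg
  let z : ℝ → Plane := fun ε => (1 - ε) • y + ε • q
  have hz : Continuous z := by fun_prop
  have hex : ∀ᶠ ε in 𝓝[>] (0 : ℝ), ∃ t ∈ (T : Set (Finset Plane)), z ε ∈ hull t := by
    filter_upwards [Ioo_mem_nhdsGT (show (0 : ℝ) < 1 by norm_num)] with ε hε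
    exact h.full_cover (h.nondeg _ ht) hP ((convex_convexHull ℝ _) hyP (subset_convexHull ℝ _ hq)
      (by linarith [hε.2]) hε.1.le (by ring))
  obtain ⟨t, htT, htf⟩ : ∃ t ∈ T, ∃ᶠ ε in 𝓝[>] (0 : ℝ), z ε ∈ hull t := by
    by_contra! hno
    have : ∀ᶠ ε in 𝓝[>] (0 : ℝ), ∀ t ∈ T, z ε ∉ hull t :=
      (Finset.eventually_all T).2 fun t ht => by simpa [Filter.not_frequently] using hno t ht
    obtain ⟨ε, h1, t, ht, h2⟩ := (this.and hex).exists
    exact h1 t ht h2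
  have hyt : y ∈ hull t := by
    have : Tendsto z (𝓝[>] 0) (𝓝 (z 0)) := hz.continuousAt.tendsto.mono_left nhdsWithin_le_nhds
    have h0 : z 0 = y := by simp [z]
    rw [h0] at this
    exact (isClosed_hull t).mem_of_frequently_of_tendsto htf this
  have hys : y ∈ hull {a, b, c} := (convex_convexHull ℝ _).openSegment_subset
    (subset_convexHull ℝ _ (by simp)) (subset_convexHull ℝ _ (by simp)) hyseg
  have hyi : y ∈ hull ({a, b, c} ∩ t) := by
    have := h.inter ht htT ⟨hys, hyt⟩
    rwa [← Finset.coe_inter] at this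
  have hmem := (h.nondeg _ ht).mem_of_openSegment Finset.inter_subset_left (by simp) (by simp)
    hab hyseg hyi
  obtain ⟨d, rfl, hd⟩ := (h.nondeg t htT).third (Finset.mem_inter.1 hmem.1).2
    (Finset.mem_inter.1 hmem.2).2 hab
  refine ⟨d, htT, hd.lt_or_gt.resolve_right fun hd => ?_⟩
  obtain ⟨ε, hε, hεt, hε0⟩ := (htf.and_eventually
    (Ioo_mem_nhdsGT (show (0 : ℝ) < 1 by norm_num))).exists
  have h1 : 0 ≤ orient a b (z ε) := by
    rw [hull_triple] at hε
    exact ((mem_triangle hd).1 hε).1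
  have h2 : orient a b y = 0 := by
    rw [hy, (isAff_orient a b).combo (by norm_num)]; simp
  rw [(isAff_orient a b).combo (by ring), h2] at h1
  nlinarith

/-- An edge of the convex hull of `P` without further points of `P` belongs to a triangle. -/
theorem exists_of_hull_edge (h : IsTri P T) {a b : Plane} (ha : a ∈ P) (hb : b ∈ P) (hab : a ≠ b)
    (hP : ∀ p ∈ P, 0 ≤ orient a b p) (hP0 : ∀ p ∈ P, orient a b p = 0 → p = a ∨ p = b)
    {q : Plane} (hq : q ∈ P) (hqa : q ≠ a) (hqb : q ≠ b) :
    ∃ c ∈ P, {a, b, c} ∈ T ∧ 0 < orient a b c := by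
  have hpos : ∀ c ∈ P, orient a b c ≠ 0 → 0 < orient a b c := fun c hc h0 =>
    lt_of_le_of_ne (hP c hc) h0.symm
  have hq0 : orient a b q ≠ 0 := fun h0 => by
    rcases hP0 q hq h0 with rfl | rfl
    · exact hqa rfl
    · exact hqb rfl
  have hyseg : (1 / 2 : ℝ) • a + (1 / 2 : ℝ) • b ∈ openSegment ℝ a b :=
    ⟨1 / 2, 1 / 2, by norm_num, by norm_num, by norm_num, rfl⟩
  generalize (1 / 2 : ℝ) • a + (1 / 2 : ℝ) • b = y at hyseg
  have hyP : y ∈ hull P := (convex_convexHull ℝ _).openSegment_subset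
    (subset_convexHull ℝ _ ha) (subset_convexHull ℝ _ hb) hyseg
  have hy0 : orient a b y = 0 := by
    obtain ⟨r, r', hr, hr', hrr, rfl⟩ := hyseg
    rw [(isAff_orient a b).combo hrr]; simp
  obtain ⟨t, ht, hyt⟩ := h.full_cover (nondeg_triple hq0) (by
    intro x hx
    simp only [Finset.mem_insert, Finset.mem_singleton] at hx
    rcases hx with rfl | rfl | rfl <;> assumption) hyP
  have hyf := (isAff_orient a b).mem_face (s := t) (fun p hp => hP p (h.subset t ht hp)) hyt hy0.le
  have hsub : {p | p ∈ t ∧ orient a b p = 0} ⊆ {a, b} := fun p hp =>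
    hP0 p (h.subset t ht hp.1) hp.2
  have mem : a ∈ t ∧ b ∈ t := by
    have hyab : y ≠ a ∧ y ≠ b := by
      constructor <;> rintro rfl
      · exact hab (left_mem_openSegment_iff.1 hyseg)
      · exact hab (right_mem_openSegment_iff.1 hyseg)
    constructor
    · by_contra hat
      have : {p | p ∈ t ∧ orient a b p = 0} ⊆ {b} := fun p hp => by
        rcases hsub hp with rfl | hp'
        · exact absurd hp.1 hat
        · exact hp'
      have := convexHull_mono this hyf
      rw [convexHull_singleton] at this
      exact hyab.2 this
    · by_contra hbt
      have : {p | p ∈ t ∧ orient a b p = 0} ⊆ {a} := fun p hp => by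
        rcases hsub hp with hp' | rfl
        · exact hp'
        · exact absurd hp.1 hbt
      have := convexHull_mono this hyf
      rw [convexHull_singleton] at this
      exact hyab.1 this
  obtain ⟨c, rfl, hc⟩ := (h.nondeg t ht).third mem.1 mem.2 hab
  have hcP := h.subset _ ht (show c ∈ ({a, b, c} : Finset Plane) by simp)
  exact ⟨c, hcP, ht, hpos c hcP hc⟩

end IsTri

/-! ### Comparing multisets by their sorted lists -/

/-- `N` has fewer copies than `M` of the smallest number at which the multiplicities differ. For
multisets of the same size this says that the sorted list of `N` is lexicographically larger. -/
def Better (M N : Multiset ℝ) : Prop :=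
  ∃ y, (∀ z < y, M.count z = N.count z) ∧ N.count y < M.count y

theorem better_add_left {C M N : Multiset ℝ} : Better (C + M) (C + N) ↔ Better M N := by
  simp [Better, Multiset.count_add]

theorem eq_of_not_better {M N : Multiset ℝ} (h : ¬ Better M N) (h' : ¬ Better N M) : M = N := by
  by_contra hne
  let S := (M.toFinset ∪ N.toFinset).filter (fun z => M.count z ≠ N.count z)
  have hS : ∀ z, z ∈ S ↔ M.count z ≠ N.count z := by
    intro z
    simp only [S, Finset.mem_filter, Finset.mem_union, Multiset.mem_toFinset, and_iff_right_iff_imp]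
    intro hz
    by_contra! h0
    exact hz (by rw [Multiset.count_eq_zero_of_notMem h0.1, Multiset.count_eq_zero_of_notMem h0.2])
  have hSne : S.Nonempty := by
    by_contra h0
    rw [Finset.not_nonempty_iff_eq_empty] at h0
    refine hne (Multiset.ext.2 fun z => ?_)
    by_contra hz
    have := (hS z).2 hz
    simp [h0] at this
  have hy := (hS _).1 (S.min'_mem hSne)
  have hlt : ∀ z < S.min' hSne, M.count z = N.count z := by
    intro z hz
    by_contra hz'
    exact absurd (S.min'_le z ((hS z).2 hz')) (not_le.2 hz)
  rcases hy.lt_or_gt with hy | hy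
  · exact h' ⟨_, fun z hz => (hlt z hz).symm, hy⟩
  · exact h ⟨_, hlt, hy⟩

theorem better_of_forall_lt {M N : Multiset ℝ} {l : ℝ} (hM : ∀ z ∈ M, l ≤ z) (hl : l ∈ M)
    (hN : ∀ z ∈ N, l < z) : Better M N := by
  refine ⟨l, fun z hz => ?_, ?_⟩
  · rw [Multiset.count_eq_zero_of_notMem fun h => absurd (hM z h) (not_le.2 hz),
      Multiset.count_eq_zero_of_notMem fun h => absurd (hN z h) (not_lt.2 hz.le)]
  · rw [Multiset.count_eq_zero_of_notMem fun h => lt_irrefl _ (hN l h)]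
    exact Multiset.count_pos.2 hl

theorem list_lt_of_count : ∀ (l₁ l₂ : List ℝ), l₁.Pairwise (· ≤ ·) → l₂.Pairwise (· ≤ ·) →
    l₁.length = l₂.length →
    (∃ y, (∀ z < y, l₁.count z = l₂.count z) ∧ l₂.count y < l₁.count y) → l₁ < l₂ := by
  intro l₁
  induction l₁ with
  | nil => rintro l₂ - - - ⟨y, -, hy⟩; simp at hy
  | cons a l ih =>
    rintro (_ | ⟨b, l'⟩) h1 h2 hlen ⟨y, hy, hy'⟩
    · simp at hlen
    rw [List.cons_lt_cons_iff]
    rcases lt_trichotomy a b with hab | rfl | hab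
    · exact Or.inl hab
    · refine Or.inr ⟨rfl, ih l' h1.of_cons h2.of_cons (by simpa using hlen) ⟨y, fun z hz => ?_, ?_⟩⟩
      · have := hy z hz
        simp only [List.count_cons] at this
        omega
      · simp only [List.count_cons] at hy'
        omega
    · exfalso
      have hya : a ≤ y := by
        have : y ∈ a :: l := List.count_pos_iff.1 (by omega)
        rcases List.mem_cons.1 this with rfl | h
        · exact le_rfl
        · exact (List.pairwise_cons.1 h1).1 y h
      have := hy b (hab.trans_le hya)
      have hb : b ∉ a :: l := by
        intro h
        rcases List.mem_cons.1 h with rfl | h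
        · exact lt_irrefl _ hab
        · exact absurd ((List.pairwise_cons.1 h1).1 b h) (not_le.2 hab)
      rw [List.count_eq_zero_of_not_mem hb] at this
      simp at this

theorem Better.sort_lt {M N : Multiset ℝ} (h : Better M N) (hc : M.card = N.card) :
    M.sort (· ≤ ·) < N.sort (· ≤ ·) := by
  obtain ⟨y, h1, h2⟩ := h
  refine list_lt_of_count _ _ (Multiset.pairwise_sort _ _) (Multiset.pairwise_sort _ _)
    (by simp [hc]) ⟨y, fun z hz => ?_, ?_⟩
  · have := h1 z hz
    rwa [← Multiset.sort_eq M (· ≤ ·), ← Multiset.sort_eq N (· ≤ ·), Multiset.coe_count,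
      Multiset.coe_count] at this
  · rwa [← Multiset.sort_eq M (· ≤ ·), ← Multiset.sort_eq N (· ≤ ·), Multiset.coe_count,
      Multiset.coe_count] at h2

/-! ### Optimal sets of triangles -/

/-- The angles of all triangles in `T`, with multiplicity. -/
def angleMul (T : Finset (Finset Plane)) : Multiset ℝ := T.val.bind triangleAngles

theorem angleMul_union {S T : Finset (Finset Plane)} (h : Disjoint S T) :
    angleMul (S ∪ T) = angleMul S + angleMul T := by
  unfold angleMul
  rw [← Multiset.add_bind, ← Finset.disjUnion_eq_union _ _ h]; rfl

theorem angleMul_singleton (t : Finset Plane) : angleMul {t} = triangleAngles t := by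
  simp [angleMul]

theorem angleMul_insert {t : Finset Plane} {T : Finset (Finset Plane)} (h : t ∉ T) :
    angleMul (insert t T) = triangleAngles t + angleMul T := by
  unfold angleMul
  rw [Finset.insert_val_of_notMem h, Multiset.cons_bind]

theorem card_angleMul {P : Finset Plane} {T : Finset (Finset Plane)} (h : IsTri P T) :
    (angleMul T).card = 3 * T.card := by
  unfold angleMul
  rw [Multiset.card_bind, Multiset.map_congr rfl (g := fun _ => 3)]
  · simp [mul_comm]
  · intro t ht
    simp [triangleAngles, (h.nondeg t ht).card]

theorem triangleAngles_eq {a b c : Plane} (h1 : a ≠ b) (h2 : b ≠ c) (h3 : a ≠ c) :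
    triangleAngles {a, b, c} = {EuclideanGeometry.angle b a c, EuclideanGeometry.angle a b c,
      EuclideanGeometry.angle a c b} := by
  unfold triangleAngles
  rw [Finset.insert_val_of_notMem (by simp [h1, h3]), Finset.insert_val_of_notMem (by simp [h2])]
  simp only [Multiset.map_cons, Finset.singleton_val, Multiset.map_singleton]
  rw [cornerAngle_eq (x := b) (v := a) (y := c) (by intro z; simp; tauto) h1.symm h3.symm h2,
    cornerAngle_eq (x := a) (v := b) (y := c) (by intro z; simp) h1 h2.symm h3,
    cornerAngle_eq (x := a) (v := c) (y := b) (by intro z; simp; tauto) h3 h2 h1]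
  rfl

/-- `T` triangulates `P`, and no triangulation with the same number of triangles has a
lexicographically larger sorted list of angles. -/
structure Opt (P : Finset Plane) (T : Finset (Finset Plane)) : Prop where
  isTri : IsTri P T
  not_better : ∀ V, IsTri P V → V.card = T.card → ¬ Better (angleMul T) (angleMul V)

/-- Every triangulated part of an optimal triangulation is optimal. -/
theorem Opt.sub {P Q : Finset Plane} {T W : Finset (Finset Plane)} (h : Opt P T) (hQ : Q ⊆ P)
    (hWT : W ⊆ T) (hW : IsTri Q W) : Opt Q W := by
  refine ⟨hW, fun V hV hc hb => ?_⟩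
  have hdis : Disjoint (T \ W) V := by
    rw [Finset.disjoint_left]
    intro t ht htV
    rw [Finset.mem_sdiff] at ht
    have ht3 := hV.nondeg t htV
    -- a triangle of `T` inside the hull of `Q` overlaps some triangle of `W`
    have hsub : hull t ⊆ (hull Q \ ⋃ w ∈ W, hull w) ∪ ⋃ w ∈ W, hull t ∩ hull w := by
      intro x hx
      by_cases hx' : x ∈ ⋃ w ∈ W, hull w
      · right
        simp only [Set.mem_iUnion] at hx' ⊢
        obtain ⟨w, hw, hxw⟩ := hx'
        exact ⟨w, hw, hx, hxw⟩
      · exact Or.inl ⟨hull_mono (hV.subset t htV) hx, hx'⟩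
    have h0 : volume (hull t) = 0 := by
      refine measure_mono_null hsub (measure_union_null hW.cover
        ((measure_biUnion_null_iff W.countable_toSet).2 ?_))
      intro w hw
      exact h.isTri.disj t ht.1 w (hWT hw) (fun e => ht.2 (e ▸ hw))
    have := isOpen_interior.measure_pos volume ht3.interior_nonempty
    exact this.ne' (measure_mono_null interior_subset h0)
  have hTW : T = T \ W ∪ W := (Finset.sdiff_union_of_subset hWT).symm
  refine h.not_better (T \ W ∪ V) (h.isTri.replace hQ hWT hW hV) ?_ ?_
  · rw [Finset.card_union_of_disjoint hdis, hc]
    conv_rhs => rw [hTW, Finset.card_union_of_disjoint Finset.sdiff_disjoint]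
  · rw [angleMul_union hdis]
    have : angleMul T = angleMul (T \ W) + angleMul W := by
      conv_lhs => rw [hTW, angleMul_union Finset.sdiff_disjoint]
    rw [this, better_add_left]
    exact hb

/-! ### Sets of triangles and simplicial complexes -/

theorem volume_hull_of_card_le_two {s : Finset Plane} (hs : s.card ≤ 2) : volume (hull s) = 0 := by
  obtain ⟨a, b, hab⟩ : ∃ a b, s ⊆ {a, b} := by
    rcases s.eq_empty_or_nonempty with rfl | ⟨a, ha⟩
    · exact ⟨0, 0, by simp⟩
    · have : (s.erase a).card ≤ 1 := by rw [Finset.card_erase_of_mem ha]; omega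
      rcases Finset.card_le_one_iff_subset_singleton.1 this with ⟨b, hb⟩
      refine ⟨a, b, fun x hx => ?_⟩
      by_cases hxa : x = a
      · simp [hxa]
      · have := hb (Finset.mem_erase.2 ⟨hxa, hx⟩)
        simp at this; simp [this]
  exact volume_convexHull_of_subset_pair (a := a) (b := b) (by
    intro x hx; simpa using hab hx)

theorem affineIndependent_iff_nondeg {t : Finset Plane} (ht : t.card = 3) :
    AffineIndependent ℝ ((↑) : t → Plane) ↔ Nondeg t := by
  have hr : Set.range ((↑) : t → Plane) = t := by ext; simp
  have hfr : Module.finrank ℝ Plane = 2 := by simp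
  have hct : Fintype.card t = 2 + 1 := by simp [ht]
  have key : AffineIndependent ℝ ((↑) : t → Plane) ↔ (interior (hull t)).Nonempty := by
    rw [interior_convexHull_nonempty_iff_affineSpan_eq_top]
    constructor
    · intro h
      have := h.affineSpan_eq_top_iff_card_eq_finrank_add_one.2 (by rw [hfr, hct])
      rwa [hr] at this
    · intro h
      rw [affineIndependent_iff_le_finrank_vectorSpan ℝ _ hct, hr,
        AffineSubspace.vectorSpan_eq_top_of_affineSpan_eq_top ℝ _ _ h, finrank_top, hfr]
  rw [key]
  refine ⟨fun h => ?_, Nondeg.interior_nonempty⟩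
  obtain ⟨a, b, c, hab, hac, hbc, rfl⟩ := Finset.card_eq_three.1 ht
  refine nondeg_triple fun h0 => ?_
  have hpos := isOpen_interior.measure_pos volume h
  refine hpos.ne' (measure_mono_null interior_subset (measure_mono_null ?_ (volume_line hab)))
  intro x hx
  refine (isAff_orient a b).zero_of_mem (fun p hp => ?_) hx
  simp only [Finset.coe_insert, Finset.coe_singleton] at hp
  rcases hp with rfl | rfl | rfl
  · simp
  · simp
  · exact h0

theorem affineIndependent_mono {s t : Finset Plane} (h : AffineIndependent ℝ ((↑) : t → Plane))
    (hst : s ⊆ t) : AffineIndependent ℝ ((↑) : s → Plane) :=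
  AffineIndependent.mono (s := (s : Set Plane)) (t := (t : Set Plane)) h (by exact_mod_cast hst)

theorem affineIndependent_pair (a b : Plane) :
    AffineIndependent ℝ ((↑) : ({a, b} : Finset Plane) → Plane) := by
  by_cases hab : a = b
  · subst hab
    have : Subsingleton ({a, a} : Finset Plane) := by
      constructor; rintro ⟨x, hx⟩ ⟨y, hy⟩; simp at hx hy; simp [hx, hy]
    exact affineIndependent_of_subsingleton ℝ _
  · obtain ⟨c, hc⟩ := exists_orient_ne hab
    have h3 := nondeg_triple hc
    exact affineIndependent_mono ((affineIndependent_iff_nondeg h3.card).2 h3) (by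
      intro x hx; simp at hx ⊢; tauto)

/-- The hull of some vertices of a simplex contains the barycenter only if it is everything. -/
theorem subset_of_barycenter_mem {s u : Finset Plane} (hs : AffineIndependent ℝ ((↑) : s → Plane))
    (hu : u ⊆ s) (hx : ∑ p ∈ s, ((s.card : ℝ)⁻¹) • p ∈ hull u) (hne : s.Nonempty) : s ⊆ u := by
  obtain ⟨w, hw0, hw1, hwx⟩ := Finset.mem_convexHull'.1 hx
  have hc : (s.card : ℝ) ≠ 0 := by exact_mod_cast hne.card_pos.ne'
  let v : Plane → ℝ := fun p => (if p ∈ u then w p else 0) - (s.card : ℝ)⁻¹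
  have hv0 : ∑ p : s, v p = 0 := by
    rw [Finset.sum_coe_sort s v]
    simp only [v, Finset.sum_sub_distrib, Finset.sum_ite_mem, Finset.inter_eq_right.2 hu, hw1]
    simp [hc]
  have hv1 : ∑ p : s, v p • (p : Plane) = 0 := by
    rw [Finset.sum_coe_sort s (fun p => v p • p)]
    simp only [v, sub_smul, Finset.sum_sub_distrib, ite_smul, zero_smul, Finset.sum_ite_mem,
      Finset.inter_eq_right.2 hu, hwx]
    simp
  have := (affineIndependent_iff.1 hs) Finset.univ (fun p => v p) hv0 hv1
  intro p hp
  by_contra hpu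
  have := this ⟨p, hp⟩ (Finset.mem_univ _)
  simp only [v, hpu, if_false, zero_sub, neg_eq_zero, inv_eq_zero] at this
  exact hc this

theorem barycenter_mem {s : Finset Plane} (hne : s.Nonempty) :
    ∑ p ∈ s, ((s.card : ℝ)⁻¹) • p ∈ hull s := by
  have hc : (s.card : ℝ) ≠ 0 := by exact_mod_cast hne.card_pos.ne'
  exact Finset.mem_convexHull'.2 ⟨fun _ => (s.card : ℝ)⁻¹, fun _ _ => by positivity,
    by simp [hc], rfl⟩

/-- The simplicial complex of all faces of the triangles in `T`. -/
def IsTri.complex {P : Finset Plane} {T : Finset (Finset Plane)} (h : IsTri P T) :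
    Geometry.SimplicialComplex ℝ Plane where
  faces := {s | s.Nonempty ∧ ∃ t ∈ T, s ⊆ t}
  isRelLowerSet_faces := by
    rintro s ⟨hs, t, ht, hst⟩
    exact ⟨hs, fun r hr hne => ⟨hne, t, ht, hr.trans hst⟩⟩
  indep := by
    rintro s ⟨-, t, ht, hst⟩
    have h3 := h.nondeg t ht
    exact affineIndependent_mono ((affineIndependent_iff_nondeg h3.card).2 h3) hst
  inter_subset_convexHull := by
    rintro s r ⟨hs, t, ht, hst⟩ ⟨hr, t', ht', hrt'⟩ x ⟨hxs, hxr⟩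
    have hi := h.inter ht ht' ⟨hull_mono hst hxs, hull_mono hrt' hxr⟩
    have hit : AffineIndependent ℝ ((↑) : t → Plane) :=
      (affineIndependent_iff_nondeg (h.nondeg t ht).card).2 (h.nondeg t ht)
    have hit' : AffineIndependent ℝ ((↑) : t' → Plane) :=
      (affineIndependent_iff_nondeg (h.nondeg t' ht').card).2 (h.nondeg t' ht')
    rw [← Finset.coe_inter] at hi
    -- cut down to `s` inside `t`, then to `r` inside `t'`
    have h1 : x ∈ hull (s ∩ (t ∩ t')) := by
      have := (hit.convexHull_inter hst (Finset.inter_subset_left (s₂ := t'))).ge ⟨hxs, hi⟩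
      rwa [← Finset.coe_inter] at this
    have h2 : x ∈ hull ((s ∩ (t ∩ t')) ∩ r) := by
      have hsub : s ∩ (t ∩ t') ⊆ t' := fun y hy => by simp at hy; exact hy.2.2
      have := (hit'.convexHull_inter hsub hrt').ge ⟨h1, hxr⟩
      rwa [← Finset.coe_inter] at this
    refine convexHull_mono ?_ h2
    intro y hy
    rw [Finset.mem_coe, Finset.mem_inter, Finset.mem_inter] at hy
    exact ⟨hy.1.1, hy.2⟩

/-- `P` does not lie on a line: three of its points form a nondegenerate triangle. -/
def Planar (P : Finset Plane) : Prop := ∃ t ⊆ P, Nondeg t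

theorem IsTri.isTriangulation {P : Finset Plane} {T : Finset (Finset Plane)} (h : IsTri P T)
    (hP : Planar P) : IsTriangulation P h.complex := by
  obtain ⟨t₀, ht₀P, ht₀⟩ := hP
  constructor
  · ext p
    rw [Geometry.SimplicialComplex.mem_vertices]
    constructor
    · rintro ⟨-, t, ht, hpt⟩
      exact h.subset t ht (hpt (Finset.mem_singleton_self p))
    · intro hp
      obtain ⟨t, ht, hpt⟩ := h.full_cover ht₀ ht₀P (subset_convexHull ℝ _ hp)
      exact ⟨by simp, t, ht, by simpa using h.empty t ht p hp hpt⟩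
  · ext x
    rw [Geometry.SimplicialComplex.mem_space_iff]
    constructor
    · rintro ⟨s, ⟨-, t, ht, hst⟩, hxs⟩
      exact hull_mono (hst.trans (h.subset t ht)) hxs
    · intro hx
      obtain ⟨t, ht, hxt⟩ := h.full_cover ht₀ ht₀P hx
      exact ⟨t, ⟨Finset.card_pos.1 (by rw [(h.nondeg t ht).card]; norm_num), t, ht, subset_rfl⟩, hxt⟩

theorem IsTri.triangles_complex {P : Finset Plane} {T : Finset (Finset Plane)} (h : IsTri P T) :
    triangles P h.complex = T := by
  ext t
  simp only [triangles, Finset.mem_filter, Finset.mem_powersetCard]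
  constructor
  · rintro ⟨⟨-, h3⟩, -, s, hs, hts⟩
    rwa [Finset.eq_of_subset_of_card_le hts (by rw [h3, (h.nondeg s hs).card])]
  · intro ht
    exact ⟨⟨h.subset t ht, (h.nondeg t ht).card⟩,
      Finset.card_pos.1 (by rw [(h.nondeg t ht).card]; norm_num), t, ht, subset_rfl⟩

namespace IsTriangulation

variable {P : Finset Plane} {τ : Geometry.SimplicialComplex ℝ Plane}

theorem subset (h : IsTriangulation P τ) {s : Finset Plane} (hs : s ∈ τ.faces) : s ⊆ P := by
  intro p hp
  have : p ∈ τ.vertices := τ.down_closed hs (Finset.singleton_subset_iff.2 hp) (by simp)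
  rw [h.vertices_eq] at this
  exact_mod_cast this

theorem mem_of_mem_hull (h : IsTriangulation P τ) {s : Finset Plane} (hs : s ∈ τ.faces) {p : Plane}
    (hp : p ∈ P) (hps : p ∈ hull s) : p ∈ s :=
  (Geometry.SimplicialComplex.vertex_mem_convexHull_iff
    (by rw [h.vertices_eq]; exact_mod_cast hp) hs).1 hps

theorem isTri (h : IsTriangulation P τ) : IsTri P (triangles P τ) where
  nondeg t ht := by
    simp only [triangles, Finset.mem_filter, Finset.mem_powersetCard] at ht
    exact (affineIndependent_iff_nondeg ht.1.2).1 (τ.indep ht.2)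
  subset t ht := by
    simp only [triangles, Finset.mem_filter, Finset.mem_powersetCard] at ht
    exact ht.1.1
  empty t ht p hp hpt := h.mem_of_mem_hull (Finset.mem_filter.1 ht).2 hp hpt
  disj s hs t ht hst := by
    simp only [triangles, Finset.mem_filter, Finset.mem_powersetCard] at hs ht
    refine measure_mono_null (τ.inter_subset_convexHull hs.2 ht.2) ?_
    rw [← Finset.coe_inter]
    refine volume_hull_of_card_le_two ?_
    by_contra! hc
    have h1 : s ∩ t = s := Finset.eq_of_subset_of_card_le Finset.inter_subset_left (by omega)
    have h2 : s ∩ t = t := Finset.eq_of_subset_of_card_le Finset.inter_subset_right (by omega)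
    exact hst (h1.symm.trans h2)
  cover := by
    have hsub : hull P \ ⋃ t ∈ triangles P τ, hull t ⊆
        ⋃ s ∈ ((P.powerset.filter (fun s => s.card ≤ 2) : Finset (Finset Plane)) :
          Set (Finset Plane)), hull s := by
      rintro x ⟨hx, hxn⟩
      have hx' : x ∈ τ.space := by rw [h.space_eq]; exact hx
      obtain ⟨s, hs, hxs⟩ := Geometry.SimplicialComplex.mem_space_iff.1 hx'
      simp only [Set.mem_iUnion, not_exists] at hxn ⊢
      refine ⟨s, ?_, hxs⟩
      simp only [Finset.coe_filter, Finset.mem_powerset, Set.mem_ofPred_eq]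
      refine ⟨h.subset hs, ?_⟩
      by_contra! hc
      have h3 : s.card ≤ 3 := by
        have := (τ.indep hs).card_le_finrank_succ
        have h2 := (vectorSpan ℝ (Set.range ((↑) : s → Plane))).finrank_le
        have h2' : Module.finrank ℝ Plane = 2 := by simp
        simp only [Fintype.card_coe] at this
        omega
      refine hxn s ?_ hxs
      simp only [triangles, Finset.mem_filter, Finset.mem_powersetCard]
      exact ⟨⟨h.subset hs, by omega⟩, hs⟩
    refine measure_mono_null hsub ((measure_biUnion_null_iff (Finset.countable_toSet _)).2 ?_)
    intro s hs
    simp only [Finset.coe_filter, Set.mem_ofPred_eq] at hs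
    exact volume_hull_of_card_le_two hs.2

theorem faces_eq (h : IsTriangulation P τ) (hP : Planar P) :
    τ.faces = {s | s.Nonempty ∧ ∃ t ∈ triangles P τ, s ⊆ t} := by
  obtain ⟨t₀, ht₀P, ht₀⟩ := hP
  ext s
  constructor
  · intro hs
    have hne := τ.nonempty_of_mem_faces hs
    refine ⟨hne, ?_⟩
    have hb := barycenter_mem hne
    obtain ⟨t, ht, hxt⟩ := h.isTri.full_cover ht₀ ht₀P (hull_mono (h.subset hs) hb)
    have ht' := (Finset.mem_filter.1 ht).2
    have := τ.inter_subset_convexHull hs ht' ⟨hb, hxt⟩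
    rw [← Finset.coe_inter] at this
    exact ⟨t, ht, (subset_of_barycenter_mem (τ.indep hs) Finset.inter_subset_left this hne).trans
      Finset.inter_subset_right⟩
  · rintro ⟨hne, t, ht, hst⟩
    exact τ.down_closed (Finset.mem_filter.1 ht).2 hst hne

theorem eq_of_triangles_eq {τ' : Geometry.SimplicialComplex ℝ Plane} (h : IsTriangulation P τ)
    (h' : IsTriangulation P τ') (hP : Planar P) (he : triangles P τ = triangles P τ') : τ = τ' := by
  ext s
  rw [h.faces_eq hP, h'.faces_eq hP, he]

end IsTriangulation

/-! ### Points on a line -/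

/-- On a line there is only one triangulation: its faces are the simplices without further
points of `P`. -/
theorem IsTriangulation.faces_eq_of_line {P : Finset Plane} {f : Plane → ℝ} (hf : IsAff f)
    {p q : Plane} (hpq : f p ≠ f q) (hP : ∀ x ∈ P, f x = 0)
    {τ : Geometry.SimplicialComplex ℝ Plane} (h : IsTriangulation P τ) :
    τ.faces = {s | s.Nonempty ∧ s ⊆ P ∧ AffineIndependent ℝ ((↑) : s → Plane) ∧
      ∀ x ∈ P, x ∈ hull s → x ∈ s} := by
  ext s
  constructor
  · intro hs
    exact ⟨τ.nonempty_of_mem_faces hs, h.subset hs, τ.indep hs, fun x => h.mem_of_mem_hull hs⟩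
  · rintro ⟨hne, hsP, hi, he⟩
    have hb := barycenter_mem hne
    have : ∑ p ∈ s, ((s.card : ℝ)⁻¹) • p ∈ τ.space := by
      rw [h.space_eq]; exact hull_mono hsP hb
    obtain ⟨t, ht, hxt⟩ := Geometry.SimplicialComplex.mem_space_iff.1 this
    have htP := h.subset ht
    have := convexHull_inter_of_line hf hpq (fun x hx => hP x (hsP hx)) (fun x hx => hP x (htP hx))
      (fun x hx => he x (htP hx)) (fun x hx => h.mem_of_mem_hull ht (hsP hx)) hb hxt
    rw [← Finset.coe_inter] at this
    exact τ.down_closed ht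
      ((subset_of_barycenter_mem hi Finset.inter_subset_left this hne).trans
        Finset.inter_subset_right) hne

theorem card_le_two_of_line {s : Finset Plane} {f : Plane → ℝ} (hf : IsAff f)
    {p q : Plane} (hpq : f p ≠ f q) (hs : ∀ x ∈ s, f x = 0)
    (hi : AffineIndependent ℝ ((↑) : s → Plane)) : s.card ≤ 2 := by
  by_contra! hc
  obtain ⟨t, hts, ht⟩ := Finset.exists_subset_card_eq (show 3 ≤ s.card by omega)
  have hn := (affineIndependent_iff_nondeg ht).1 (affineIndependent_mono hi hts)
  have := not_isAff_const_of_nondeg hf hn (fun x hx => hs x (hts hx))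
  exact hpq (by rw [this, this])

theorem exists_isTriangulation_of_line {P : Finset Plane} {f : Plane → ℝ} (hf : IsAff f)
    {p q : Plane} (hpq : f p ≠ f q) (hP : ∀ x ∈ P, f x = 0) :
    ∃ τ, IsTriangulation P τ := by
  let τ : Geometry.SimplicialComplex ℝ Plane :=
    { faces := {s | s.Nonempty ∧ s ⊆ P ∧ AffineIndependent ℝ ((↑) : s → Plane) ∧
        ∀ x ∈ P, x ∈ hull s → x ∈ s}
      isRelLowerSet_faces := by
        rintro s ⟨hne, hsP, hi, he⟩
        refine ⟨hne, fun r hr hrne => ⟨hrne, hr.trans hsP, affineIndependent_mono hi hr, ?_⟩⟩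
        intro x hx hxr
        have hxs := he x hx (hull_mono hr hxr)
        have := (hi.convexHull_inter (Finset.singleton_subset_iff.2 hxs) hr).ge
          ⟨subset_convexHull ℝ _ (by simp), hxr⟩
        by_contra hxn
        rw [← Finset.coe_inter, Finset.singleton_inter_of_notMem hxn] at this
        simp at this
      indep := fun hs => hs.2.2.1
      inter_subset_convexHull := by
        rintro s t ⟨-, hsP, -, he⟩ ⟨-, htP, -, he'⟩ x ⟨hxs, hxt⟩
        exact convexHull_inter_of_line hf hpq (fun x hx => hP x (hsP hx))
          (fun x hx => hP x (htP hx)) (fun x hx => he x (htP hx)) (fun x hx => he' x (hsP hx))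
          hxs hxt }
  refine ⟨τ, ?_, ?_⟩
  · ext x
    rw [Geometry.SimplicialComplex.mem_vertices]
    constructor
    · rintro ⟨-, h, -⟩
      exact_mod_cast Finset.singleton_subset_iff.1 h
    · intro hx
      have : AffineIndependent ℝ ((↑) : ({x} : Finset Plane) → Plane) := by
        have := affineIndependent_pair x x
        rwa [Finset.pair_eq_singleton] at this
      refine ⟨by simp, by simpa using hx, this, fun y _ hy => ?_⟩
      rw [hull, Finset.coe_singleton, convexHull_singleton] at hy
      simpa using hy
  · ext x
    rw [Geometry.SimplicialComplex.mem_space_iff]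
    constructor
    · rintro ⟨s, ⟨-, hs, -⟩, hx⟩
      exact hull_mono hs hx
    · intro hx
      -- a shortest segment between points of `P` that contains `x`
      let S := (P ×ˢ P).filter (fun ab => x ∈ segment ℝ ab.1 ab.2)
      have hS : S.Nonempty := by
        rw [convexHull_eq_union] at hx
        simp only [Set.mem_iUnion] at hx
        obtain ⟨t, htP, hti, hxt⟩ := hx
        have hc : t.card ≤ 2 := card_le_two_of_line hf hpq (fun y hy => hP y (htP hy)) hti
        obtain ⟨a, b, ha, hb, hab⟩ : ∃ a b, a ∈ t ∧ b ∈ t ∧ t = {a, b} := by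
          rcases t.eq_empty_or_nonempty with rfl | ⟨a, ha⟩
          · simp at hxt
          · rcases (show t.card = 1 ∨ t.card = 2 by
              have := Finset.card_pos.2 ⟨a, ha⟩; omega) with h1 | h2
            · obtain ⟨b, rfl⟩ := Finset.card_eq_one.1 h1
              exact ⟨b, b, by simp, by simp, by simp⟩
            · obtain ⟨b, c, -, rfl⟩ := Finset.card_eq_two.1 h2
              exact ⟨b, c, by simp, by simp, rfl⟩
        refine ⟨(a, b), Finset.mem_filter.2 ⟨Finset.mem_product.2 ⟨htP ha, htP hb⟩, ?_⟩⟩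
        rw [hab] at hxt
        rwa [← convexHull_pair, ← Finset.coe_pair]
      obtain ⟨⟨a, b⟩, hab, hmin⟩ := S.exists_min_image (fun ab => dist ab.1 ab.2) hS
      simp only [S, Finset.mem_filter, Finset.mem_product] at hab hmin
      obtain ⟨⟨ha, hb⟩, hxab⟩ := hab
      have hh : hull {a, b} = segment ℝ a b := by
        rw [hull, Finset.coe_pair, convexHull_pair]
      refine ⟨{a, b}, ⟨by simp, ?_, affineIndependent_pair a b, ?_⟩, hh.ge hxab⟩
      · intro y hy; simp at hy; rcases hy with rfl | rfl <;> assumption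
      · intro y hy hyab
        rw [hh] at hyab
        by_contra hne
        simp only [Finset.mem_insert, Finset.mem_singleton, not_or] at hne
        have hd := dist_add_dist_of_mem_segment hyab
        have h1 : 0 < dist a y := dist_pos.2 (Ne.symm hne.1)
        have h2 : 0 < dist y b := dist_pos.2 hne.2
        have : x ∈ segment ℝ a y ∨ x ∈ segment ℝ y b := by
          rw [segment_eq_image_lineMap] at hxab hyab
          obtain ⟨r, hr, rfl⟩ := hxab
          obtain ⟨r', hr', rfl⟩ := hyab
          rcases le_total r r' with hle | hle
          · left
            rcases eq_or_lt_of_le hr'.1 with h0 | h0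
            · have : r = 0 := by linarith [hr.1]
              subst this; simp [left_mem_segment]
            · rw [segment_eq_image_lineMap]
              refine ⟨r / r', ⟨div_nonneg hr.1 h0.le, div_le_one_of_le₀ hle h0.le⟩, ?_⟩
              apply plane_ext <;>
              · simp [AffineMap.lineMap_apply]; field_simp
          · right
            rw [segment_symm, segment_eq_image_lineMap]
            rcases eq_or_lt_of_le hr'.2 with h0 | h0
            · have : r = 1 := by linarith [hr.2]
              subst this; exact ⟨0, by simp, by simp⟩
            · have h0' : 0 < 1 - r' := by linarith
              refine ⟨(1 - r) / (1 - r'), ⟨div_nonneg (by linarith [hr.2]) h0'.le,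
                div_le_one_of_le₀ (by linarith) h0'.le⟩, ?_⟩
              apply plane_ext <;>
              · simp [AffineMap.lineMap_apply]; field_simp; ring
        rcases this with hs | hs
        · have := hmin (a, y) ⟨⟨ha, hy⟩, hs⟩
          simp only at this; linarith
        · have := hmin (y, b) ⟨⟨hy, hb⟩, hs⟩
          simp only at this; linarith

/-! ### Existence of a triangulation -/

/-- The affine function that takes the values of `h` at `a`, `b`, `c`. -/
def interp (h : Plane → ℝ) (a b c x : Plane) : ℝ :=
  (orient b c x * h a + orient c a x * h b + orient a b x * h c) / orient a b c

theorem isAff_interp (h : Plane → ℝ) (a b c : Plane) : IsAff (interp h a b c) := by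
  obtain ⟨α, β, γ, h1⟩ := isAff_orient b c
  obtain ⟨α', β', γ', h2⟩ := isAff_orient c a
  obtain ⟨α'', β'', γ'', h3⟩ := isAff_orient a b
  refine ⟨(α * h a + α' * h b + α'' * h c) / orient a b c,
    (β * h a + β' * h b + β'' * h c) / orient a b c,
    (γ * h a + γ' * h b + γ'' * h c) / orient a b c, fun x => ?_⟩
  unfold interp
  rw [h1, h2, h3]; ring

theorem interp_apply (h : Plane → ℝ) {a b c : Plane} (h0 : orient a b c ≠ 0) {x : Plane}
    (hx : x ∈ ({a, b, c} : Finset Plane)) : interp h a b c x = h x := by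
  simp only [Finset.mem_insert, Finset.mem_singleton] at hx
  unfold interp
  rw [div_eq_iff h0]
  rcases hx with rfl | rfl | rfl
  · rw [orient_rot]; simp; ring
  · simp [orient_rot' a x c]; ring
  · simp; ring

/-- The largest multiple of `m` that can be subtracted from the positive coordinates `l` without
making one of them negative is determined by some index `i`. -/
theorem exists_min_ratio (l m : Fin 3 → ℝ) (hl : ∀ i, 0 < l i) (hm : ∃ i, 0 < m i) :
    ∃ i, 0 < m i ∧ ∀ j, l i * m j ≤ l j * m i := by
  obtain ⟨i₀, hi₀⟩ := hm
  obtain ⟨i, hi, hmin⟩ := (Finset.univ.filter (fun i => 0 < m i)).exists_min_image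
    (fun i => l i / m i) ⟨i₀, by simpa using hi₀⟩
  simp only [Finset.mem_filter, Finset.mem_univ, true_and] at hi hmin
  refine ⟨i, hi, fun j => ?_⟩
  rcases le_or_gt (m j) 0 with h | h
  · have h1 := hl i; have h2 := hl j
    nlinarith [mul_pos h2 hi, mul_nonneg h1.le (neg_nonneg.2 h)]
  · have := hmin j h
    rwa [div_le_div_iff₀ hi h] at this

/-- Heights over a point set that lie strictly above some affine function through each single one,
and no four of which over a triangle and a further point are coplanar. -/
structure GenericHeight (P : Finset Plane) (h : Plane → ℝ) : Prop where
  vertex : ∀ p ∈ P, ∃ m, IsAff m ∧ m p = h p ∧ ∀ q ∈ P, q ≠ p → m q < h q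
  generic : ∀ a ∈ P, ∀ b ∈ P, ∀ c ∈ P, 0 < orient a b c → ∀ q ∈ P,
    q ∉ ({a, b, c} : Finset Plane) → interp h a b c q ≠ h q

theorem eventually_notMem_of_finite {S : Set ℝ} (hS : S.Finite) : ∀ᶠ ε in 𝓝[>] (0 : ℝ), ε ∉ S := by
  have h1 : (S \ {0})ᶜ ∈ 𝓝 (0 : ℝ) :=
    (hS.subset Set.sdiff_subset).isClosed.isOpen_compl.mem_nhds (by simp)
  filter_upwards [mem_nhdsWithin_of_mem_nhds h1, self_mem_nhdsWithin] with ε hε hε0 hmem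
  exact hε ⟨hmem, (ne_of_gt hε0)⟩

/-- Small generic perturbations of the paraboloid are generic heights. -/
theorem exists_genericHeight (P : Finset Plane) : ∃ h, GenericHeight P h := by
  obtain ⟨k, hk⟩ : ∃ k : Plane → ℕ, Set.InjOn k P := by
    refine ⟨fun x => if hx : x ∈ P then P.equivFin ⟨x, hx⟩ else 0, fun x hx y hy hxy => ?_⟩
    have hx : x ∈ P := hx
    have hy : y ∈ P := hy
    simpa [hx, hy, Fin.val_inj] using hxy
  let h : ℝ → Plane → ℝ := fun ε p => p 0 ^ 2 + p 1 ^ 2 + ε ^ (k p + 1)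
  have hv : ∀ᶠ ε in 𝓝[>] (0 : ℝ), ∀ p ∈ P, ∀ q ∈ P, q ≠ p →
      0 < (q 0 - p 0) ^ 2 + (q 1 - p 1) ^ 2 + ε ^ (k q + 1) - ε ^ (k p + 1) := by
    rw [Finset.eventually_all P]
    intro p hp
    rw [Finset.eventually_all P]
    intro q hq
    by_cases hqp : q = p
    · exact Eventually.of_forall fun _ h => absurd hqp h
    have hpos : 0 < (q 0 - p 0) ^ 2 + (q 1 - p 1) ^ 2 := by
      by_contra! hle
      have h1 : q 0 - p 0 = 0 := by nlinarith [sq_nonneg (q 0 - p 0), sq_nonneg (q 1 - p 1)]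
      have h2 : q 1 - p 1 = 0 := by nlinarith [sq_nonneg (q 0 - p 0), sq_nonneg (q 1 - p 1)]
      exact hqp (plane_ext (by linarith) (by linarith))
    have hc : Continuous fun ε : ℝ =>
        (q 0 - p 0) ^ 2 + (q 1 - p 1) ^ 2 + ε ^ (k q + 1) - ε ^ (k p + 1) := by fun_prop
    have := (hc.tendsto 0).eventually (lt_mem_nhds (a := 0) (by simpa using hpos))
    exact (this.filter_mono nhdsWithin_le_nhds).mono fun ε hε _ => hε
  have hg : ∀ᶠ ε in 𝓝[>] (0 : ℝ), ∀ a ∈ P, ∀ b ∈ P, ∀ c ∈ P, ∀ q ∈ P, 0 < orient a b c →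
      q ∉ ({a, b, c} : Finset Plane) → interp (h ε) a b c q ≠ h ε q := by
    rw [Finset.eventually_all P]; intro a ha
    rw [Finset.eventually_all P]; intro b hb
    rw [Finset.eventually_all P]; intro c hc
    rw [Finset.eventually_all P]; intro q hq
    by_cases h0 : 0 < orient a b c
    swap
    · exact Eventually.of_forall fun _ h => absurd h h0
    by_cases hq' : q ∈ ({a, b, c} : Finset Plane)
    · exact Eventually.of_forall fun _ _ h => absurd hq' h
    simp only [Finset.mem_insert, Finset.mem_singleton, not_or] at hq'
    -- the coefficient of the power belonging to `q` is the nonzero number `orient a b c`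
    obtain ⟨A, hA⟩ : ∃ A, A = orient b c q * (a 0 ^ 2 + a 1 ^ 2) + orient c a q * (b 0 ^ 2 + b 1 ^ 2)
        + orient a b q * (c 0 ^ 2 + c 1 ^ 2) - orient a b c * (q 0 ^ 2 + q 1 ^ 2) := ⟨_, rfl⟩
    let R : Polynomial ℝ := Polynomial.C A
      + Polynomial.C (orient b c q) * Polynomial.X ^ (k a + 1)
      + Polynomial.C (orient c a q) * Polynomial.X ^ (k b + 1)
      + Polynomial.C (orient a b q) * Polynomial.X ^ (k c + 1)
      - Polynomial.C (orient a b c) * Polynomial.X ^ (k q + 1)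
    have hR : R ≠ 0 := by
      intro hR0
      have := congrArg (fun S => Polynomial.coeff S (k q + 1)) hR0
      have e1 : ¬ k q = k a := fun e => hq'.1 (hk hq ha e)
      have e2 : ¬ k q = k b := fun e => hq'.2.1 (hk hq hb e)
      have e3 : ¬ k q = k c := fun e => hq'.2.2 (hk hq hc e)
      simp [R, Polynomial.coeff_X_pow, e1, e2, e3] at this
      exact h0.ne' this
    have hfin : {ε | R.eval ε = 0}.Finite := by
      refine (R.roots.toFinset.finite_toSet).subset fun ε hε => ?_
      simpa [hR] using hε
    refine (eventually_notMem_of_finite hfin).mono fun ε hε _ _ he => hε ?_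
    unfold interp at he
    rw [div_eq_iff h0.ne'] at he
    simp only [R, h, Set.mem_ofPred_eq, Polynomial.eval_add, Polynomial.eval_sub,
      Polynomial.eval_mul, Polynomial.eval_C, Polynomial.eval_pow, Polynomial.eval_X] at he ⊢
    linear_combination he + hA
  obtain ⟨ε, hε1, hε2⟩ := (hv.and hg).exists
  refine ⟨h ε, ?_, fun a ha b hb c hc h0 q hq => hε2 a ha b hb c hc q hq h0⟩
  intro p hp
  refine ⟨fun x => 2 * p 0 * x 0 + 2 * p 1 * x 1 + (ε ^ (k p + 1) - p 0 ^ 2 - p 1 ^ 2),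
    ⟨_, _, _, fun x => rfl⟩, by simp only [h]; ring, fun q hq hqp => ?_⟩
  have := hε1 p hp q hq hqp
  simp only [h]
  nlinarith

/-- One exchange step: if the height of `q` is below the plane over the triangle `a b c`, and `c` is
the vertex to leave, then the triangle `a b q` has a lower plane at `x`. -/
theorem interp_exchange {h : Plane → ℝ} {a b c q x : Plane} (h0 : 0 < orient a b c)
    (h3 : 0 < orient a b x) (hq : h q < interp h a b c q) (hm : 0 < orient a b q)
    (hm1 : orient a b x * orient b c q ≤ orient b c x * orient a b q)
    (hm2 : orient a b x * orient c a q ≤ orient c a x * orient a b q) :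
    x ∈ hull {a, b, q} ∧ interp h a b q x < interp h a b c x := by
  constructor
  · rw [hull_triple, mem_triangle hm]
    refine ⟨h3.le, ?_, ?_⟩
    · have e : orient a b c * orient b q x =
          orient b c x * orient a b q - orient a b x * orient b c q := by unfold orient; ring
      by_contra! hn
      nlinarith [mul_neg_of_pos_of_neg h0 hn]
    · have e : orient a b c * orient q a x =
          orient c a x * orient a b q - orient a b x * orient c a q := by unfold orient; ring
      by_contra! hn
      nlinarith [mul_neg_of_pos_of_neg h0 hn]
  · have e := (isAff_interp h a b c).bary a b q x
    rw [interp_apply h h0.ne' (x := a) (by simp), interp_apply h h0.ne' (x := b) (by simp)] at e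
    conv_lhs => unfold interp
    rw [div_lt_iff₀ hm]
    nlinarith [mul_lt_mul_of_pos_left hq h3]

theorem interp_rot (h : Plane → ℝ) (a b c x : Plane) : interp h b c a x = interp h a b c x := by
  unfold interp
  rw [orient_rot a b c]; ring

/-- The regular triangulation of generic heights. -/
theorem GenericHeight.isTri {P : Finset Plane} {h : Plane → ℝ} (hh : GenericHeight P h)
    (hP : Planar P) : ∃ T, IsTri P T := by
  let T : Finset (Finset Plane) := P.powerset.filter (fun t => ∃ a b c, t = {a, b, c} ∧
    0 < orient a b c ∧ ∀ q ∈ P, q ∉ t → interp h a b c q < h q)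
  have hT : ∀ t, t ∈ T ↔ t ⊆ P ∧ ∃ a b c, t = {a, b, c} ∧
    0 < orient a b c ∧ ∀ q ∈ P, q ∉ t → interp h a b c q < h q := by simp [T]
  -- the lower supporting affine function of a triangle in `T`
  have hsupp : ∀ t ∈ T, ∃ f, IsAff f ∧ (∀ q ∈ t, f q = h q) ∧ ∀ q ∈ P, q ∉ t → f q < h q := by
    intro t ht
    obtain ⟨-, a, b, c, rfl, h0, hlt⟩ := (hT t).1 ht
    exact ⟨_, isAff_interp h a b c, fun q hq => interp_apply h h0.ne' hq, hlt⟩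
  refine ⟨T, ?_, ?_, ?_, ?_, ?_⟩
  · intro t ht
    obtain ⟨-, a, b, c, e, h0, -⟩ := (hT t).1 ht
    exact ⟨a, b, c, e, h0⟩
  · exact fun t ht => ((hT t).1 ht).1
  · intro t ht p hp hpt
    have htP := ((hT t).1 ht).1
    obtain ⟨f, hf, hft, hfl⟩ := hsupp t ht
    obtain ⟨m, hm, hmp, hml⟩ := hh.vertex p hp
    have hm' : ∀ q ∈ P, m q ≤ h q := fun q hq => by
      by_cases e : q = p
      · rw [e, hmp]
      · exact (hml q hq e).le
    have hf' : ∀ q ∈ P, f q ≤ h q := fun q hq => by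
      by_cases e : q ∈ t
      · exact (hft q e).le
      · exact (hfl q hq e).le
    have := (hf.sub hm).mem_face (s := t)
      (fun q hq => by rw [hft q hq]; linarith [hm' q (htP hq)]) hpt (by linarith [hf' p hp])
    by_contra hpn
    have hem : {q | q ∈ t ∧ f q - m q = 0} = ∅ := by
      ext q
      simp only [Set.mem_ofPred_eq, Set.mem_empty_iff_false, iff_false, not_and]
      intro hq h0
      rw [hft q hq] at h0
      have := hml q (htP hq) (fun e => hpn (e ▸ hq))
      linarith
    rw [hem] at this
    simp at this
  · intro s hs t ht hst
    have hsP := ((hT s).1 hs).1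
    have htP := ((hT t).1 ht).1
    obtain ⟨f, hf, hfs, hfl⟩ := hsupp s hs
    obtain ⟨g, hg, hgt, hgl⟩ := hsupp t ht
    have hf' : ∀ q ∈ P, f q ≤ h q := fun q hq => by
      by_cases e : q ∈ s
      · exact (hfs q e).le
      · exact (hfl q hq e).le
    have hg' : ∀ q ∈ P, g q ≤ h q := fun q hq => by
      by_cases e : q ∈ t
      · exact (hgt q e).le
      · exact (hgl q hq e).le
    refine measure_mono_null (t := hull (s ∩ t)) ?_ (volume_hull_of_card_le_two ?_)
    · rintro x ⟨hxs, hxt⟩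
      have h1 := (hg.sub hf).nonpos_of_mem (s := (s : Set Plane))
        (fun q hq => by rw [hfs q hq]; linarith [hg' q (hsP hq)]) hxs
      have := (hg.sub hf).mem_face (s := t)
        (fun q hq => by rw [hgt q hq]; linarith [hf' q (htP hq)]) hxt h1
      refine convexHull_mono ?_ this
      rintro q ⟨hq, hq0⟩
      rw [Finset.coe_inter]
      refine ⟨?_, hq⟩
      by_contra hqs
      have := hfl q (htP hq) hqs
      rw [hgt q hq] at hq0
      linarith
    · by_contra! hc
      have hn : ∀ t ∈ T, t.card = 3 := by
        intro t ht
        obtain ⟨-, a, b, c, e, h0, -⟩ := (hT t).1 ht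
        exact Nondeg.card ⟨a, b, c, e, h0⟩
      have e1 : s ∩ t = s := Finset.eq_of_subset_of_card_le Finset.inter_subset_left
        (by rw [hn s hs]; omega)
      have e2 : s ∩ t = t := Finset.eq_of_subset_of_card_le Finset.inter_subset_right
        (by rw [hn t ht]; omega)
      exact hst (e1.symm.trans e2)
  · -- a point on no line through two points of `P` is covered
    have hnull : volume (⋃ ab ∈ ((P ×ˢ P).filter (fun ab => ab.1 ≠ ab.2) : Set (Plane × Plane)),
        {x | orient ab.1 ab.2 x = 0}) = 0 := by
      rw [measure_biUnion_null_iff (Finset.countable_toSet _)]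
      intro ab hab
      exact volume_line (by simpa using (Finset.mem_filter.1 hab).2)
    refine measure_mono_null ?_ hnull
    rintro x ⟨hx, hxn⟩
    by_contra hxl
    have hgen : ∀ a ∈ P, ∀ b ∈ P, a ≠ b → orient a b x ≠ 0 := by
      intro a ha b hb hab h0
      refine hxl ?_
      simp only [Set.mem_iUnion]
      exact ⟨(a, b), by simpa using ⟨⟨ha, hb⟩, hab⟩, h0⟩
    apply hxn
    let S := (P ×ˢ P ×ˢ P).filter (fun u => 0 < orient u.1 u.2.1 u.2.2 ∧
      x ∈ hull {u.1, u.2.1, u.2.2})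
    have hS : ∀ a b c, (a, b, c) ∈ S ↔ (a ∈ P ∧ b ∈ P ∧ c ∈ P) ∧ 0 < orient a b c ∧
        x ∈ hull {a, b, c} := by intro a b c; simp [S]
    have hSne : S.Nonempty := by
      have hx' := hx
      rw [hull, convexHull_eq_union] at hx'
      simp only [Set.mem_iUnion] at hx'
      obtain ⟨t, htP, hti, hxt⟩ := hx'
      have htP : t ⊆ P := by exact_mod_cast htP
      have h3 : t.card ≤ 3 := by
        have := hti.card_le_finrank_succ
        have h2 := (vectorSpan ℝ (Set.range ((↑) : t → Plane))).finrank_le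
        have h2' : Module.finrank ℝ Plane = 2 := by simp
        simp only [Fintype.card_coe] at this
        omega
      have h3' : ¬ t.card ≤ 2 := by
        intro hc
        -- otherwise `x` lies on a line through two points of `P`
        obtain ⟨a, ha, b, hb, hab, htab⟩ : ∃ a ∈ P, ∃ b ∈ P, a ≠ b ∧ t ⊆ {a, b} := by
          obtain ⟨r, hrP, hr⟩ := hP
          have hPc : 3 ≤ P.card := hr.card ▸ Finset.card_le_card hrP
          obtain ⟨u, htu, huP, huc⟩ := Finset.exists_subsuperset_card_eq htP hc (by omega)
          obtain ⟨a, b, hab, rfl⟩ := Finset.card_eq_two.1 huc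
          exact ⟨a, huP (by simp), b, huP (by simp), hab, htu⟩
        refine hgen a ha b hb hab ((isAff_orient a b).zero_of_mem (s := (t : Set Plane)) ?_ hxt)
        intro p hp
        have := htab hp
        simp only [Finset.mem_insert, Finset.mem_singleton] at this
        rcases this with rfl | rfl <;> simp
      obtain ⟨a, b, c, rfl, h0⟩ := (affineIndependent_iff_nondeg (by omega)).1 hti
      exact ⟨(a, b, c), (hS a b c).2 ⟨⟨htP (by simp), htP (by simp), htP (by simp)⟩, h0, hxt⟩⟩
    obtain ⟨⟨a, b, c⟩, habc, hmin⟩ := S.exists_min_image (fun u => interp h u.1 u.2.1 u.2.2 x) hSne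
    obtain ⟨⟨ha, hb, hc⟩, h0, hxt⟩ := (hS a b c).1 habc
    have hxt' := hxt
    rw [hull_triple, mem_triangle h0] at hxt'
    obtain ⟨hab, hbc, hac⟩ := orient_ne h0.ne'
    have p1 : 0 < orient a b x := lt_of_le_of_ne hxt'.1 (hgen a ha b hb hab).symm
    have p2 : 0 < orient b c x := lt_of_le_of_ne hxt'.2.1 (hgen b hb c hc hbc).symm
    have p3 : 0 < orient c a x := lt_of_le_of_ne hxt'.2.2 (hgen c hc a ha hac.symm).symm
    simp only [Set.mem_iUnion]
    refine ⟨{a, b, c}, (hT _).2 ⟨?_, a, b, c, rfl, h0, ?_⟩, hxt⟩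
    · intro y hy; simp at hy; rcases hy with rfl | rfl | rfl <;> assumption
    · intro q hq hqt
      by_contra! hle
      have hlt := lt_of_le_of_ne hle (hh.generic a ha b hb c hc h0 q hq hqt).symm
      have hsum := orient_add a b c q
      obtain ⟨i, hi, hij⟩ := exists_min_ratio ![orient a b x, orient b c x, orient c a x]
        ![orient a b q, orient b c q, orient c a q] (by intro i; fin_cases i <;> simpa)
        (by
          by_contra! hn
          have n0 := hn 0; have n1 := hn 1; have n2 := hn 2
          simp at n0 n1 n2
          linarith)
      have j0 := hij 0; have j1 := hij 1; have j2 := hij 2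
      have r1 : orient b c a = orient a b c := orient_rot _ _ _
      have r2 : orient c a b = orient a b c := orient_rot' _ _ _
      fin_cases i <;> simp at hi j0 j1 j2
      · obtain ⟨hm, hl⟩ := interp_exchange h0 p1 hlt hi j1 j2
        have := hmin (a, b, q) ((hS _ _ _).2 ⟨⟨ha, hb, hq⟩, hi, hm⟩)
        simp only at this; linarith
      · obtain ⟨hm, hl⟩ := interp_exchange (r1 ▸ h0) p2 (by rwa [interp_rot h a b c]) hi j2 j0
        have := hmin (b, c, q) ((hS _ _ _).2 ⟨⟨hb, hc, hq⟩, hi, hm⟩)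
        rw [interp_rot h a b c] at hl
        simp only at this; linarith
      · obtain ⟨hm, hl⟩ := interp_exchange (r2 ▸ h0) p3 (by rwa [← interp_rot h c a b])
          hi j0 j1
        have := hmin (c, a, q) ((hS _ _ _).2 ⟨⟨hc, ha, hq⟩, hi, hm⟩)
        rw [← interp_rot h c a b] at hl
        simp only at this; linarith

theorem exists_isTri {P : Finset Plane} (hP : Planar P) : ∃ T, IsTri P T := by
  obtain ⟨h, hh⟩ := exists_genericHeight P
  exact hh.isTri hP

/-! ### Angles in coordinates -/

/-- The inner product of `a - p` and `b - p`. -/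
def dot (p a b : Plane) : ℝ := (a 0 - p 0) * (b 0 - p 0) + (a 1 - p 1) * (b 1 - p 1)

theorem angle_eq {a p b : Plane} (h : orient p a b ≠ 0) :
    EuclideanGeometry.angle a p b = Real.pi / 2 - Real.arctan (dot p a b / |orient p a b|) := by
  have hk : 0 < |orient p a b| := abs_pos.2 h
  have hin : inner ℝ (a - p) (b - p) = dot p a b := by
    simp [PiLp.inner_apply, dot, Fin.sum_univ_two]; ring
  have hn : ‖a - p‖ * ‖b - p‖ = √(dot p a b ^ 2 + |orient p a b| ^ 2) := by
    rw [EuclideanSpace.norm_eq, EuclideanSpace.norm_eq, ← Real.sqrt_mul (by positivity), sq_abs]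
    congr 1
    simp only [Fin.sum_univ_two, PiLp.sub_apply, Real.norm_eq_abs, sq_abs, dot, orient]
    ring
  have hs : √(dot p a b ^ 2 + |orient p a b| ^ 2)
      = |orient p a b| * √(1 + (dot p a b / |orient p a b|) ^ 2) := by
    rw [show dot p a b ^ 2 + |orient p a b| ^ 2
      = |orient p a b| ^ 2 * (1 + (dot p a b / |orient p a b|) ^ 2) by field_simp; ring,
      Real.sqrt_mul (by positivity), Real.sqrt_sq hk.le]
  rw [EuclideanGeometry.angle, InnerProductGeometry.angle, vsub_eq_sub, vsub_eq_sub, hin, hn, hs,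
    Real.arccos, Real.arctan_eq_arcsin, div_div]

theorem angle_lt {a p b a' p' b' : Plane} (h : orient p a b ≠ 0) (h' : orient p' a' b' ≠ 0)
    (hlt : dot p' a' b' * |orient p a b| < dot p a b * |orient p' a' b'|) :
    EuclideanGeometry.angle a p b < EuclideanGeometry.angle a' p' b' := by
  rw [angle_eq h, angle_eq h']
  have := Real.arctan_strictMono
    ((div_lt_div_iff₀ (abs_pos.2 h') (abs_pos.2 h)).2 hlt)
  linarith

/-! ### Flipping an edge -/

theorem better_of_dominated {M N : Multiset ℝ} (hM : M ≠ 0) (h : ∀ n ∈ N, ∃ m ∈ M, m < n) :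
    Better M N := by
  obtain ⟨x, hx⟩ := Multiset.exists_mem_of_ne_zero hM
  obtain ⟨l, hl, hmin⟩ := M.toFinset.exists_min_image id ⟨x, by simpa using hx⟩
  simp only [Multiset.mem_toFinset, id] at hl hmin
  refine better_of_forall_lt hmin hl fun z hz => ?_
  obtain ⟨m, hm, hmz⟩ := h z hz
  exact (hmin m hm).trans_lt hmz

/-- The two triangles cut from a convex quadrilateral `a d b c` by the diagonal `a b`. -/
theorem isTri_quad {a b c d : Plane} (h1 : 0 < orient a b c) (h2 : 0 < orient b a d)
    (h3 : 0 < orient a d c) (h4 : 0 < orient d b c) :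
    IsTri {a, b, c, d} {{a, b, c}, {b, a, d}} := by
  have hd : orient a b d < 0 := by rw [orient_swap] at h2; linarith
  have hc : orient b a c < 0 := by rw [orient_swap]; linarith
  have e1 : orient b c d = orient d b c := (orient_rot d b c)
  have e2 : orient c a d = orient a d c := orient_rot' a d c
  have e3 : orient a d b = orient b a d := orient_rot b a d
  have e4 : orient d b a = orient b a d := (orient_rot' b a d)
  have e5 : orient b c a = orient a b c := orient_rot a b c
  have e6 : orient c a b = orient a b c := orient_rot' a b c
  refine ⟨?_, ?_, ?_, ?_, ?_⟩
  · intro t ht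
    simp only [Finset.mem_insert, Finset.mem_singleton] at ht
    rcases ht with rfl | rfl
    · exact nondeg_triple h1.ne'
    · exact nondeg_triple h2.ne'
  · intro t ht x hx
    simp only [Finset.mem_insert, Finset.mem_singleton] at ht
    rcases ht with rfl | rfl <;> simp at hx ⊢ <;> tauto
  · intro t ht p hp hpt
    simp only [Finset.mem_insert, Finset.mem_singleton] at ht hp
    rcases ht with rfl | rfl
    · rw [hull_triple, mem_triangle h1] at hpt
      rcases hp with rfl | rfl | rfl | rfl <;> simp
      linarith [hpt.1]
    · rw [hull_triple, mem_triangle h2] at hpt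
      rcases hp with rfl | rfl | rfl | rfl <;> simp
      linarith [hpt.1]
  · have key : volume (hull {a, b, c} ∩ hull {b, a, d}) = 0 := by
      refine measure_mono_null ?_ (volume_line (orient_ne h1.ne').1)
      rintro x ⟨hx1, hx2⟩
      rw [hull_triple, mem_triangle h1] at hx1
      rw [hull_triple, mem_triangle h2, orient_swap] at hx2
      exact le_antisymm (by linarith [hx2.1]) hx1.1
    intro s hs t ht hst
    simp only [Finset.mem_insert, Finset.mem_singleton] at hs ht
    rcases hs with rfl | rfl <;> rcases ht with rfl | rfl
    · exact absurd rfl hst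
    · exact key
    · rw [Set.inter_comm]; exact key
    · exact absurd rfl hst
  · convert measure_empty (μ := (volume : Measure Plane))
    rw [Set.sdiff_eq_empty]
    intro x hx
    have nn : ∀ u v : Plane, 0 ≤ orient u v a → 0 ≤ orient u v b → 0 ≤ orient u v c →
        0 ≤ orient u v d → 0 ≤ orient u v x := by
      intro u v ha hb hc hd
      refine (isAff_orient u v).nonneg_of_mem (fun p hp => ?_) hx
      simp only [Finset.coe_insert, Finset.coe_singleton] at hp
      rcases hp with rfl | rfl | rfl | rfl <;> assumption
    simp only [Set.mem_iUnion]
    rcases le_total 0 (orient a b x) with h0 | h0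
    · refine ⟨{a, b, c}, by simp, ?_⟩
      rw [hull_triple, mem_triangle h1]
      exact ⟨h0, nn b c (by linarith) (by simp) (by simp) (by linarith),
        nn c a (by simp) (by linarith) (by simp) (by linarith)⟩
    · refine ⟨{b, a, d}, by simp, ?_⟩
      rw [hull_triple, mem_triangle h2]
      exact ⟨by rw [orient_swap]; linarith, nn a d (by simp) (by linarith) (by linarith) (by simp),
        nn d b (by linarith) (by simp) (by linarith) (by simp)⟩

/-- The paraboloid `‖x‖ ^ 2`. -/
def parab (x : Plane) : ℝ := x 0 ^ 2 + x 1 ^ 2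

/-- The incircle determinant, for a counterclockwise triangle `a b c` positive exactly when `p` lies
strictly inside the circumcircle: there the paraboloid is below the plane over `a b c`. -/
def incirc (a b c p : Plane) : ℝ :=
  orient b c p * parab a + orient c a p * parab b + orient a b p * parab c - orient a b c * parab p

theorem incirc_eq {a b c : Plane} (h : orient a b c ≠ 0) (p : Plane) :
    incirc a b c p = orient a b c * (interp parab a b c p - parab p) := by
  unfold incirc interp; field_simp

theorem sq_dist_pos {a b : Plane} (h : a ≠ b) : 0 < (a 0 - b 0) ^ 2 + (a 1 - b 1) ^ 2 := by
  by_contra! hle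
  have h1 : a 0 - b 0 = 0 := by nlinarith [sq_nonneg (a 0 - b 0), sq_nonneg (a 1 - b 1)]
  have h2 : a 1 - b 1 = 0 := by nlinarith [sq_nonneg (a 0 - b 0), sq_nonneg (a 1 - b 1)]
  exact h (plane_ext (by linarith) (by linarith))

/-- Flipping an edge `a b` whose opposite vertex `d` is inside the circumcircle of `a b c` increases
the smallest of the six angles involved. -/
theorem Opt.incirc_nonpos {P : Finset Plane} {T : Finset (Finset Plane)} (h : Opt P T)
    {a b c d : Plane} (hT : {a, b, c} ∈ T) (hT' : {a, b, d} ∈ T) (hc : 0 < orient a b c)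
    (hd : orient a b d < 0) : incirc a b c d ≤ 0 := by
  by_contra! hin
  obtain ⟨hab, hbc, hac⟩ := orient_ne hc.ne'
  obtain ⟨-, hbd, had⟩ := orient_ne hd.ne
  have h2 : 0 < orient b a d := by rw [orient_swap]; linarith
  have pab := sq_dist_pos hab
  have h3 : 0 < orient a d c := by
    have e : orient a d c * ((a 0 - b 0) ^ 2 + (a 1 - b 1) ^ 2) = incirc a b c d
        + orient b a d * ((c 0 - a 0) ^ 2 + (c 1 - a 1) ^ 2)
        + orient a b c * ((d 0 - a 0) ^ 2 + (d 1 - a 1) ^ 2) := by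
      unfold incirc parab orient; ring
    exact (mul_pos_iff_of_pos_right pab).1 (by rw [e]; positivity)
  have h4 : 0 < orient d b c := by
    have e : orient d b c * ((a 0 - b 0) ^ 2 + (a 1 - b 1) ^ 2) = incirc a b c d
        + orient b a d * ((c 0 - b 0) ^ 2 + (c 1 - b 1) ^ 2)
        + orient a b c * ((d 0 - b 0) ^ 2 + (d 1 - b 1) ^ 2) := by
      unfold incirc parab orient; ring
    exact (mul_pos_iff_of_pos_right pab).1 (by rw [e]; positivity)
  have hcd : d ≠ c := (orient_ne h3.ne').2.1
  have hW := isTri_quad hc h2 h3 h4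
  have hF : IsTri {a, b, c, d} {{d, c, a}, {c, d, b}} := by
    have := isTri_quad (a := d) (b := c) (c := a) (d := b) (by rwa [orient_rot a d c])
      (by rwa [orient_rot' d b c]) (by rwa [orient_rot' b a d]) (by rwa [orient_rot a b c])
    convert this using 1
    ext; simp; tauto
  have hWT : ({{a, b, c}, {b, a, d}} : Finset (Finset Plane)) ⊆ T := by
    intro t ht
    simp only [Finset.mem_insert, Finset.mem_singleton] at ht
    rcases ht with rfl | rfl
    · exact hT
    · rwa [Finset.insert_comm]
  have hQ : ({a, b, c, d} : Finset Plane) ⊆ P := by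
    intro x hx
    simp only [Finset.mem_insert, Finset.mem_singleton] at hx
    rcases hx with rfl | rfl | rfl | rfl
    · exact h.isTri.subset _ hT (by simp)
    · exact h.isTri.subset _ hT (by simp)
    · exact h.isTri.subset _ hT (by simp)
    · exact h.isTri.subset _ hT' (by simp)
  have n1 : ({a, b, c} : Finset Plane) ∉ ({{b, a, d}} : Finset (Finset Plane)) := by
    rw [Finset.mem_singleton]
    intro e
    have : c ∈ ({b, a, d} : Finset Plane) := by rw [← e]; simp
    simp only [Finset.mem_insert, Finset.mem_singleton] at this
    rcases this with h | h | h
    · exact hbc h.symm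
    · exact hac h.symm
    · exact hcd h.symm
  have n2 : ({d, c, a} : Finset Plane) ∉ ({{c, d, b}} : Finset (Finset Plane)) := by
    rw [Finset.mem_singleton]
    intro e
    have : a ∈ ({c, d, b} : Finset Plane) := by rw [← e]; simp
    simp only [Finset.mem_insert, Finset.mem_singleton] at this
    rcases this with h | h | h
    · exact hac h
    · exact had h
    · exact hab h
  refine (h.sub hQ hWT hW).not_better _ hF ?_ ?_
  · rw [Finset.card_insert_of_notMem n1, Finset.card_insert_of_notMem n2]; rfl
  have a1 : |orient b a c| = orient a b c := by rw [orient_swap, abs_neg, abs_of_pos hc]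
  have a1' : |orient a b c| = orient a b c := abs_of_pos hc
  have a2 : |orient a b d| = orient b a d := by rw [orient_swap, abs_neg, abs_of_pos h2]
  have a2' : |orient b a d| = orient b a d := abs_of_pos h2
  have a3 : |orient d c a| = orient a d c := by rw [orient_rot a d c, abs_of_pos h3]
  have a3' : |orient c d a| = orient a d c := by
    rw [orient_swap, abs_neg, orient_rot a d c, abs_of_pos h3]
  have a3'' : |orient a d c| = orient a d c := abs_of_pos h3
  have a4 : |orient c d b| = orient d b c := by rw [orient_rot' d b c, abs_of_pos h4]
  have a4' : |orient d c b| = orient d b c := by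
    rw [orient_swap, abs_neg, orient_rot' d b c, abs_of_pos h4]
  have a4'' : |orient b c d| = orient d b c := by rw [orient_rot d b c, abs_of_pos h4]
  have nz : ∀ {x y : ℝ}, |x| = y → 0 < y → x ≠ 0 := fun h h' => abs_pos.1 (h ▸ h')
  have pac := mul_pos (sq_dist_pos hac) h2
  have pbc := mul_pos (sq_dist_pos hbc) h2
  have l1 : EuclideanGeometry.angle a b c < EuclideanGeometry.angle c d a := by
    refine angle_lt (nz a1 hc) (nz a3 h3) ?_
    rw [a1, a3]
    have : dot b a c * orient a d c - dot d c a * orient a b c = incirc a b c d := by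
      unfold dot incirc parab orient; ring
    linarith
  have l2 : EuclideanGeometry.angle a b d < EuclideanGeometry.angle d c a := by
    refine angle_lt (nz a2' h2) (nz a3' h3) ?_
    rw [a2', a3']
    have : dot b a d * orient a d c - dot c d a * orient b a d = incirc a b c d := by
      unfold dot incirc parab orient; ring
    linarith
  have l3 : EuclideanGeometry.angle b a c < EuclideanGeometry.angle d a c := by
    refine angle_lt (nz a1' hc) (nz a3'' h3) ?_
    rw [a1', a3'']
    have : dot a b c * orient a d c - dot a d c * orient a b c
        = ((a 0 - c 0) ^ 2 + (a 1 - c 1) ^ 2) * orient b a d := by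
      unfold dot orient; ring
    linarith
  have l4 : EuclideanGeometry.angle b a d < EuclideanGeometry.angle d c b := by
    refine angle_lt (nz a2 h2) (nz a4 h4) ?_
    rw [a2, a4]
    have : dot a b d * orient d b c - dot c d b * orient b a d = incirc a b c d := by
      unfold dot incirc parab orient; ring
    linarith
  have l5 : EuclideanGeometry.angle b a c < EuclideanGeometry.angle c d b := by
    refine angle_lt (nz a1' hc) (nz a4' h4) ?_
    rw [a1', a4']
    have : dot a b c * orient d b c - dot d c b * orient a b c = incirc a b c d := by
      unfold dot incirc parab orient; ring
    linarith
  have l6 : EuclideanGeometry.angle a b c < EuclideanGeometry.angle c b d := by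
    refine angle_lt (nz a1 hc) (nz a4'' h4) ?_
    rw [a1, a4'']
    have : dot b a c * orient d b c - dot b c d * orient a b c
        = ((b 0 - c 0) ^ 2 + (b 1 - c 1) ^ 2) * orient b a d := by
      unfold dot orient; ring
    linarith
  rw [angleMul_insert n1, angleMul_insert n2, angleMul_singleton, angleMul_singleton, triangleAngles_eq hab hbc hac, triangleAngles_eq hab.symm had hbd,
    triangleAngles_eq hcd hac.symm had.symm, triangleAngles_eq hcd.symm hbd.symm hbc.symm]
  refine better_of_dominated (by simp) fun n hn => ?_
  simp only [Multiset.mem_add, Multiset.insert_eq_cons, Multiset.mem_cons,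
    Multiset.mem_singleton] at hn
  rcases hn with (rfl | rfl | rfl) | (rfl | rfl | rfl)
  · exact ⟨_, by simp, l1⟩
  · exact ⟨EuclideanGeometry.angle a b d, by simp, l2⟩
  · exact ⟨EuclideanGeometry.angle b a c, by simp, l3⟩
  · exact ⟨EuclideanGeometry.angle b a d, by simp, l4⟩
  · exact ⟨EuclideanGeometry.angle b a c, by simp, l5⟩
  · exact ⟨EuclideanGeometry.angle a b c, by simp, l6⟩

/-! ### Optimal triangulations are Delaunay -/

theorem incirc_rot (a b c p : Plane) : incirc b c a p = incirc a b c p := by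
  unfold incirc; rw [orient_rot a b c]; ring

theorem incirc_vertex {a b c p : Plane} (hp : p ∈ ({a, b, c} : Finset Plane)) :
    incirc a b c p = 0 := by
  simp only [Finset.mem_insert, Finset.mem_singleton] at hp
  rcases hp with rfl | rfl | rfl <;> unfold incirc parab orient <;> ring

theorem IsAff.eventually_nonneg {f : Plane → ℝ} (hf : IsAff f) {y p : Plane}
    (h : 0 < f y ∨ (f y = 0 ∧ 0 ≤ f p)) :
    ∀ᶠ μ in 𝓝[>] (0 : ℝ), 0 ≤ f ((1 - μ) • y + μ • p) := by
  rcases h with h | ⟨h, h'⟩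
  · have hc : Continuous fun μ : ℝ => f ((1 - μ) • y + μ • p) := hf.continuous.comp (by fun_prop)
    have := (hc.tendsto 0).eventually (lt_mem_nhds (a := 0) (by simpa using h))
    exact (this.filter_mono nhdsWithin_le_nhds).mono fun μ hμ => hμ.le
  · filter_upwards [self_mem_nhdsWithin] with μ hμ
    have hμ : 0 < μ := hμ
    rw [hf.combo (by ring), h]
    nlinarith [mul_nonneg hμ.le h']

theorem eventually_mem_hull {a b c y p : Plane} (h : 0 < orient a b c)
    (h1 : 0 < orient a b y ∨ (orient a b y = 0 ∧ 0 ≤ orient a b p))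
    (h2 : 0 < orient b c y ∨ (orient b c y = 0 ∧ 0 ≤ orient b c p))
    (h3 : 0 < orient c a y ∨ (orient c a y = 0 ∧ 0 ≤ orient c a p)) :
    ∀ᶠ μ in 𝓝[>] (0 : ℝ), (1 - μ) • y + μ • p ∈ hull {a, b, c} := by
  filter_upwards [(isAff_orient a b).eventually_nonneg h1, (isAff_orient b c).eventually_nonneg h2,
    (isAff_orient c a).eventually_nonneg h3] with μ m1 m2 m3
  rw [hull_triple, mem_triangle h]
  exact ⟨m1, m2, m3⟩

/-- Crossing the edge `a b` towards a point `p` inside the circumcircle of `a b c` leads to a triangle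
whose circumcircle contains `p` as well. -/
theorem Opt.exists_next {P : Finset Plane} {T : Finset (Finset Plane)} (h : Opt P T)
    {a b c p y : Plane} (hT : {a, b, c} ∈ T) (hc : 0 < orient a b c) (hp : p ∈ P)
    (hin : 0 < incirc a b c p) (hab : orient a b y = 0) (habp : orient a b p < 0)
    (hbc : 0 < orient b c y) (hca : 0 < orient c a y) :
    ∃ d, {b, a, d} ∈ T ∧ 0 < orient b a d ∧ 0 < incirc b a d p ∧
      ∀ᶠ μ in 𝓝[>] (0 : ℝ), (1 - μ) • y + μ • p ∈ hull {b, a, d} := by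
  obtain ⟨d, hdT, hd⟩ := h.isTri.neighbor hT hc hp habp
  have hd' : 0 < orient b a d := by rw [orient_swap]; linarith
  refine ⟨d, by rwa [Finset.insert_comm], hd', ?_, ?_⟩
  · have hloc := h.incirc_nonpos hT hdT hc hd
    have hF := ((isAff_interp parab b a d).sub (isAff_interp parab a b c)).bary b a d p
    rw [interp_apply parab hd'.ne' (x := b) (by simp), interp_apply parab hd'.ne' (x := a) (by simp),
      interp_apply parab hd'.ne' (x := d) (by simp), interp_apply parab hc.ne' (x := b) (by simp),
      interp_apply parab hc.ne' (x := a) (by simp)] at hF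
    rw [incirc_eq hc.ne'] at hin hloc
    rw [incirc_eq hd'.ne']
    have k1 : 0 < interp parab a b c p - parab p := (mul_pos_iff_of_pos_left hc).1 hin
    have k2 : 0 ≤ parab d - interp parab a b c d := by
      by_contra! hn
      nlinarith
    have hbap : 0 < orient b a p := by rw [orient_swap]; linarith
    have k3 : 0 ≤ interp parab b a d p - interp parab a b c p := by
      by_contra! hn
      nlinarith [mul_nonneg hbap.le k2, mul_neg_of_pos_of_neg hd' hn]
    exact mul_pos hd' (by linarith)
  · have e := orient_add a b c y
    have hy1 : orient a b c * orient a d y = orient b c y * 0 + orient c a y * orient b a d := by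
      have := (isAff_orient a d).bary a b c y
      rw [hab, orient_left, orient_rot b a d] at this; linarith
    have hy2 : orient a b c * orient d b y = orient b c y * orient b a d := by
      have := (isAff_orient d b).bary a b c y
      rw [hab, orient_right, orient_rot' b a d] at this; linarith
    refine eventually_mem_hull hd' (Or.inr ⟨?_, ?_⟩) (Or.inl ?_) (Or.inl ?_)
    · rw [orient_swap, hab, neg_zero]
    · rw [orient_swap]; linarith
    · refine (mul_pos_iff_of_pos_left hc).1 ?_
      rw [hy1]; nlinarith [mul_pos hca hd']
    · refine (mul_pos_iff_of_pos_left hc).1 ?_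
      rw [hy2]; positivity

/-- In an optimal triangulation all circumcircles are empty. The segment from a generic point of a
triangle with `p` inside its circumcircle to `p` only ever runs through such triangles, but it ends
in `p`, a vertex. -/
theorem Opt.delaunay {P : Finset Plane} {T : Finset (Finset Plane)} (h : Opt P T)
    {a b c p : Plane} (hT : {a, b, c} ∈ T) (hc : 0 < orient a b c) (hp : p ∈ P) :
    incirc a b c p ≤ 0 := by
  by_contra! hin
  -- a starting point on no line through `p` and a further point of `P`
  obtain ⟨x, hxT, hx⟩ : ∃ x ∈ hull {a, b, c}, ∀ q ∈ P, q ≠ p → orient p q x ≠ 0 := by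
    have hpos := isOpen_interior.measure_pos volume (h.isTri.nondeg _ hT).interior_nonempty
    by_contra! hno
    have hnull : volume (⋃ q ∈ ((P.erase p : Finset Plane) : Set Plane), {x | orient p q x = 0})
        = 0 := by
      rw [measure_biUnion_null_iff (Finset.countable_toSet _)]
      intro q hq
      exact volume_line (Finset.mem_erase.1 hq).1.symm
    refine hpos.ne' (measure_mono_null interior_subset (measure_mono_null ?_ hnull))
    intro x hx
    obtain ⟨q, hq, hqp, h0⟩ := hno x hx
    simp only [Set.mem_iUnion]
    exact ⟨q, Finset.mem_erase.2 ⟨hqp, hq⟩, h0⟩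
  let z : ℝ → Plane := fun r => (1 - r) • x + r • p
  have hz : Continuous z := by fun_prop
  let G := T.filter (fun t => ∃ a b c, t = {a, b, c} ∧ 0 < orient a b c ∧ 0 < incirc a b c p)
  let Λ : Set ℝ := Set.Icc 0 1 ∩ z ⁻¹' ⋃ t ∈ G, hull t
  have hΛ : IsCompact Λ := isCompact_Icc.inter_right ((IsTri.isClosed_iUnion G).preimage hz)
  have hΛ0 : (0 : ℝ) ∈ Λ := by
    refine ⟨⟨le_rfl, zero_le_one⟩, ?_⟩
    simp only [Set.mem_preimage, Set.mem_iUnion]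
    exact ⟨{a, b, c}, Finset.mem_filter.2 ⟨hT, a, b, c, rfl, hc, hin⟩, by simpa [z] using hxT⟩
  obtain ⟨r, ⟨⟨hr0, hr1⟩, hrG⟩, hmax⟩ := hΛ.exists_isGreatest ⟨0, hΛ0⟩
  simp only [Set.mem_preimage, Set.mem_iUnion] at hrG
  obtain ⟨t, htG, hrt⟩ := hrG
  obtain ⟨htT, a', b', c', rfl, hc', hin'⟩ := Finset.mem_filter.1 htG
  have hr1' : r < 1 := by
    refine lt_of_le_of_ne hr1 fun e => ?_
    subst e
    have : p ∈ hull {a', b', c'} := by simpa [z] using hrt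
    rw [incirc_vertex (h.isTri.empty _ htT p hp this)] at hin'
    exact lt_irrefl _ hin'
  -- the segment cannot stay in triangles with `p` inside the circumcircle beyond `z r`
  have leave : ∀ t ∈ G, ¬ ∀ᶠ μ in 𝓝[>] (0 : ℝ), (1 - μ) • z r + μ • p ∈ hull t := by
    intro t ht hev
    obtain ⟨μ, hμ, hμ0, hμ1⟩ := (hev.and
      (Ioo_mem_nhdsGT (show (0 : ℝ) < 1 by norm_num))).exists
    have e : (1 - μ) • z r + μ • p = z (r + μ * (1 - r)) := by
      simp only [z]; module
    have hpos := mul_pos hμ0 (show 0 < 1 - r by linarith)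
    have := hmax (a := r + μ * (1 - r)) ⟨⟨by linarith, by nlinarith⟩, by
      simp only [Set.mem_preimage, Set.mem_iUnion]
      exact ⟨t, ht, e ▸ hμ⟩⟩
    linarith
  have main : ∀ a b c, {a, b, c} ∈ T → 0 < orient a b c → 0 < incirc a b c p →
      z r ∈ hull {a, b, c} → ¬ (orient a b (z r) = 0 ∧ orient a b p < 0) := by
    rintro a b c hT hc hin hzt ⟨h0, hp0⟩
    rw [hull_triple, mem_triangle hc] at hzt
    have hzq : ∀ q ∈ ({a, b, c} : Finset Plane), z r ≠ q := by
      intro q hq e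
      have hqp : q ≠ p := by
        rintro rfl
        rw [incirc_vertex hq] at hin
        exact lt_irrefl _ hin
      have := hx q (h.isTri.subset _ hT hq) hqp
      have h0 : orient p q (z r) = 0 := by rw [e]; simp
      rw [(isAff_orient p q).combo (by ring), orient_left] at h0
      have := mul_ne_zero (show 1 - r ≠ 0 by linarith) this
      exact this (by linarith)
    have hbary := bary hc.ne' (z r)
    have hsum := orient_add a b c (z r)
    have hbc : 0 < orient b c (z r) := by
      refine lt_of_le_of_ne hzt.2.1 fun e => hzq b (by simp) ?_
      rw [← e, h0, zero_add, zero_add] at hsum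
      rw [hbary, h0, ← e, hsum, div_self hc.ne']; simp
    have hca : 0 < orient c a (z r) := by
      refine lt_of_le_of_ne hzt.2.2 fun e => hzq a (by simp) ?_
      rw [← e, h0, zero_add, add_zero] at hsum
      rw [hbary, h0, ← e, hsum, div_self hc.ne']; simp
    obtain ⟨d, hdT, hd, hdin, hev⟩ := h.exists_next hT hc hp hin h0 hp0 hbc hca
    exact leave _ (Finset.mem_filter.2 ⟨hdT, b, a, d, rfl, hd, hdin⟩) hev
  have hrt' := hrt
  rw [hull_triple, mem_triangle hc'] at hrt'
  have rot : ∀ a b c : Plane, ({b, c, a} : Finset Plane) = {a, b, c} := by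
    intro a b c; ext; simp; tauto
  refine leave _ htG (eventually_mem_hull hc' ?_ ?_ ?_)
  · rcases hrt'.1.lt_or_eq with h0 | h0
    · exact Or.inl h0
    · exact Or.inr ⟨h0.symm, not_lt.1 fun h1 => main a' b' c' htT hc' hin' hrt ⟨h0.symm, h1⟩⟩
  · rcases hrt'.2.1.lt_or_eq with h0 | h0
    · exact Or.inl h0
    · refine Or.inr ⟨h0.symm, not_lt.1 fun h1 => main b' c' a' (by rwa [rot]) (by rwa [orient_rot])
        (by rwa [incirc_rot]) (by rwa [rot]) ⟨h0.symm, h1⟩⟩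
  · rcases hrt'.2.2.lt_or_eq with h0 | h0
    · exact Or.inl h0
    · refine Or.inr ⟨h0.symm, not_lt.1 fun h1 => main c' a' b' (by rwa [← rot c' a' b'])
        (by rwa [orient_rot']) (by rwa [← incirc_rot]) (by rwa [← rot c' a' b']) ⟨h0.symm, h1⟩⟩

/-- If all circumcircles are empty, then the triangles with vertices on the circumcircle of `a b c`
triangulate the points on this circle. -/
theorem IsTri.cell {P : Finset Plane} {T : Finset (Finset Plane)} (h : IsTri P T)
    (hdel : ∀ a b c, {a, b, c} ∈ T → 0 < orient a b c → ∀ p ∈ P, incirc a b c p ≤ 0)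
    {a b c : Plane} (hc : 0 < orient a b c) (hemp : ∀ p ∈ P, incirc a b c p ≤ 0) {K : Finset Plane}
    (hK : K = P.filter (fun p => incirc a b c p = 0)) : IsTri K (T.filter (fun t => t ⊆ K)) where
  nondeg t ht := h.nondeg t (Finset.mem_filter.1 ht).1
  subset t ht := (Finset.mem_filter.1 ht).2
  empty t ht p hp := h.empty t (Finset.mem_filter.1 ht).1 p (by
    rw [hK] at hp; exact (Finset.mem_filter.1 hp).1)
  disj s hs t ht := h.disj s (Finset.mem_filter.1 hs).1 t (Finset.mem_filter.1 ht).1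
  cover := by
    have le_of : ∀ {a b c p}, 0 < orient a b c → incirc a b c p ≤ 0 →
        interp parab a b c p ≤ parab p := by
      intro a b c p hc hle
      rw [incirc_eq hc.ne'] at hle
      by_contra! hn
      nlinarith [mul_pos hc (sub_pos.2 hn)]
    have hnull : volume (⋃ t ∈ ((T.filter (fun t => ¬ t ⊆ K) : Finset (Finset Plane)) :
        Set (Finset Plane)), hull (t ∩ K)) = 0 := by
      rw [measure_biUnion_null_iff (Finset.countable_toSet _)]
      intro t ht
      simp only [Finset.coe_filter, Set.mem_ofPred_eq] at ht
      refine volume_hull_of_card_le_two ?_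
      by_contra! hcard
      have h3 := (h.nondeg t ht.1).card
      have e : t ∩ K = t := Finset.eq_of_subset_of_card_le Finset.inter_subset_left (by omega)
      exact ht.2 (Finset.inter_eq_left.1 e)
    refine measure_mono_null ?_ (measure_union_null h.cover hnull)
    rintro x ⟨hx, hxn⟩
    have hKP : K ⊆ P := hK ▸ Finset.filter_subset _ _
    by_cases hx' : x ∈ ⋃ t ∈ T, hull t
    · right
      simp only [Set.mem_iUnion] at hx' hxn ⊢
      obtain ⟨t, ht, hxt⟩ := hx'
      have htK : ¬ t ⊆ K := fun htK => hxn ⟨t, Finset.mem_filter.2 ⟨ht, htK⟩, hxt⟩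
      refine ⟨t, by simpa using ⟨ht, htK⟩, ?_⟩
      obtain ⟨a', b', c', e, hc'⟩ := h.nondeg t ht
      have hf := (isAff_interp parab a' b' c').sub (isAff_interp parab a b c)
      have h1 := hf.nonpos_of_mem (s := (K : Set Plane)) (fun q hq => by
        have hq' : q ∈ K := hq
        rw [hK, Finset.mem_filter, incirc_eq hc.ne'] at hq'
        have e1 := (mul_eq_zero.1 hq'.2).resolve_left hc.ne'
        have := le_of hc' (hdel a' b' c' (e ▸ ht) hc' q hq'.1)
        linarith) hx
      have h2 := hf.mem_face (s := t) (fun q hq => by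
        rw [interp_apply parab hc'.ne' (e ▸ hq)]
        linarith [le_of hc (hemp q (h.subset t ht hq))]) hxt h1
      refine convexHull_mono ?_ h2
      rintro q ⟨hq, hq0⟩
      rw [interp_apply parab hc'.ne' (e ▸ hq)] at hq0
      rw [Finset.coe_inter]
      refine ⟨hq, ?_⟩
      rw [hK, Finset.mem_coe, Finset.mem_filter, incirc_eq hc.ne']
      exact ⟨h.subset t ht hq, by rw [show interp parab a b c q - parab q = 0 by linarith, mul_zero]⟩
    · exact Or.inl ⟨hull_mono hKP hx, hx'⟩

/-- The points on the circumcircle of `a b c` have the same distance from some center. -/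
theorem exists_center {a b c : Plane} (hc : orient a b c ≠ 0) :
    ∃ (o : Plane) (R : ℝ), ∀ p, incirc a b c p = 0 → dist p o = R := by
  obtain ⟨α, β, γ, hf⟩ := isAff_interp parab a b c
  refine ⟨!₂[α / 2, β / 2], √(γ + (α / 2) ^ 2 + (β / 2) ^ 2), fun p hp => ?_⟩
  rw [incirc_eq hc] at hp
  have e := (mul_eq_zero.1 hp).resolve_left hc
  rw [hf] at e
  rw [EuclideanSpace.dist_eq]
  congr 1
  simp only [Fin.sum_univ_two, Real.dist_eq, sq_abs]
  simp [parab] at e ⊢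
  linarith

/-! ### Points on a circle -/

/-- A circle with center `o`, a radius vector `u`, and an orientation `s`. -/
structure Frame where
  /-- the center -/
  o : Plane
  /-- the vector from the center to the point with parameter `0` -/
  u : Plane
  /-- the orientation, `1` or `-1` -/
  s : ℝ
  s_mul : s * s = 1
  pos : 0 < u 0 ^ 2 + u 1 ^ 2

namespace Frame

variable (F : Frame)

/-- The point of the circle at central angle `2 * x`. Parameters in `[0, π)` give each point once,
and by the inscribed angle theorem parameter differences are angles. -/
def pt (x : ℝ) : Plane :=
  !₂[F.o 0 + Real.cos (2 * x) * F.u 0 - F.s * Real.sin (2 * x) * F.u 1,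
    F.o 1 + Real.cos (2 * x) * F.u 1 + F.s * Real.sin (2 * x) * F.u 0]

/-- The squared diameter of the circle. -/
def d2 : ℝ := 4 * (F.u 0 ^ 2 + F.u 1 ^ 2)

theorem d2_pos : 0 < F.d2 := by have := F.pos; unfold d2; linarith

theorem sub_zero (x y : ℝ) : F.pt y 0 - F.pt x 0 = 2 * Real.sin (y - x) *
    (-Real.sin (x + y) * F.u 0 - F.s * Real.cos (x + y) * F.u 1) := by
  have h1 := Real.cos_sub_cos (2 * y) (2 * x)
  have h2 := Real.sin_sub_sin (2 * y) (2 * x)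
  rw [show (2 * y + 2 * x) / 2 = x + y by ring, show (2 * y - 2 * x) / 2 = y - x by ring] at h1 h2
  simp only [pt, Matrix.cons_val_zero]
  linear_combination F.u 0 * h1 - F.s * F.u 1 * h2

theorem sub_one (x y : ℝ) : F.pt y 1 - F.pt x 1 = 2 * Real.sin (y - x) *
    (-Real.sin (x + y) * F.u 1 + F.s * Real.cos (x + y) * F.u 0) := by
  have h1 := Real.cos_sub_cos (2 * y) (2 * x)
  have h2 := Real.sin_sub_sin (2 * y) (2 * x)
  rw [show (2 * y + 2 * x) / 2 = x + y by ring, show (2 * y - 2 * x) / 2 = y - x by ring] at h1 h2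
  simp only [pt, Matrix.cons_val_one, Matrix.cons_val_fin_one]
  linear_combination F.u 1 * h1 + F.s * F.u 0 * h2

theorem orient_pt (x y z : ℝ) : F.s * orient (F.pt x) (F.pt y) (F.pt z) =
    F.d2 * (Real.sin (y - x) * Real.sin (z - y) * Real.sin (z - x)) := by
  unfold orient d2
  rw [sub_zero, sub_one, sub_zero, sub_one]
  have h : Real.sin (z - y) = Real.sin (x + z) * Real.cos (x + y)
      - Real.cos (x + z) * Real.sin (x + y) := by
    rw [← Real.sin_sub]; ring_nf
  rw [h]
  linear_combination (4 * (F.u 0 ^ 2 + F.u 1 ^ 2) * Real.sin (y - x) * Real.sin (z - x) *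
    (Real.sin (x + z) * Real.cos (x + y) - Real.cos (x + z) * Real.sin (x + y))) * F.s_mul

theorem dot_pt (x y z : ℝ) : dot (F.pt x) (F.pt y) (F.pt z) =
    F.d2 * (Real.sin (y - x) * Real.sin (z - x) * Real.cos (z - y)) := by
  unfold dot d2
  rw [sub_zero, sub_one, sub_zero, sub_one]
  have h : Real.cos (z - y) = Real.cos (x + z) * Real.cos (x + y)
      + Real.sin (x + z) * Real.sin (x + y) := by
    rw [← Real.cos_sub]; ring_nf
  rw [h]
  linear_combination (4 * (F.u 0 ^ 2 + F.u 1 ^ 2) * Real.sin (y - x) * Real.sin (z - x) *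
    (Real.cos (x + z) * Real.cos (x + y))) * F.s_mul

theorem dist_pt (x y : ℝ) : dist (F.pt x) (F.pt y) = √F.d2 * |Real.sin (y - x)| := by
  rw [← Real.sqrt_sq_eq_abs, ← Real.sqrt_mul F.d2_pos.le, EuclideanSpace.dist_eq]
  congr 1
  simp only [Fin.sum_univ_two, Real.dist_eq, sq_abs]
  have h0 := F.sub_zero x y
  have h1 := F.sub_one x y
  have hcs := Real.sin_sq_add_cos_sq (x + y)
  rw [← neg_sub (F.pt y 0), ← neg_sub (F.pt y 1), neg_sq, neg_sq, h0, h1]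
  unfold d2
  linear_combination (4 * Real.sin (y - x) ^ 2 * (F.u 0 ^ 2 + F.u 1 ^ 2)) * hcs
    + (4 * Real.sin (y - x) ^ 2 * Real.cos (x + y) ^ 2 * (F.u 0 ^ 2 + F.u 1 ^ 2)) * F.s_mul

theorem s_eq : F.s = 1 ∨ F.s = -1 := mul_self_eq_one_iff.1 F.s_mul

variable {F}

theorem sin_pos {x y : ℝ} (hx : 0 ≤ x) (hxy : x < y) (hy : y < Real.pi) : 0 < Real.sin (y - x) :=
  Real.sin_pos_of_pos_of_lt_pi (by linarith) (by linarith)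

theorem orient_pos {x y z : ℝ} (hx : 0 ≤ x) (hxy : x < y) (hyz : y < z) (hz : z < Real.pi) :
    0 < F.s * orient (F.pt x) (F.pt y) (F.pt z) := by
  rw [orient_pt]
  have h1 := sin_pos hx hxy (hyz.trans hz)
  have h2 := sin_pos (hx.trans hxy.le) hyz hz
  have h3 := sin_pos hx (hxy.trans hyz) hz
  have := F.d2_pos
  positivity

theorem pt_inj {x y : ℝ} (hx : 0 ≤ x) (hx' : x < Real.pi) (hy : 0 ≤ y) (hy' : y < Real.pi)
    (h : F.pt x = F.pt y) : x = y := by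
  by_contra hne
  have h0 : dist (F.pt x) (F.pt y) = 0 := by rw [h, dist_self]
  rw [dist_pt] at h0
  have h1 : 0 < √F.d2 := Real.sqrt_pos.2 F.d2_pos
  have h2 := abs_eq_zero.1 ((mul_eq_zero.1 h0).resolve_left h1.ne')
  rcases lt_or_gt_of_ne hne with h | h
  · exact (sin_pos hx h hy').ne' h2
  · have := sin_pos hy h hx'
    rw [← neg_sub, Real.sin_neg] at h2
    linarith

theorem angle_of {a p b : Plane} {A δ : ℝ} (hA : 0 < A) (h0 : 0 < δ) (hπ : δ < Real.pi)
    (hd : dot p a b = A * Real.cos δ) (ho : |orient p a b| = A * Real.sin δ) :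
    EuclideanGeometry.angle a p b = δ := by
  have hs := Real.sin_pos_of_pos_of_lt_pi h0 hπ
  have hne : orient p a b ≠ 0 := abs_pos.1 (by rw [ho]; positivity)
  rw [angle_eq hne, hd, ho, mul_div_mul_left _ _ hA.ne']
  have : Real.cos δ / Real.sin δ = Real.tan (Real.pi / 2 - δ) := by
    rw [Real.tan_eq_sin_div_cos, Real.sin_pi_div_two_sub, Real.cos_pi_div_two_sub]
  rw [this, Real.arctan_tan (by linarith) (by linarith)]
  ring

/-- The angles of an inscribed triangle. -/
theorem triangleAngles_pt {x y z : ℝ} (hx : 0 ≤ x) (hxy : x < y) (hyz : y < z)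
    (hz : z < Real.pi) : triangleAngles {F.pt x, F.pt y, F.pt z} =
      {z - y, Real.pi - (z - x), y - x} := by
  have s1 := sin_pos hx hxy (hyz.trans hz)
  have s2 := sin_pos (hx.trans hxy.le) hyz hz
  have s3 := sin_pos hx (hxy.trans hyz) hz
  have hD := F.d2_pos
  have hor : |orient (F.pt x) (F.pt y) (F.pt z)| =
      F.d2 * (Real.sin (y - x) * Real.sin (z - y) * Real.sin (z - x)) := by
    rw [← F.orient_pt, ← abs_of_pos (orient_pos hx hxy hyz hz), abs_mul]
    rcases F.s_eq with h | h <;> simp [h]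
  rw [triangleAngles_eq (fun h => hxy.ne (pt_inj hx (by linarith) (by linarith) (by linarith) h))
    (fun h => hyz.ne (pt_inj (by linarith) (by linarith) (by linarith) hz h))
    (fun h => (hxy.trans hyz).ne (pt_inj hx (by linarith) (by linarith) hz h))]
  congr 1
  · exact angle_of (A := F.d2 * (Real.sin (y - x) * Real.sin (z - x))) (by positivity)
      (by linarith) (by linarith) (by rw [dot_pt]; ring) (by rw [hor]; ring)
  congr 1
  · refine angle_of (A := F.d2 * (Real.sin (y - x) * Real.sin (z - y))) (by positivity)
      (by linarith) (by linarith) ?_ ?_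
    · rw [dot_pt, ← neg_sub y x, Real.sin_neg, Real.cos_pi_sub]; ring
    · rw [orient_swap, abs_neg, hor, Real.sin_pi_sub]; ring
  · rw [Multiset.singleton_inj]
    refine angle_of (A := F.d2 * (Real.sin (z - x) * Real.sin (z - y))) (by positivity)
      (by linarith) (by linarith) ?_ ?_
    · rw [dot_pt, ← neg_sub z x, Real.sin_neg, ← neg_sub z y, Real.sin_neg]; ring
    · rw [orient_rot', hor]; ring

end Frame

/-- Every finite set on a circle is parametrized by a subset of `[0, π)`, from any base point and in
both orientations. -/
theorem exists_frame {K : Finset Plane} {o : Plane} {R : ℝ} (hK : ∀ p ∈ K, dist p o = R)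
    (hcard : 2 ≤ K.card) {b : Plane} (hb : b ∈ K) {s : ℝ} (hs : s * s = 1) :
    ∃ (F : Frame) (X : Finset ℝ), F.s = s ∧ (∀ x ∈ X, 0 ≤ x ∧ x < Real.pi) ∧ K = X.image F.pt ∧
      0 ∈ X ∧ F.pt 0 = b := by
  have hd : ∀ p ∈ K, (p 0 - o 0) ^ 2 + (p 1 - o 1) ^ 2 = R ^ 2 := by
    intro p hp
    rw [← hK p hp, EuclideanSpace.dist_eq, Real.sq_sqrt (by positivity)]
    simp [Fin.sum_univ_two, Real.dist_eq, sq_abs]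
  have hR : 0 < R ^ 2 := by
    obtain ⟨c, hc, hcb⟩ := Finset.exists_mem_ne (show 1 < K.card by omega) b
    by_contra! hle
    have hR0 : R = 0 := by nlinarith [sq_nonneg R]
    have h1 := hK b hb
    have h2 := hK c hc
    rw [hR0, dist_eq_zero] at h1 h2
    exact hcb (h2.trans h1.symm)
  let F : Frame := ⟨o, b - o, s, hs, by
    simp only [PiLp.sub_apply]; rw [hd b hb]; exact hR⟩
  have hF0 : F.pt 0 = b := by apply plane_ext <;> simp [Frame.pt, F]
  have hex : ∀ p ∈ K, ∃ x, (0 ≤ x ∧ x < Real.pi) ∧ F.pt x = p := by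
    intro p hp
    let C : ℝ := ((p 0 - o 0) * (b 0 - o 0) + (p 1 - o 1) * (b 1 - o 1)) / R ^ 2
    let S : ℝ := s * ((p 1 - o 1) * (b 0 - o 0) - (p 0 - o 0) * (b 1 - o 1)) / R ^ 2
    have hp' := hd p hp
    have hb' := hd b hb
    have hC : C * R ^ 2 = (p 0 - o 0) * (b 0 - o 0) + (p 1 - o 1) * (b 1 - o 1) :=
      div_mul_cancel₀ _ hR.ne'
    have hS : S * R ^ 2 = s * ((p 1 - o 1) * (b 0 - o 0) - (p 0 - o 0) * (b 1 - o 1)) :=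
      div_mul_cancel₀ _ hR.ne'
    have hCS : C ^ 2 + S ^ 2 = 1 := by
      have : (C ^ 2 + S ^ 2) * (R ^ 2) ^ 2 = 1 * (R ^ 2) ^ 2 := by
        rw [add_mul, ← mul_pow, ← mul_pow, hC, hS, mul_pow, pow_two s, hs]
        have e : ((p 0 - o 0) * (b 0 - o 0) + (p 1 - o 1) * (b 1 - o 1)) ^ 2
            + ((p 1 - o 1) * (b 0 - o 0) - (p 0 - o 0) * (b 1 - o 1)) ^ 2
            = ((p 0 - o 0) ^ 2 + (p 1 - o 1) ^ 2) * ((b 0 - o 0) ^ 2 + (b 1 - o 1) ^ 2) := by ring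
        rw [one_mul, one_mul, e, hp', hb', pow_two (R ^ 2)]
      exact mul_right_cancel₀ (by positivity) this
    let w : ℂ := ⟨C, S⟩
    have hw : ‖w‖ = 1 := by
      rw [Complex.norm_def, Complex.normSq_mk, ← pow_two, ← pow_two, hCS, Real.sqrt_one]
    have hw0 : w ≠ 0 := fun h => by rw [h, norm_zero] at hw; exact zero_ne_one hw
    have hcos : Real.cos w.arg = C := by rw [Complex.cos_arg hw0, hw]; simp [w]
    have hsin : Real.sin w.arg = S := by rw [Complex.sin_arg, hw]; simp [w]
    obtain ⟨x, hx, hx', hxc, hxs⟩ : ∃ x, 0 ≤ x ∧ x < Real.pi ∧ Real.cos (2 * x) = C ∧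
        Real.sin (2 * x) = S := by
      have hpi := Real.pi_pos
      rcases le_or_gt 0 w.arg with h | h
      · exact ⟨w.arg / 2, by linarith, by linarith [Complex.arg_le_pi w],
          by rw [mul_div_cancel₀ _ two_ne_zero, hcos], by rw [mul_div_cancel₀ _ two_ne_zero, hsin]⟩
      · refine ⟨w.arg / 2 + Real.pi, by linarith [Complex.neg_pi_lt_arg w], by linarith, ?_, ?_⟩
        · rw [show 2 * (w.arg / 2 + Real.pi) = w.arg + 2 * Real.pi by ring, Real.cos_add_two_pi, hcos]
        · rw [show 2 * (w.arg / 2 + Real.pi) = w.arg + 2 * Real.pi by ring, Real.sin_add_two_pi, hsin]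
    refine ⟨x, ⟨hx, hx'⟩, ?_⟩
    have e0 : R ^ 2 * (o 0 + C * (b 0 - o 0) - s * S * (b 1 - o 1)) = R ^ 2 * p 0 := by
      linear_combination (b 0 - o 0) * hC - s * (b 1 - o 1) * hS
        + (p 0 - o 0) * hb' - (b 1 - o 1) * ((p 1 - o 1) * (b 0 - o 0)
          - (p 0 - o 0) * (b 1 - o 1)) * hs
    have e1 : R ^ 2 * (o 1 + C * (b 1 - o 1) + s * S * (b 0 - o 0)) = R ^ 2 * p 1 := by
      linear_combination (b 1 - o 1) * hC + s * (b 0 - o 0) * hS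
        + (p 1 - o 1) * hb' + (b 0 - o 0) * ((p 1 - o 1) * (b 0 - o 0)
          - (p 0 - o 0) * (b 1 - o 1)) * hs
    apply plane_ext
    · simp only [Frame.pt, F, Matrix.cons_val_zero, hxc, hxs, PiLp.sub_apply]
      exact mul_left_cancel₀ hR.ne' e0
    · simp only [Frame.pt, F, Matrix.cons_val_one, Matrix.cons_val_fin_one, hxc, hxs, PiLp.sub_apply]
      exact mul_left_cancel₀ hR.ne' e1
  choose! g hg hgp using hex
  refine ⟨F, K.image g, rfl, ?_, ?_, ?_, hF0⟩
  · intro x hx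
    obtain ⟨p, hp, rfl⟩ := Finset.mem_image.1 hx
    exact hg p hp
  · rw [Finset.image_image]
    ext p
    simp only [Finset.mem_image, Function.comp]
    constructor
    · exact fun hp => ⟨p, hp, hgp p hp⟩
    · rintro ⟨q, hq, rfl⟩
      rwa [hgp q hq]
  · refine Finset.mem_image.2 ⟨b, hb, ?_⟩
    exact Frame.pt_inj (F := F) (hg b hb).1 (hg b hb).2 le_rfl Real.pi_pos (by rw [hgp b hb, hF0])

/-- A point of a circle in the hull of finitely many points of this circle is one of these points. -/
theorem mem_of_mem_hull_of_circle {t : Finset Plane} {o : Plane} {R : ℝ}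
    (ht : ∀ p ∈ t, dist p o = R) {p : Plane} (hp : dist p o = R) (hpt : p ∈ hull t) : p ∈ t := by
  have hd : ∀ p, dist p o = R → (p 0 - o 0) ^ 2 + (p 1 - o 1) ^ 2 = R ^ 2 := by
    intro p hp
    rw [← hp, EuclideanSpace.dist_eq, Real.sq_sqrt (by positivity)]
    simp [Fin.sum_univ_two, Real.dist_eq, sq_abs]
  have hp' := hd p hp
  -- the tangent at `p`
  let f : Plane → ℝ := fun q => R ^ 2 - ((q 0 - o 0) * (p 0 - o 0) + (q 1 - o 1) * (p 1 - o 1))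
  have hf : IsAff f := ⟨-(p 0 - o 0), -(p 1 - o 1), R ^ 2 + o 0 * (p 0 - o 0) + o 1 * (p 1 - o 1),
    fun q => by simp only [f]; ring⟩
  have hfq : ∀ q, dist q o = R → 2 * f q = (q 0 - p 0) ^ 2 + (q 1 - p 1) ^ 2 := by
    intro q hq
    simp only [f]; linear_combination -(hd q hq) - hp'
  have := hf.mem_face (s := t) (fun q hq => by
    nlinarith [hfq q (ht q hq), sq_nonneg (q 0 - p 0), sq_nonneg (q 1 - p 1)]) hpt
    (by have := hfq p hp; simp at this; linarith)
  by_contra hpn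
  have hem : {q | q ∈ t ∧ f q = 0} = ∅ := by
    ext q
    simp only [Set.mem_ofPred_eq, Set.mem_empty_iff_false, iff_false, not_and]
    intro hq h0
    have h1 := hfq q (ht q hq)
    have h2 := sq_dist_pos (a := q) (b := p) (fun e => hpn (e ▸ hq))
    rw [h0] at h1; linarith
  rw [hem] at this
  simp at this

/-! ### Triangulations of points on a circle -/

/-- `p` and `q` are joined by a side of a triangle of `T`, or equal. -/
def Edge (T : Finset (Finset Plane)) (p q : Plane) : Prop := ∃ t ∈ T, p ∈ t ∧ q ∈ t

theorem Edge.symm {T : Finset (Finset Plane)} {p q : Plane} (h : Edge T p q) : Edge T q p := by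
  obtain ⟨t, ht, h1, h2⟩ := h
  exact ⟨t, ht, h2, h1⟩

/-- `p` and `q` are joined by an edge of `U` with points of `K` strictly on both sides. -/
structure Diag (K : Finset Plane) (U : Finset (Finset Plane)) (p q : Plane) : Prop where
  left : p ∈ K
  right : q ∈ K
  edge : Edge U p q
  exists_pos : ∃ m ∈ K, 0 < orient p q m
  exists_neg : ∃ m ∈ K, orient p q m < 0

theorem Diag.symm {K : Finset Plane} {U : Finset (Finset Plane)} {p q : Plane}
    (h : Diag K U p q) : Diag K U q p := by
  obtain ⟨m, hm, h1⟩ := h.exists_pos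
  obtain ⟨m', hm', h2⟩ := h.exists_neg
  exact ⟨h.right, h.left, h.edge.symm, ⟨m', hm', by rw [orient_swap]; linarith⟩,
    ⟨m, hm, by rw [orient_swap]; linarith⟩⟩

theorem Diag.ne {K : Finset Plane} {U : Finset (Finset Plane)} {p q : Plane}
    (h : Diag K U p q) : p ≠ q := by
  obtain ⟨m, hm, h1⟩ := h.exists_pos
  exact (orient_ne h1.ne').1

/-- On each side of an edge where there is a point, there is a triangle at this edge. -/
theorem IsTri.apex {P : Finset Plane} {T : Finset (Finset Plane)} (h : IsTri P T) {a b q : Plane}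
    (he : Edge T a b) (hq : q ∈ P) (h0 : 0 < orient a b q) :
    ∃ d ∈ P, {a, b, d} ∈ T ∧ 0 < orient a b d := by
  obtain ⟨t, ht, hat, hbt⟩ := he
  obtain ⟨c, rfl, hc⟩ := (h.nondeg t ht).third hat hbt (orient_ne h0.ne').1
  rcases hc.lt_or_gt with hc | hc
  · have e : ({a, b, c} : Finset Plane) = {b, a, c} := by ext; simp; tauto
    rw [e] at ht
    obtain ⟨d, hd, hd0⟩ := h.neighbor ht (by rw [orient_swap]; linarith) hq
      (by rw [orient_swap]; linarith)
    have e' : ({b, a, d} : Finset Plane) = {a, b, d} := by ext; simp; tauto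
    refine ⟨d, h.subset _ hd (by simp), e' ▸ hd, ?_⟩
    rw [orient_swap] at hd0; linarith
  · exact ⟨c, h.subset _ ht (by simp), ht, hc⟩

theorem IsTri.apex_mul {P : Finset Plane} {T : Finset (Finset Plane)} (h : IsTri P T)
    {a b q : Plane} {s : ℝ} (hs : s = 1 ∨ s = -1)
    (he : Edge T a b) (hq : q ∈ P) (h0 : 0 < s * orient a b q) :
    ∃ d ∈ P, {a, b, d} ∈ T ∧ 0 < s * orient a b d := by
  rcases hs with rfl | rfl
  · rw [one_mul] at h0
    obtain ⟨d, hd, h1, h2⟩ := h.apex he hq h0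
    exact ⟨d, hd, h1, by rwa [one_mul]⟩
  · obtain ⟨d, hd, h1, h2⟩ := h.apex he.symm hq (by rw [orient_swap]; linarith)
    have e' : ({b, a, d} : Finset Plane) = {a, b, d} := by ext; simp; tauto
    exact ⟨d, hd, e' ▸ h1, by rw [orient_swap] at h2; linarith⟩

namespace Frame

variable {F : Frame}

theorem orient_neg_iff {x y m : ℝ} (hx : 0 ≤ x) (hxy : x < y) (hy : y < Real.pi) (hm : 0 ≤ m)
    (hm' : m < Real.pi) :
    F.s * orient (F.pt x) (F.pt y) (F.pt m) < 0 ↔ x < m ∧ m < y := by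
  rcases lt_trichotomy m x with h | rfl | h
  · have := orient_pos (F := F) hm h hxy hy
    rw [← orient_rot] at this
    constructor
    · intro h; linarith
    · intro h; linarith
  · simp
  rcases lt_trichotomy m y with h' | rfl | h'
  · have := orient_pos (F := F) hx h h' hy
    rw [orient_swap'] at this
    have e : F.s * orient (F.pt x) (F.pt y) (F.pt m) < 0 := by linarith
    simp [h, h', e]
  · simp
  · have := orient_pos (F := F) hx hxy h' hm'
    constructor
    · intro h; linarith
    · intro h; linarith

theorem orient_pos_iff {x y m : ℝ} (hx : 0 ≤ x) (hxy : x < y) (hy : y < Real.pi) (hm : 0 ≤ m)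
    (hm' : m < Real.pi) :
    0 < F.s * orient (F.pt x) (F.pt y) (F.pt m) ↔ m < x ∨ y < m := by
  rcases lt_trichotomy m x with h | rfl | h
  · have := orient_pos (F := F) hm h hxy hy
    have e : 0 < F.s * orient (F.pt x) (F.pt y) (F.pt m) := by rwa [orient_rot]
    simp [h, e]
  · simp [hxy.not_gt]
  rcases lt_trichotomy m y with h' | rfl | h'
  · have := orient_pos (F := F) hx h h' hy
    rw [orient_swap'] at this
    constructor
    · intro h; linarith
    · rintro (h | h) <;> linarith
  · simp [hxy.not_gt]
  · have := orient_pos (F := F) hx hxy h' hm'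
    simp [h', this]

/-- Chords with interlaced ends cross. -/
theorem exists_mem_inter {x y z w : ℝ} (hx : 0 ≤ x) (hxy : x < y) (hyz : y < z) (hzw : z < w)
    (hw : w < Real.pi) : ∃ p ∈ openSegment ℝ (F.pt x) (F.pt z),
      p ∈ openSegment ℝ (F.pt y) (F.pt w) := by
  have h1 := orient_pos (F := F) hx hxy hyz (by linarith)
  have h2 := orient_pos (F := F) hx hxy (hyz.trans hzw) hw
  have h3 := orient_pos (F := F) hx (hxy.trans hyz) hzw hw
  have h4 := orient_pos (F := F) (hx.trans hxy.le) hyz hzw hw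
  rcases F.s_eq with h | h <;> rw [h] at h1 h2 h3 h4
  · exact exists_crossing (by rw [orient_swap']; linarith) (by linarith)
      (by rw [orient_rot]; linarith) (by rw [orient_swap']; linarith)
  · rw [openSegment_symm ℝ (F.pt y)]
    exact exists_crossing (by linarith) (by rw [orient_swap']; linarith)
      (by rw [orient_swap', orient_rot']; linarith)
      (by rw [orient_rot']; linarith)

end Frame

/-- `U` triangulates the points with parameters in `X` of the circle `F`. -/
structure Inscribed (F : Frame) (X : Finset ℝ) (U : Finset (Finset Plane)) : Prop where
  mem : ∀ x ∈ X, 0 ≤ x ∧ x < Real.pi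
  isTri : IsTri (X.image F.pt) U

namespace Inscribed

variable {F : Frame} {X : Finset ℝ} {U V : Finset (Finset Plane)}

theorem pt_mem (x : ℝ) (hx : x ∈ X) : F.pt x ∈ X.image F.pt := Finset.mem_image_of_mem _ hx

theorem inj (h : Inscribed F X U) {x y : ℝ} (hx : x ∈ X) (hy : y ∈ X) (e : F.pt x = F.pt y) :
    x = y :=
  F.pt_inj (h.mem x hx).1 (h.mem x hx).2 (h.mem y hy).1 (h.mem y hy).2 e

theorem not_cross (h : Inscribed F X U) {x y z w : ℝ} (hx : x ∈ X) (hy : y ∈ X) (hz : z ∈ X)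
    (hw : w ∈ X) (hxy : x < y) (hyz : y < z) (hzw : z < w) (e : Edge U (F.pt x) (F.pt z))
    (e' : Edge U (F.pt y) (F.pt w)) : False := by
  obtain ⟨p, hp, hp'⟩ := Frame.exists_mem_inter (F := F) (h.mem x hx).1 hxy hyz hzw (h.mem w hw).2
  obtain ⟨t, ht, h1, h2⟩ := e
  obtain ⟨t', ht', h1', h2'⟩ := e'
  rcases h.isTri.not_cross ht ht' h1 h2 (fun e => (hxy.trans hyz).ne (h.inj hx hz e)) h1' h2'
    (fun e => (hyz.trans hzw).ne (h.inj hy hw e)) hp hp' with e | e | e | e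
  · exact hxy.ne (h.inj hx hy e)
  · exact (hxy.trans (hyz.trans hzw)).ne (h.inj hx hw e)
  · exact hyz.ne' (h.inj hz hy e)
  · exact hzw.ne (h.inj hz hw e)

theorem exists_sorted (h : Inscribed F X U) {t : Finset Plane} (ht : t ∈ U) :
    ∃ x ∈ X, ∃ y ∈ X, ∃ z ∈ X, x < y ∧ y < z ∧ t = {F.pt x, F.pt y, F.pt z} := by
  obtain ⟨a, b, c, rfl, h0⟩ := h.isTri.nondeg t ht
  obtain ⟨h1, h2, h3⟩ := orient_ne h0.ne'
  have hs := h.isTri.subset _ ht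
  obtain ⟨x, hx, rfl⟩ := Finset.mem_image.1 (hs (show a ∈ _ by simp))
  obtain ⟨y, hy, rfl⟩ := Finset.mem_image.1 (hs (show b ∈ _ by simp))
  obtain ⟨z, hz, rfl⟩ := Finset.mem_image.1 (hs (show c ∈ _ by simp))
  have h1 : x ≠ y := fun e => h1 (e ▸ rfl)
  have h2 : y ≠ z := fun e => h2 (e ▸ rfl)
  have h3 : x ≠ z := fun e => h3 (e ▸ rfl)
  rcases h1.lt_or_gt with h1 | h1 <;> rcases h2.lt_or_gt with h2 | h2 <;>
    rcases h3.lt_or_gt with h3 | h3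
  · exact ⟨x, hx, y, hy, z, hz, h1, h2, rfl⟩
  · linarith
  · exact ⟨x, hx, z, hz, y, hy, h3, h2, by ext; simp; tauto⟩
  · exact ⟨z, hz, x, hx, y, hy, h3, h1, by ext; simp; tauto⟩
  · exact ⟨y, hy, x, hx, z, hz, h1, h3, by ext; simp; tauto⟩
  · exact ⟨y, hy, z, hz, x, hx, h2, h3, by ext; simp; tauto⟩
  · linarith
  · exact ⟨z, hz, y, hy, x, hx, h2, h1, by ext; simp; tauto⟩

theorem apex (h : Inscribed F X U) {x y m : ℝ} (e : Edge U (F.pt x) (F.pt y)) (hm : m ∈ X)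
    (h0 : 0 < F.s * orient (F.pt x) (F.pt y) (F.pt m)) :
    ∃ d ∈ X, {F.pt x, F.pt y, F.pt d} ∈ U ∧ 0 < F.s * orient (F.pt x) (F.pt y) (F.pt d) := by
  obtain ⟨d, hd, h1, h2⟩ := h.isTri.apex_mul F.s_eq e (pt_mem m hm) h0
  obtain ⟨d, hd', rfl⟩ := Finset.mem_image.1 hd
  exact ⟨d, hd', h1, h2⟩

/-- A chord with all the points on one side is a side of a triangle. -/
theorem apex_of_hull (h : Inscribed F X U) {x y m : ℝ} (hx : x ∈ X) (hy : y ∈ X) (hm : m ∈ X)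
    (h0 : 0 < F.s * orient (F.pt x) (F.pt y) (F.pt m))
    (hn : ∀ m ∈ X, ¬ F.s * orient (F.pt x) (F.pt y) (F.pt m) < 0) :
    ∃ d ∈ X, {F.pt x, F.pt y, F.pt d} ∈ U ∧ 0 < F.s * orient (F.pt x) (F.pt y) (F.pt d) := by
  obtain ⟨n1, n2, n3⟩ := orient_ne (right_ne_zero_of_mul h0.ne')
  have hz : ∀ p ∈ X.image F.pt, orient (F.pt x) (F.pt y) p = 0 → p = F.pt x ∨ p = F.pt y := by
    intro p hp h0
    obtain ⟨m, hm, rfl⟩ := Finset.mem_image.1 hp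
    by_contra! hne
    have m1 : m ≠ x := fun e => hne.1 (e ▸ rfl)
    have m2 : m ≠ y := fun e => hne.2 (e ▸ rfl)
    obtain ⟨bx, bx'⟩ := h.mem x hx
    obtain ⟨bz, bz'⟩ := h.mem y hy
    obtain ⟨bm, bm'⟩ := h.mem m hm
    have h1 : x ≠ y := fun e => n1 (e ▸ rfl)
    rcases h1.lt_or_gt with h1 | h1
    · have p1 := Frame.orient_neg_iff (F := F) bx h1 bz' bm bm'
      have p2 := Frame.orient_pos_iff (F := F) bx h1 bz' bm bm'
      rw [h0, mul_zero] at p1 p2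
      simp only [lt_irrefl, false_iff, not_or, not_and, not_lt] at p1 p2
      exact m2 (le_antisymm p2.2 (p1 (lt_of_le_of_ne p2.1 m1.symm)))
    · have p1 := Frame.orient_neg_iff (F := F) bz h1 bx' bm bm'
      have p2 := Frame.orient_pos_iff (F := F) bz h1 bx' bm bm'
      rw [orient_swap, h0, neg_zero, mul_zero] at p1 p2
      simp only [lt_irrefl, false_iff, not_or, not_and, not_lt] at p1 p2
      exact m1 (le_antisymm p2.2 (p1 (lt_of_le_of_ne p2.1 m2.symm)))
  have hpt : ∀ p ∈ X.image F.pt, 0 ≤ F.s * orient (F.pt x) (F.pt y) p := by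
    intro p hp
    obtain ⟨m, hm, rfl⟩ := Finset.mem_image.1 hp
    exact not_lt.1 (hn m hm)
  suffices H : ∃ d ∈ X.image F.pt, {F.pt x, F.pt y, d} ∈ U ∧
      0 < F.s * orient (F.pt x) (F.pt y) d by
    obtain ⟨d, hd, h1, h2⟩ := H
    obtain ⟨d, hd', rfl⟩ := Finset.mem_image.1 hd
    exact ⟨d, hd', h1, h2⟩
  rcases F.s_eq with hs | hs <;> simp only [hs] at hpt ⊢
  · obtain ⟨d, hd, h1, h2⟩ := h.isTri.exists_of_hull_edge (pt_mem x hx) (pt_mem y hy) n1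
      (fun p hp => by linarith [hpt p hp]) hz (pt_mem m hm) n3.symm n2.symm
    exact ⟨d, hd, h1, by linarith⟩
  · obtain ⟨d, hd, h1, h2⟩ := h.isTri.exists_of_hull_edge (pt_mem y hy) (pt_mem x hx) n1.symm
      (fun p hp => by rw [orient_swap]; linarith [hpt p hp])
      (fun p hp h0 => (hz p hp (by rw [orient_swap, h0, neg_zero])).symm) (pt_mem m hm)
      n2.symm n3.symm
    refine ⟨d, hd, ?_, by rw [orient_swap]; linarith⟩
    have e' : ({F.pt y, F.pt x, d} : Finset Plane) = {F.pt x, F.pt y, d} := by ext; simp; tauto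
    exact e' ▸ h1

/-- The triangle on a given side of an edge is unique. -/
theorem apex_unique (h : Inscribed F X U) {x y m m' : ℝ} (hx : x ∈ X) (hy : y ∈ X) (hm : m ∈ X)
    (hm' : m' ∈ X) (ht : {F.pt x, F.pt y, F.pt m} ∈ U) (ht' : {F.pt x, F.pt y, F.pt m'} ∈ U)
    (h0 : 0 < F.s * orient (F.pt x) (F.pt y) (F.pt m))
    (h0' : 0 < F.s * orient (F.pt x) (F.pt y) (F.pt m')) : m = m' := by
  have key : ∀ m m', m ∈ X → m' ∈ X → {F.pt x, F.pt y, F.pt m} ∈ U →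
      {F.pt x, F.pt y, F.pt m'} ∈ U → 0 < F.s * orient (F.pt x) (F.pt y) (F.pt m) →
      0 < F.s * orient (F.pt x) (F.pt y) (F.pt m') → ¬ m < m' := by
    intro m m' hm hm' ht ht' h0 h0' hlt
    have e1 : Edge U (F.pt x) (F.pt m) := ⟨_, ht, by simp, by simp⟩
    have e2 : Edge U (F.pt y) (F.pt m) := ⟨_, ht, by simp, by simp⟩
    have e3 : Edge U (F.pt x) (F.pt m') := ⟨_, ht', by simp, by simp⟩
    have e4 : Edge U (F.pt y) (F.pt m') := ⟨_, ht', by simp, by simp⟩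
    obtain ⟨bx, bx'⟩ := h.mem x hx
    obtain ⟨bz, bz'⟩ := h.mem y hy
    obtain ⟨bm, bm'⟩ := h.mem m hm
    obtain ⟨bn, bn'⟩ := h.mem m' hm'
    have h1 : x ≠ y := fun e => (orient_ne (right_ne_zero_of_mul h0.ne')).1 (e ▸ rfl)
    rcases h1.lt_or_gt with h1 | h1
    · rw [Frame.orient_pos_iff bx h1 bz' bm bm'] at h0
      rw [Frame.orient_pos_iff bx h1 bz' bn bn'] at h0'
      rcases h0' with h0' | h0'
      · exact h.not_cross hm hm' hx hy hlt h0' h1 e1.symm e4.symm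
      · rcases h0 with h0 | h0
        · exact h.not_cross hm hx hy hm' h0 h1 h0' e2.symm e3
        · exact h.not_cross hx hy hm hm' h1 h0 hlt e1 e4
    · rw [orient_swap, mul_neg, neg_pos, Frame.orient_neg_iff bz h1 bx' bm bm'] at h0
      rw [orient_swap, mul_neg, neg_pos, Frame.orient_neg_iff bz h1 bx' bn bn'] at h0'
      exact h.not_cross hy hm hm' hx h0.1 hlt h0'.2 e4 e1.symm
  rcases lt_trichotomy m m' with hlt | he | hlt
  · exact absurd hlt (key m m' hm hm' ht ht' h0 h0')
  · exact he
  · exact absurd hlt (key m' m hm' hm ht' ht h0' h0)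

end Inscribed

namespace Inscribed

variable {F : Frame} {X : Finset ℝ} {U V : Finset (Finset Plane)}

/-! ### The angles of an inscribed triangulation -/

/-- The angle under which the chord from parameter `e.1` to parameter `e.2` is seen from the points
of the circle on its positive side, which is the left side for the orientation of the frame. -/
def oppAngle (e : ℝ × ℝ) : ℝ := if e.1 < e.2 then e.2 - e.1 else Real.pi - (e.1 - e.2)

/-- The sides of the triangle `t`, directed such that `t` is on the positive side. -/
def sides (F : Frame) (X : Finset ℝ) (t : Finset Plane) : Finset (ℝ × ℝ) :=
  (X ×ˢ X).filter fun e => ∃ m ∈ X, {F.pt e.1, F.pt e.2, F.pt m} = t ∧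
    0 < F.s * orient (F.pt e.1) (F.pt e.2) (F.pt m)

/-- The directed chords with all the points on the positive side. -/
def hullPairs (F : Frame) (X : Finset ℝ) : Finset (ℝ × ℝ) :=
  (X ×ˢ X).filter fun e => (∃ m ∈ X, 0 < F.s * orient (F.pt e.1) (F.pt e.2) (F.pt m)) ∧
    ∀ m ∈ X, ¬ F.s * orient (F.pt e.1) (F.pt e.2) (F.pt m) < 0

/-- The directed diagonals of a triangulation. -/
def diagPairs (F : Frame) (X : Finset ℝ) (U : Finset (Finset Plane)) : Finset (ℝ × ℝ) :=
  (X ×ˢ X).filter fun e => Diag (X.image F.pt) U (F.pt e.1) (F.pt e.2)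

/-- The angles opposite to the diagonals of a triangulation, two for each diagonal. -/
def diagAngles (F : Frame) (X : Finset ℝ) (U : Finset (Finset Plane)) : Multiset ℝ :=
  ∑ e ∈ diagPairs F X U, {oppAngle e}

theorem diag_iff {x y : ℝ} (hx : x ∈ X) (hy : y ∈ X) :
    Diag (X.image F.pt) U (F.pt x) (F.pt y) ↔ Edge U (F.pt x) (F.pt y) ∧
      (∃ m ∈ X, 0 < F.s * orient (F.pt x) (F.pt y) (F.pt m)) ∧
      ∃ m ∈ X, F.s * orient (F.pt x) (F.pt y) (F.pt m) < 0 := by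
  have e1 : Diag (X.image F.pt) U (F.pt x) (F.pt y) ↔ Edge U (F.pt x) (F.pt y) ∧
      (∃ m ∈ X, 0 < orient (F.pt x) (F.pt y) (F.pt m)) ∧
      ∃ m ∈ X, orient (F.pt x) (F.pt y) (F.pt m) < 0 := by
    constructor
    · rintro ⟨-, -, h1, ⟨m, hm, h2⟩, ⟨m', hm', h3⟩⟩
      obtain ⟨m, k, rfl⟩ := Finset.mem_image.1 hm
      obtain ⟨m', k', rfl⟩ := Finset.mem_image.1 hm'
      exact ⟨h1, ⟨m, k, h2⟩, ⟨m', k', h3⟩⟩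
    · rintro ⟨h1, ⟨m, hm, h2⟩, ⟨m', hm', h3⟩⟩
      exact ⟨pt_mem x hx, pt_mem y hy, h1, ⟨_, pt_mem m hm, h2⟩, ⟨_, pt_mem m' hm', h3⟩⟩
  rw [e1]
  rcases F.s_eq with h | h <;> simp only [h, one_mul, neg_mul, neg_pos, neg_lt_zero]
  tauto

theorem sides_eq (h : Inscribed F X U) {x y z : ℝ} (hx : x ∈ X) (hy : y ∈ X) (hz : z ∈ X)
    (hxy : x < y) (hyz : y < z) :
    sides F X {F.pt x, F.pt y, F.pt z} = {(x, y), (y, z), (z, x)} := by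
  have hpos := Frame.orient_pos (F := F) (h.mem x hx).1 hxy hyz (h.mem z hz).2
  have hmem : ∀ p ∈ X, F.pt p ∈ ({F.pt x, F.pt y, F.pt z} : Finset Plane) → p = x ∨ p = y ∨ p = z := by
    intro p hp hpt
    simp only [Finset.mem_insert, Finset.mem_singleton] at hpt
    rcases hpt with e | e | e
    · exact .inl (h.inj hp hx e)
    · exact .inr (.inl (h.inj hp hy e))
    · exact .inr (.inr (h.inj hp hz e))
  ext ⟨p, q⟩
  simp only [sides, Finset.mem_filter, Finset.mem_product, Finset.mem_insert,
    Finset.mem_singleton, Prod.mk.injEq]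
  constructor
  · rintro ⟨⟨hp, hq⟩, m, hm, e, h0⟩
    have hp' := hmem p hp (e ▸ by simp)
    have hq' := hmem q hq (e ▸ by simp)
    have hm' := hmem m hm (e ▸ by simp)
    obtain ⟨n1, n2, n3⟩ := orient_ne (right_ne_zero_of_mul h0.ne')
    have h0' : 0 < F.s * orient (F.pt q) (F.pt m) (F.pt p) := by rwa [orient_rot]
    have h0'' : 0 < F.s * orient (F.pt m) (F.pt p) (F.pt q) := by rwa [orient_rot']
    have hneg : ¬ 0 < F.s * orient (F.pt y) (F.pt x) (F.pt z) := by
      rw [orient_swap]; linarith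
    rcases hp' with rfl | rfl | rfl <;> rcases hq' with rfl | rfl | rfl <;>
      rcases hm' with rfl | rfl | rfl <;> first
        | exact absurd rfl n1
        | exact absurd rfl n2
        | exact absurd rfl n3
        | exact absurd h0 hneg
        | exact absurd h0' hneg
        | exact absurd h0'' hneg
        | simp
  · rintro (⟨rfl, rfl⟩ | ⟨rfl, rfl⟩ | ⟨rfl, rfl⟩)
    · exact ⟨⟨hx, hy⟩, z, hz, rfl, hpos⟩
    · exact ⟨⟨hy, hz⟩, x, hx, by ext; simp; tauto, by rwa [orient_rot]⟩
    · exact ⟨⟨hz, hx⟩, y, hy, by ext; simp; tauto, by rwa [orient_rot']⟩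

theorem sum_sides (h : Inscribed F X U) {x y z : ℝ} (hx : x ∈ X) (hy : y ∈ X) (hz : z ∈ X)
    (hxy : x < y) (hyz : y < z) :
    ∑ e ∈ sides F X {F.pt x, F.pt y, F.pt z}, ({oppAngle e} : Multiset ℝ) =
      {z - y, Real.pi - (z - x), y - x} := by
  rw [h.sides_eq hx hy hz hxy hyz, Finset.sum_insert, Finset.sum_insert, Finset.sum_singleton]
  · simp only [oppAngle, hxy, hyz, (hxy.trans hyz).not_gt, if_true, if_false]
    rw [add_comm, Multiset.insert_eq_cons, Multiset.insert_eq_cons, ← Multiset.singleton_add,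
      ← Multiset.singleton_add, add_assoc]
  · simp only [Finset.mem_singleton, Prod.mk.injEq]
    rintro ⟨e, -⟩; exact hyz.ne e
  · simp only [Finset.mem_insert, Finset.mem_singleton, Prod.mk.injEq]
    rintro (⟨e, -⟩ | ⟨e, -⟩)
    · exact hxy.ne e
    · exact (hxy.trans hyz).ne e

theorem biUnion_sides (h : Inscribed F X U) :
    U.biUnion (sides F X) = hullPairs F X ∪ diagPairs F X U := by
  ext ⟨x, y⟩
  simp only [Finset.mem_biUnion, Finset.mem_union, sides, hullPairs, diagPairs, Finset.mem_filter,
    Finset.mem_product]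
  constructor
  · rintro ⟨t, ht, ⟨hx, hy⟩, m, hm, rfl, h0⟩
    by_cases hn : ∀ m ∈ X, ¬ F.s * orient (F.pt x) (F.pt y) (F.pt m) < 0
    · exact .inl ⟨⟨hx, hy⟩, ⟨m, hm, h0⟩, hn⟩
    · push Not at hn
      exact .inr ⟨⟨hx, hy⟩, (diag_iff hx hy).2 ⟨⟨_, ht, by simp, by simp⟩, ⟨m, hm, h0⟩, hn⟩⟩
  · rintro (⟨⟨hx, hy⟩, ⟨m, hm, h0⟩, hn⟩ | ⟨⟨hx, hy⟩, hd⟩)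
    · obtain ⟨d, hd, h1, h2⟩ := h.apex_of_hull hx hy hm h0 hn
      exact ⟨_, h1, ⟨hx, hy⟩, d, hd, rfl, h2⟩
    · obtain ⟨he, ⟨m, hm, h0⟩, -⟩ := (diag_iff hx hy).1 hd
      obtain ⟨d, hd, h1, h2⟩ := h.apex he hm h0
      exact ⟨_, h1, ⟨hx, hy⟩, d, hd, rfl, h2⟩

theorem disjoint_pairs : Disjoint (hullPairs F X) (diagPairs F X U) := by
  rw [Finset.disjoint_left]
  rintro ⟨x, y⟩ h1 h2
  simp only [hullPairs, diagPairs, Finset.mem_filter, Finset.mem_product] at h1 h2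
  obtain ⟨-, -, m, hm, h0⟩ := (diag_iff h1.1.1 h1.1.2).1 h2.2
  exact h1.2.2 m hm h0

/-- Up to a part that depends on the points only, the angles of a triangulation of concyclic points
are the angles opposite to the diagonals. -/
theorem angleMul_eq (h : Inscribed F X U) :
    angleMul U = ∑ e ∈ hullPairs F X, {oppAngle e} + diagAngles F X U := by
  rw [diagAngles, ← Finset.sum_union disjoint_pairs, ← h.biUnion_sides, Finset.sum_biUnion]
  · change ∑ t ∈ U, triangleAngles t = _
    refine Finset.sum_congr rfl fun t ht => ?_
    obtain ⟨x, hx, y, hy, z, hz, hxy, hyz, rfl⟩ := h.exists_sorted ht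
    rw [h.sum_sides hx hy hz hxy hyz,
      Frame.triangleAngles_pt (h.mem x hx).1 hxy hyz (h.mem z hz).2]
  · intro t ht t' ht' hne
    rw [Function.onFun, Finset.disjoint_left]
    rintro ⟨x, y⟩ h1 h2
    simp only [sides, Finset.mem_filter, Finset.mem_product] at h1 h2
    obtain ⟨⟨hx, hy⟩, m, hm, rfl, h0⟩ := h1
    obtain ⟨-, m', hm', rfl, h0'⟩ := h2
    exact hne (by rw [h.apex_unique hx hy hm hm' ht ht' h0 h0'])

theorem oppAngle_swap {x y : ℝ} (hxy : x ≠ y) : oppAngle (y, x) = Real.pi - oppAngle (x, y) := by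
  rcases hxy.lt_or_gt with h | h
  · simp [oppAngle, h, h.not_gt]
  · simp [oppAngle, h, h.not_gt]

/-- The two angles opposite to a diagonal add up to `π`. -/
theorem sum_diag (U : Finset (Finset Plane)) :
    2 * ∑ e ∈ diagPairs F X U, oppAngle e = Real.pi * (diagPairs F X U).card := by
  have h1 : ∑ e ∈ diagPairs F X U, oppAngle e = ∑ e ∈ diagPairs F X U, oppAngle (e.2, e.1) := by
    refine Finset.sum_bij' (fun e _ => (e.2, e.1)) (fun e _ => (e.2, e.1)) ?_ ?_ ?_ ?_ ?_ <;>
      simp only [diagPairs, Finset.mem_filter, Finset.mem_product]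
    · exact fun e h => ⟨⟨h.1.2, h.1.1⟩, h.2.symm⟩
    · exact fun e h => ⟨⟨h.1.2, h.1.1⟩, h.2.symm⟩
    all_goals simp
  have h2 : ∑ e ∈ diagPairs F X U, oppAngle (e.2, e.1) =
      ∑ e ∈ diagPairs F X U, (Real.pi - oppAngle e) := by
    refine Finset.sum_congr rfl fun e he => oppAngle_swap fun hxy => ?_
    exact (Finset.mem_filter.1 he).2.ne (congrArg F.pt hxy)
  rw [Finset.sum_sub_distrib, Finset.sum_const, nsmul_eq_mul] at h2
  linarith

/-- The number `n` of triangles depends on the points only: the number of angles is `3 * n` and their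
sum is `n * π`, and a diagonal adds two angles with sum `π` to the boundary angles. -/
theorem card_eq (h : Inscribed F X U) (h' : Inscribed F X V) : U.card = V.card := by
  have key : ∀ U, Inscribed F X U →
      Real.pi * U.card = ∑ e ∈ hullPairs F X, oppAngle e + ∑ e ∈ diagPairs F X U, oppAngle e ∧
      3 * U.card = (hullPairs F X).card + (diagPairs F X U).card := by
    intro U h
    constructor
    · have h1 : (angleMul U).sum = ∑ t ∈ U, (triangleAngles t).sum :=
        map_sum (Multiset.sumAddMonoidHom (M := ℝ)) triangleAngles U
      have h2 : ∑ t ∈ U, (triangleAngles t).sum = ∑ t ∈ U, Real.pi := by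
        refine Finset.sum_congr rfl fun t ht => ?_
        obtain ⟨x, hx, y, hy, z, hz, hxy, hyz, rfl⟩ := h.exists_sorted ht
        rw [Frame.triangleAngles_pt (h.mem x hx).1 hxy hyz (h.mem z hz).2]
        simp only [Multiset.insert_eq_cons, Multiset.sum_cons, Multiset.sum_singleton]
        ring
      rw [h2, Finset.sum_const, nsmul_eq_mul, mul_comm] at h1
      rw [← h1, h.angleMul_eq, Multiset.sum_add, diagAngles]
      congr 1 <;> exact (map_sum (Multiset.sumAddMonoidHom (M := ℝ)) _ _).trans (by simp)
    · rw [← card_angleMul h.isTri, h.angleMul_eq, Multiset.card_add, diagAngles, Multiset.card_sum,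
        Multiset.card_sum]
      simp
  obtain ⟨a1, a2⟩ := key U h
  obtain ⟨b1, b2⟩ := key V h'
  have c1 := sum_diag (F := F) (X := X) U
  have c2 := sum_diag (F := F) (X := X) V
  have a2' : 3 * (U.card : ℝ) = (hullPairs F X).card + (diagPairs F X U).card := by exact_mod_cast a2
  have b2' : 3 * (V.card : ℝ) = (hullPairs F X).card + (diagPairs F X V).card := by exact_mod_cast b2
  have : Real.pi * (U.card : ℝ) = Real.pi * V.card := by
    linear_combination -2 * a1 - c1 + Real.pi * a2' + 2 * b1 + c2 - Real.pi * b2'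
  exact_mod_cast mul_left_cancel₀ Real.pi_pos.ne' this

theorem mem_diagAngles {U : Finset (Finset Plane)} {δ : ℝ} : δ ∈ diagAngles F X U ↔
    ∃ x ∈ X, ∃ y ∈ X, Diag (X.image F.pt) U (F.pt x) (F.pt y) ∧ oppAngle (x, y) = δ := by
  simp only [diagAngles, Multiset.mem_sum, diagPairs, Finset.mem_filter, Finset.mem_product,
    Multiset.mem_singleton, Prod.exists]
  constructor
  · rintro ⟨x, y, ⟨⟨hx, hy⟩, hd⟩, rfl⟩; exact ⟨x, hx, y, hy, hd, rfl⟩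
  · rintro ⟨x, hx, y, hy, hd, rfl⟩; exact ⟨x, y, ⟨⟨hx, hy⟩, hd⟩, rfl⟩

theorem sin_oppAngle {x y : ℝ} (hx : 0 ≤ x ∧ x < Real.pi) (hy : 0 ≤ y ∧ y < Real.pi) :
    Real.sin (oppAngle (x, y)) = |Real.sin (y - x)| := by
  unfold oppAngle
  split_ifs with h
  · rw [abs_of_pos (Frame.sin_pos hx.1 h hy.2)]
  · simp only at h ⊢
    rw [Real.sin_pi_sub, ← neg_sub x y, Real.sin_neg, abs_neg, abs_of_nonneg]
    exact Real.sin_nonneg_of_nonneg_of_le_pi (by linarith) (by linarith)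

/-- Two optimal triangulations of concyclic points have diagonals of the same lengths. -/
theorem exists_diag_dist_eq (h : Inscribed F X U) (h' : Inscribed F X V)
    (hU : Opt (X.image F.pt) U) (hV : Opt (X.image F.pt) V) {p q : Plane}
    (hpq : Diag (X.image F.pt) U p q) :
    ∃ p' q', Diag (X.image F.pt) V p' q' ∧ dist p' q' = dist p q := by
  have hc := h.card_eq h'
  have e : angleMul U = angleMul V :=
    eq_of_not_better (hU.not_better V h'.isTri hc.symm) (hV.not_better U h.isTri hc)
  rw [h.angleMul_eq, h'.angleMul_eq, add_right_inj] at e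
  obtain ⟨x, hx, rfl⟩ := Finset.mem_image.1 hpq.left
  obtain ⟨y, hy, rfl⟩ := Finset.mem_image.1 hpq.right
  have hm : oppAngle (x, y) ∈ diagAngles F X U := mem_diagAngles.2 ⟨x, hx, y, hy, hpq, rfl⟩
  rw [e] at hm
  obtain ⟨x', hx', y', hy', hd, he⟩ := mem_diagAngles.1 hm
  refine ⟨_, _, hd, ?_⟩
  have b1 := h.mem x hx
  have b2 := h.mem y hy
  have b3 := h.mem x' hx'
  have b4 := h.mem y' hy'
  rw [Frame.dist_pt, Frame.dist_pt, ← sin_oppAngle b1 b2, ← sin_oppAngle b3 b4, he]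

end Inscribed

/-! ### Two triangulations with equal diagonal lengths -/

/-- Suppose that two triangulations of the parameters `X`, with edges `E` and `E'` and diagonals `D`
and `D'`, have diagonals of the same lengths, measured by `min w (π - w)` for the parameter
difference `w`, but no common diagonal, and that interlaced chords have different lengths. Let the
chord from `0` to `a` be a longest diagonal in `D`, with the triangle `0`, `z`, `a` on its long side
and no parameter between `0` and `z`. The equally long diagonal in `D'` runs from `0` to some `e`.
If its triangle on the long side, with third vertex `w`, has a side on the boundary too, then the
diagonals from `z` to `a` and from `e` to `w` are interlaced, and the longer one of them has no
counterpart: the diagonals of the other triangulation that are confined to the same arc are too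
short, and the remaining candidates are interlaced with a chord of their own length. -/
theorem false_of_matching {X : Finset ℝ} (hX : ∀ x ∈ X, 0 ≤ x ∧ x < Real.pi)
    {E E' D D' : ℝ → ℝ → Prop}
    (nc : ∀ x ∈ X, ∀ y ∈ X, ∀ z ∈ X, ∀ w ∈ X, x < y → y < z → z < w → E x z → E y w → False)
    (nc' : ∀ x ∈ X, ∀ y ∈ X, ∀ z ∈ X, ∀ w ∈ X, x < y → y < z → z < w → E' x z → E' y w → False)
    (hD : ∀ x ∈ X, ∀ y ∈ X, x < y → (D x y ↔ E x y ∧ (∃ m ∈ X, x < m ∧ m < y) ∧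
      ∃ m ∈ X, m < x ∨ y < m))
    (hD' : ∀ x ∈ X, ∀ y ∈ X, x < y → (D' x y ↔ E' x y ∧ (∃ m ∈ X, x < m ∧ m < y) ∧
      ∃ m ∈ X, m < x ∨ y < m))
    (hlen : ∀ x ∈ X, ∀ y ∈ X, ∀ z ∈ X, ∀ w ∈ X, x < y → y < z → z < w →
      min (z - x) (Real.pi - (z - x)) ≠ min (w - y) (Real.pi - (w - y)))
    (hcom : ∀ x ∈ X, ∀ y ∈ X, x < y → D x y → D' x y → False)
    (hm : ∀ x ∈ X, ∀ y ∈ X, x < y → D x y → ∃ x' ∈ X, ∃ y' ∈ X, x' < y' ∧ D' x' y' ∧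
      min (y' - x') (Real.pi - (y' - x')) = min (y - x) (Real.pi - (y - x)))
    (hm' : ∀ x ∈ X, ∀ y ∈ X, x < y → D' x y → ∃ x' ∈ X, ∃ y' ∈ X, x' < y' ∧ D x' y' ∧
      min (y' - x') (Real.pi - (y' - x')) = min (y - x) (Real.pi - (y - x)))
    {a z : ℝ} (h0 : 0 ∈ X) (hz : z ∈ X) (ha : a ∈ X) (h0z : 0 < z) (hza : z < a)
    (hpa : Real.pi / 2 ≤ a) (hD0 : D 0 a)
    (hmax : ∀ x ∈ X, ∀ y ∈ X, x < y → D x y → min (y - x) (Real.pi - (y - x)) ≤ Real.pi - a)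
    (hEz : E z a) (hzmin : ∀ m ∈ X, 0 < m → z ≤ m)
    (hap : ∀ e ∈ X, 0 < e → D' 0 e → ∃ w ∈ X, e < w ∧ E' 0 w ∧ E' e w ∧ ¬ (D' 0 w ∧ D' e w)) :
    False := by
  have h0a := h0z.trans hza
  have hE0 := ((hD 0 h0 a ha h0a).1 hD0).1
  have hmax' : ∀ x ∈ X, ∀ y ∈ X, x < y → D' x y →
      min (y - x) (Real.pi - (y - x)) ≤ Real.pi - a := by
    intro x hx y hy hxy hd
    obtain ⟨x', hx', y', hy', hxy', hd', he⟩ := hm' x hx y hy hxy hd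
    exact he ▸ hmax x' hx' y' hy' hxy' hd'
  -- the diagonal of the second triangulation that is as long as the chord from `0` to `a`
  obtain ⟨s, hs, e, he, hse, hd', hl⟩ := hm 0 h0 a ha h0a hD0
  rw [sub_zero, min_eq_right (by linarith : Real.pi - a ≤ a)] at hl
  obtain ⟨bs, bs'⟩ := hX s hs
  obtain ⟨be, be'⟩ := hX e he
  obtain ⟨ba, ba'⟩ := hX a ha
  have hE' := ((hD' s hs e he hse).1 hd').1
  have hsa : s < a := by
    by_contra! hle
    rcases min_choice (e - s) (Real.pi - (e - s)) with h | h <;> rw [h] at hl <;> linarith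
  obtain rfl : s = 0 := by
    by_contra hs0
    have hs0 : 0 < s := lt_of_le_of_ne bs (Ne.symm hs0)
    have hea : e ≤ a := by
      by_contra! hlt
      refine hlen 0 h0 s hs a ha e he hs0 hsa hlt ?_
      rw [hl, sub_zero, min_eq_right (by linarith)]
    have hzs := hzmin s hs hs0
    have hwid : e - s = Real.pi - a := by
      rcases min_choice (e - s) (Real.pi - (e - s)) with h | h <;> rw [h] at hl <;> linarith
    obtain ⟨-, ⟨m, hm, hm1, hm2⟩, -⟩ := (hD' s hs e he hse).1 hd'
    have hDz : D z a := (hD z hz a ha hza).2 ⟨hEz, ⟨m, hm, by linarith, by linarith⟩, 0, h0, .inl h0z⟩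
    have := hmax z hz a ha hza hDz
    rcases min_le_iff.1 this with h | h
    · have e1 : z = s := by linarith
      have e2 : a = e := by linarith
      subst e1 e2
      exact hcom z hz a ha hza hDz hd'
    · linarith
  rw [sub_zero] at hl
  have hea : e ≠ a := fun h => by subst h; exact hcom 0 h0 e he hse hD0 hd'
  have hel : e = Real.pi - a := by
    rcases min_choice e (Real.pi - e) with h | h <;> rw [h] at hl
    · exact hl
    · exact absurd (by linarith) hea
  have hea : e < a := lt_of_le_of_ne (by linarith) hea
  obtain ⟨-, ⟨m, hmX, hm1, hm2⟩, -⟩ := (hD' 0 h0 e he hse).1 hd'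
  have hze : z < e := (hzmin m hmX hm1).trans_lt hm2
  -- the triangle beyond this diagonal
  obtain ⟨w, hw, hew, hE0w, hEew, hnd⟩ := hap e he hse hd'
  obtain ⟨bw, bw'⟩ := hX w hw
  have h0w := hse.trans hew
  have haw : a < w := by
    by_contra! hle
    rcases hle.lt_or_eq with hlt | rfl
    · have hDw : D' 0 w := (hD' 0 h0 w hw h0w).2 ⟨hE0w, ⟨e, he, hse, hew⟩, a, ha, .inr hlt⟩
      rcases min_le_iff.1 (hmax' 0 h0 w hw h0w hDw) with h | h <;> linarith
    · obtain ⟨-, h1, h2⟩ := (hD 0 h0 w hw h0w).1 hD0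
      exact hcom 0 h0 w hw h0w hD0 ((hD' 0 h0 w hw h0w).2 ⟨hE0w, h1, h2⟩)
  have hDew : D' e w := (hD' e he w hw hew).2 ⟨hEew, ⟨a, ha, hea, haw⟩, 0, h0, .inl hse⟩
  have hwmax : ∀ m ∈ X, m ≤ w := by
    intro m hm
    by_contra! hlt
    exact hnd ⟨(hD' 0 h0 w hw h0w).2 ⟨hE0w, ⟨e, he, hse, hew⟩, m, hm, .inr hlt⟩, hDew⟩
  have hDza : D z a := (hD z hz a ha hza).2 ⟨hEz, ⟨e, he, hze, hea⟩, 0, h0, .inl h0z⟩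
  have l1 : a - z ≤ Real.pi - a := by
    rcases min_le_iff.1 (hmax z hz a ha hza hDza) with h | h <;> linarith
  have l2 : w - e ≤ Real.pi - a := by
    rcases min_le_iff.1 (hmax' e he w hw hew hDew) with h | h <;> linarith
  have m1 : min (a - z) (Real.pi - (a - z)) = a - z := min_eq_left (by linarith)
  have m2 : min (w - e) (Real.pi - (w - e)) = w - e := min_eq_left (by linarith)
  have hne := hlen z hz e he a ha w hw hze hea haw
  rw [m1, m2] at hne
  have hpos : ∀ x ∈ X, x = 0 ∨ z ≤ x := fun x hx => by
    rcases (hX x hx).1.eq_or_lt with h | h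
    · exact .inl h.symm
    · exact .inr (hzmin x hx h)
  rcases hne.lt_or_gt with hlt | hlt
  · -- the chord from `e` to `w` is the longer one and has no match in the first triangulation
    obtain ⟨p, hp, q, hq, hpq, hd, hl'⟩ := hm' e he w hw hew hDew
    rw [m2] at hl'
    have hle : w - e ≤ q - p := hl' ▸ min_le_left _ _
    obtain ⟨hEpq, ⟨m, hm, hm1, hm2⟩, ⟨m', hm', hm3⟩⟩ := (hD p hp q hq hpq).1 hd
    have hqw := hwmax q hq
    rcases hpos p hp with rfl | hzp
    · rcases lt_trichotomy q a with hqa | rfl | hqa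
      · have := hzmin m hm hm1
        exact nc 0 h0 z hz q hq a ha h0z (by linarith) hqa hEpq hEz
      · exact hlen 0 h0 e he q hq w hw hse hea haw (by rw [m2, hl'])
      · have : q < w := by
          rcases hm3 with h | h
          · linarith [(hX m' hm').1]
          · exact h.trans_le (hwmax m' hm')
        exact hlen 0 h0 e he q hq w hw hse (by linarith) this (by rw [m2, hl'])
    · rcases le_or_gt q a with hqa | hqa
      · linarith
      · rcases lt_or_ge p a with hpa | hpa
        · exact nc 0 h0 p hp a ha q hq (by linarith) hpa hqa hE0 hEpq
        · linarith
  · -- the chord from `z` to `a` is the longer one and has no match in the second triangulation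
    obtain ⟨p, hp, q, hq, hpq, hd, hl'⟩ := hm z hz a ha hza hDza
    rw [m1] at hl'
    have hle : a - z ≤ q - p := hl' ▸ min_le_left _ _
    obtain ⟨hEpq, ⟨m, hm, hm1, hm2⟩, ⟨m', hm', hm3⟩⟩ := (hD' p hp q hq hpq).1 hd
    have hqw := hwmax q hq
    rcases le_or_gt q e with hqe | hqe
    · rcases hpos p hp with rfl | hzp
      · have := hzmin m hm hm1
        exact hlen 0 h0 z hz q hq a ha h0z (by linarith) (by linarith) (by rw [m1, hl'])
      · linarith
    · rcases lt_or_ge p e with hpe | hpe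
      · rcases hqw.lt_or_eq with hqw | rfl
        · exact nc' p hp e he q hq w hw hpe hqe hqw hEpq hEew
        · rcases hpos p hp with rfl | hzp
          · rcases hm3 with h | h
            · linarith [(hX m' hm').1]
            · linarith [hwmax m' hm']
          · exact nc' 0 h0 p hp e he q hq (by linarith) hpe hqe hE' hEpq
      · linarith

/-! ### Diagonals split a triangulation -/

theorem exists_inscribed {K : Finset Plane} {U : Finset (Finset Plane)} {o : Plane} {R : ℝ}
    (hK : ∀ p ∈ K, dist p o = R) (hcard : 2 ≤ K.card) {b : Plane} (hb : b ∈ K) {s : ℝ}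
    (hs : s * s = 1) (h : IsTri K U) :
    ∃ (F : Frame) (X : Finset ℝ), F.s = s ∧ Inscribed F X U ∧ K = X.image F.pt ∧ 0 ∈ X ∧
      F.pt 0 = b := by
  obtain ⟨F, X, h1, h2, rfl, h3, h4⟩ := exists_frame hK hcard hb hs
  exact ⟨F, X, h1, ⟨h2, h⟩, rfl, h3, h4⟩

/-- No triangle crosses the line of an edge of a triangulation of concyclic points. -/
theorem IsTri.side_of_edge {K : Finset Plane} {U : Finset (Finset Plane)} {o : Plane} {R : ℝ}
    (hK : ∀ p ∈ K, dist p o = R) (h : IsTri K U) {a b : Plane} (hab : a ≠ b) (he : Edge U a b)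
    {t : Finset Plane} (ht : t ∈ U) :
    (∀ p ∈ t, 0 ≤ orient a b p) ∨ ∀ p ∈ t, orient a b p ≤ 0 := by
  by_contra! hcon
  obtain ⟨⟨p, hp, hp0⟩, ⟨q, hq, hq0⟩⟩ := hcon
  have he' := he
  obtain ⟨t', ht', hat, hbt⟩ := he'
  have haK := h.subset t' ht' hat
  have hbK := h.subset t' ht' hbt
  obtain ⟨F, X, hs, hI, rfl, -, -⟩ := exists_inscribed hK
    (Finset.one_lt_card.2 ⟨a, haK, b, hbK, hab⟩) haK (one_mul 1) h
  obtain ⟨x, hx, rfl⟩ := Finset.mem_image.1 haK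
  obtain ⟨y, hy, rfl⟩ := Finset.mem_image.1 hbK
  obtain ⟨m, hm, rfl⟩ := Finset.mem_image.1 (h.subset t ht hp)
  obtain ⟨n, hn, rfl⟩ := Finset.mem_image.1 (h.subset t ht hq)
  have hmn : Edge U (F.pt m) (F.pt n) := ⟨t, ht, hp, hq⟩
  have key : ∀ x y m n, x ∈ X → y ∈ X → m ∈ X → n ∈ X → Edge U (F.pt x) (F.pt y) →
      Edge U (F.pt m) (F.pt n) → orient (F.pt x) (F.pt y) (F.pt m) < 0 →
      0 < orient (F.pt x) (F.pt y) (F.pt n) → ¬ x < y := by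
    intro x y m n hx hy hm hn he hmn h1 h2 hxy
    rw [← one_mul (orient _ _ _), ← hs,
      Frame.orient_neg_iff (hI.mem x hx).1 hxy (hI.mem y hy).2 (hI.mem m hm).1 (hI.mem m hm).2] at h1
    rw [← one_mul (orient _ _ _), ← hs,
      Frame.orient_pos_iff (hI.mem x hx).1 hxy (hI.mem y hy).2 (hI.mem n hn).1 (hI.mem n hn).2] at h2
    rcases h2 with h2 | h2
    · exact hI.not_cross hn hx hm hy h2 h1.1 h1.2 hmn.symm he
    · exact hI.not_cross hx hm hy hn h1.1 h1.2 h2 he hmn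
  rcases lt_trichotomy x y with hxy | rfl | hxy
  · exact key x y m n hx hy hm hn he hmn hp0 hq0 hxy
  · exact hab rfl
  · exact key y x n m hy hx hn hm he.symm hmn.symm (by rw [orient_swap]; linarith)
      (by rw [orient_swap]; linarith) hxy

theorem IsTri.split_edge {K : Finset Plane} {U : Finset (Finset Plane)} {o : Plane} {R : ℝ}
    (hK : ∀ p ∈ K, dist p o = R) (h : IsTri K U) {a b : Plane} (hab : a ≠ b) (he : Edge U a b) :
    IsTri (K.filter fun p => 0 ≤ orient a b p)
      (U.filter fun t => t ⊆ K.filter fun p => 0 ≤ orient a b p) := by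
  obtain ⟨q, hq⟩ := exists_orient_ne hab
  exact h.split (isAff_orient a b)
    (show orient a b q ≠ orient a b a by rwa [orient_left]) (fun t ht => h.side_of_edge hK hab he ht) rfl

/-! ### The fan triangulation -/

theorem Frame.dist_center (F : Frame) (x : ℝ) :
    dist (F.pt x) F.o = √(F.u 0 ^ 2 + F.u 1 ^ 2) := by
  rw [EuclideanSpace.dist_eq]
  congr 1
  simp only [Fin.sum_univ_two, Real.dist_eq, sq_abs, Frame.pt, Matrix.cons_val_zero,
    Matrix.cons_val_one, Matrix.cons_val_fin_one]
  have := Real.sin_sq_add_cos_sq (2 * x)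
  linear_combination (F.u 0 ^ 2 + F.u 1 ^ 2) * this +
    Real.sin (2 * x) ^ 2 * (F.u 0 ^ 2 + F.u 1 ^ 2) * F.s_mul

/-- The triangles that join the point with parameter `0` to two consecutive further points. -/
def fan (F : Frame) (X : Finset ℝ) : Finset (Finset Plane) :=
  ((X ×ˢ X).filter fun e => 0 < e.1 ∧ e.1 < e.2 ∧ ∀ m ∈ X, m ≤ e.1 ∨ e.2 ≤ m).image
    fun e => {F.pt 0, F.pt e.1, F.pt e.2}

theorem mem_fan {F : Frame} {X : Finset ℝ} {t : Finset Plane} : t ∈ fan F X ↔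
    ∃ p ∈ X, ∃ q ∈ X, 0 < p ∧ p < q ∧ (∀ m ∈ X, m ≤ p ∨ q ≤ m) ∧
      t = {F.pt 0, F.pt p, F.pt q} := by
  simp only [fan, Finset.mem_image, Finset.mem_filter, Finset.mem_product, Prod.exists]
  constructor
  · rintro ⟨p, q, ⟨⟨hp, hq⟩, h0, h1, h2⟩, rfl⟩; exact ⟨p, hp, q, hq, h0, h1, h2, rfl⟩
  · rintro ⟨p, hp, q, hq, h0, h1, h2, rfl⟩; exact ⟨p, q, ⟨⟨hp, hq⟩, h0, h1, h2⟩, rfl⟩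

theorem inscribed_fan {F : Frame} (hs : F.s = 1) {X : Finset ℝ}
    (hX : ∀ x ∈ X, 0 ≤ x ∧ x < Real.pi) (h0 : 0 ∈ X) {p₀ q₀ : ℝ} (hp₀ : p₀ ∈ X) (hq₀ : q₀ ∈ X)
    (hp₀0 : 0 < p₀) (hpq₀ : p₀ < q₀) : Inscribed F X (fan F X) := by
  have hpos : ∀ {x y z : ℝ}, x ∈ X → z ∈ X → x < y → y < z →
      0 < orient (F.pt x) (F.pt y) (F.pt z) := fun hx hz hxy hyz => by
    have := Frame.orient_pos (F := F) (hX _ hx).1 hxy hyz (hX _ hz).2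
    rwa [hs, one_mul] at this
  have hnn : ∀ {x y z : ℝ}, x ∈ X → z ∈ X → x ≤ y → y ≤ z →
      0 ≤ orient (F.pt x) (F.pt y) (F.pt z) := fun hx hz hxy hyz => by
    rcases hxy.eq_or_lt with rfl | hxy
    · simp
    rcases hyz.eq_or_lt with rfl | hyz
    · simp
    exact (hpos hx hz hxy hyz).le
  have hsub : ∀ t ∈ fan F X, t ⊆ X.image F.pt := by
    intro t ht
    obtain ⟨p, hp, q, hq, -, -, -, rfl⟩ := mem_fan.1 ht
    intro r hr
    simp only [Finset.mem_insert, Finset.mem_singleton] at hr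
    rcases hr with rfl | rfl | rfl
    exacts [Finset.mem_image_of_mem _ h0, Finset.mem_image_of_mem _ hp,
      Finset.mem_image_of_mem _ hq]
  have hcirc : ∀ p ∈ X.image F.pt, dist p F.o = √(F.u 0 ^ 2 + F.u 1 ^ 2) := by
    intro p hp
    obtain ⟨x, -, rfl⟩ := Finset.mem_image.1 hp
    exact F.dist_center x
  refine ⟨hX, ⟨?_, hsub, ?_, ?_, ?_⟩⟩
  · intro t ht
    obtain ⟨p, hp, q, hq, hp0, hpq, -, rfl⟩ := mem_fan.1 ht
    exact ⟨_, _, _, rfl, hpos h0 hq hp0 hpq⟩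
  · exact fun t ht p hp hpt =>
      mem_of_mem_hull_of_circle (fun r hr => hcirc r (hsub t ht hr)) (hcirc p hp) hpt
  · have key : ∀ p q p' q', p ∈ X → q ∈ X → p' ∈ X → q' ∈ X → 0 < p → p < q → 0 < p' → p' < q' →
        (∀ m ∈ X, m ≤ p ∨ q ≤ m) → p < p' →
        volume (hull {F.pt 0, F.pt p, F.pt q} ∩ hull {F.pt 0, F.pt p', F.pt q'}) = 0 := by
      intro p q p' q' hp hq hp' hq' h1 h2 h3 h4 h5 h6
      have h7 : q ≤ p' := (h5 p' hp').resolve_left h6.not_ge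
      have hf := isAff_orient (F.pt 0) (F.pt q)
      have hne : F.pt 0 ≠ F.pt q := (orient_ne (hpos h0 hq h1 h2).ne').2.2
      obtain ⟨r, hr⟩ := exists_orient_ne hne
      refine measure_mono_null ?_ (hf.volume_zero (show orient (F.pt 0) (F.pt q) r ≠
        orient (F.pt 0) (F.pt q) (F.pt 0) by rwa [orient_left]))
      rintro x ⟨hx, hx'⟩
      refine le_antisymm (hf.nonpos_of_mem ?_ hx) (hf.nonneg_of_mem ?_ hx')
      · intro y hy
        simp only [Finset.coe_insert, Finset.coe_singleton, Set.mem_insert_iff,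
          Set.mem_singleton_iff] at hy
        rcases hy with rfl | rfl | rfl
        · simp
        · rw [orient_swap']; linarith [hpos h0 hq h1 h2]
        · simp
      · intro y hy
        simp only [Finset.coe_insert, Finset.coe_singleton, Set.mem_insert_iff,
          Set.mem_singleton_iff] at hy
        rcases hy with rfl | rfl | rfl
        · simp
        · exact hnn h0 hp' (h1.trans h2).le h7
        · exact hnn h0 hq' (h1.trans h2).le (h7.trans h4.le)
    intro s hs' t ht hst
    obtain ⟨p, hp, q, hq, hp0, hpq, hm, rfl⟩ := mem_fan.1 hs'
    obtain ⟨p', hp', q', hq', hp0', hpq', hm', rfl⟩ := mem_fan.1 ht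
    rcases lt_trichotomy p p' with h | rfl | h
    · exact key p q p' q' hp hq hp' hq' hp0 hpq hp0' hpq' hm h
    · have e : q = q' := le_antisymm ((hm q' hq').resolve_left hpq'.not_ge)
        ((hm' q hq).resolve_left hpq.not_ge)
      exact absurd (by rw [e]) hst
    · rw [Set.inter_comm]
      exact key p' q' p q hp' hq' hp hq hp0' hpq' hp0 hpq hm' h
  · -- a point of the hull lies between two neighboring rays from the apex
    refine measure_mono_null (t := ∅) ?_ measure_empty
    rintro x ⟨hx, hxn⟩
    refine hxn ?_
    obtain ⟨M, hM, hMmax⟩ := X.exists_max_image id ⟨0, h0⟩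
    have hMmax : ∀ m ∈ X, m ≤ M := hMmax
    let A := X.filter fun m => 0 < m ∧ m < M ∧ 0 ≤ orient (F.pt 0) (F.pt m) x
    have hhull : ∀ u v, u ∈ X → v ∈ X → (∀ m ∈ X, 0 ≤ orient (F.pt u) (F.pt v) (F.pt m)) →
        0 ≤ orient (F.pt u) (F.pt v) x := by
      intro u v hu hv hm
      refine (isAff_orient _ _).nonneg_of_mem ?_ hx
      intro y hy
      obtain ⟨m, hmX, rfl⟩ := Finset.mem_image.1 (Finset.mem_coe.1 hy)
      exact hm m hmX
    have hA : A.Nonempty := by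
      obtain ⟨μ, hμ, hμmin⟩ := (X.filter fun m => 0 < m).exists_min_image id
        ⟨p₀, Finset.mem_filter.2 ⟨hp₀, hp₀0⟩⟩
      obtain ⟨hμX, hμ0⟩ := Finset.mem_filter.1 hμ
      have hμmin : ∀ m ∈ X, 0 < m → μ ≤ m := fun m hm hm0 =>
        hμmin m (Finset.mem_filter.2 ⟨hm, hm0⟩)
      refine ⟨μ, Finset.mem_filter.2 ⟨hμX, hμ0,
        (hμmin p₀ hp₀ hp₀0).trans_lt (hpq₀.trans_le (hMmax q₀ hq₀)), hhull 0 μ h0 hμX ?_⟩⟩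
      intro m hm
      rcases (hX m hm).1.eq_or_lt with rfl | hm0
      · simp
      · exact hnn h0 hm hμ0.le (hμmin m hm hm0)
    obtain ⟨p, hpA, hpmax⟩ := A.exists_max_image id hA
    obtain ⟨hp, hp0, hpM, hpx⟩ := Finset.mem_filter.1 hpA
    obtain ⟨q, hqA, hqmin⟩ := (X.filter fun m => p < m).exists_min_image id
      ⟨M, Finset.mem_filter.2 ⟨hM, hpM⟩⟩
    obtain ⟨hq, hpq⟩ := Finset.mem_filter.1 hqA
    have hcons : ∀ m ∈ X, m ≤ p ∨ q ≤ m := fun m hm => by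
      rcases le_or_gt m p with h | h
      · exact .inl h
      · exact .inr (hqmin m (Finset.mem_filter.2 ⟨hm, h⟩))
    have hqx : 0 ≤ orient (F.pt q) (F.pt 0) x := by
      rcases (hMmax q hq).eq_or_lt with rfl | hqM
      · refine hhull _ 0 hq h0 fun m hm => ?_
        rw [orient_rot']
        exact hnn h0 hq (hX m hm).1 (hMmax m hm)
      · by_contra! hlt
        have := hpmax q (Finset.mem_filter.2 ⟨hq, hp0.trans hpq, hqM, by
          rw [orient_swap]; linarith⟩)
        exact absurd hpq (not_lt.2 this)
    have hpqx : 0 ≤ orient (F.pt p) (F.pt q) x := by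
      refine hhull p q hp hq fun m hm => ?_
      rcases hcons m hm with h | h
      · rw [orient_rot]; exact hnn hm hq h hpq.le
      · exact hnn hp hm hpq.le h
    refine Set.mem_iUnion₂.2 ⟨_, mem_fan.2 ⟨p, hp, q, hq, hp0, hpq, hcons, rfl⟩, ?_⟩
    rw [hull_triple, mem_triangle (hpos h0 hq hp0 hpq)]
    exact ⟨hpx, hpqx, hqx⟩

/-! ### Triangles of optimal triangulations have a side on the boundary -/

/-- The lengths of chords with parameter differences `a` and `b` are proportional to the sines, and
compare like the distances of `a` and `b` to the ends of `[0, π]`. -/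
theorem min_le_min_of_sin_le {a b : ℝ} (ha : 0 ≤ a) (ha' : a ≤ Real.pi) (hb : 0 ≤ b)
    (hb' : b ≤ Real.pi) (h : Real.sin a ≤ Real.sin b) :
    min a (Real.pi - a) ≤ min b (Real.pi - b) := by
  have key : ∀ c, 0 ≤ c → c ≤ Real.pi → Real.sin c = Real.sin (min c (Real.pi - c)) := by
    intro c _ _
    rcases min_choice c (Real.pi - c) with h | h <;> rw [h]
    rw [Real.sin_pi_sub]
  have hle : ∀ c, 0 ≤ c → c ≤ Real.pi → min c (Real.pi - c) ∈ Set.Icc (-(Real.pi / 2)) (Real.pi / 2) := by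
    intro c h1 h2
    have := Real.pi_pos
    constructor
    · exact le_min (by linarith) (by linarith)
    · rcases le_total c (Real.pi / 2) with h | h
      · exact (min_le_left _ _).trans h
      · exact (min_le_right _ _).trans (by linarith)
  rw [key a ha ha', key b hb hb'] at h
  exact (Real.strictMonoOn_sin.le_iff_le (hle a ha ha') (hle b hb hb')).1 h

namespace Inscribed

variable {F : Frame} {X : Finset ℝ} {U V : Finset (Finset Plane)}

theorem oppAngle_mem (h : Inscribed F X U) {x y : ℝ} (hx : x ∈ X) (hy : y ∈ X) :
    0 ≤ oppAngle (x, y) ∧ oppAngle (x, y) ≤ Real.pi := by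
  obtain ⟨b1, b2⟩ := h.mem x hx
  obtain ⟨b3, b4⟩ := h.mem y hy
  unfold oppAngle
  split_ifs with h
  · simp only at h ⊢; constructor <;> linarith
  · simp only at h ⊢; constructor <;> linarith

theorem min_le_oppAngle (h : Inscribed F X U) {x y u v : ℝ} (hx : x ∈ X) (hy : y ∈ X)
    (hxy : x < y) (hu : u ∈ X) (hv : v ∈ X)
    (hd : dist (F.pt x) (F.pt y) ≤ dist (F.pt u) (F.pt v)) :
    min (y - x) (Real.pi - (y - x)) ≤ oppAngle (u, v) := by
  have b1 := h.mem x hx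
  have b2 := h.mem y hy
  have b3 := h.mem u hu
  have b4 := h.mem v hv
  rw [Frame.dist_pt, Frame.dist_pt] at hd
  have hd := le_of_mul_le_mul_left hd (Real.sqrt_pos.2 F.d2_pos)
  rw [← sin_oppAngle b3 b4, abs_of_pos (Frame.sin_pos b1.1 hxy b2.2)] at hd
  have hm := h.oppAngle_mem hu hv
  exact (min_le_min_of_sin_le (by linarith) (by linarith) hm.1 hm.2 hd).trans (min_le_left _ _)

/-- The diagonals of the fan triangulation start at its apex. -/
theorem diag_fan (h : Inscribed F X (fan F X)) (h0 : 0 ∈ X) {x y : ℝ} (hx : x ∈ X) (hy : y ∈ X)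
    (hxy : x < y) (hd : Diag (X.image F.pt) (fan F X) (F.pt x) (F.pt y)) :
    x = 0 ∧ (∃ m ∈ X, 0 < m ∧ m < y) ∧ ∃ m ∈ X, y < m := by
  obtain ⟨⟨t, ht, hxt, hyt⟩, ⟨m, hm, hm0⟩, ⟨m', hm', hm0'⟩⟩ := (diag_iff hx hy).1 hd
  have b1 := h.mem x hx
  have b2 := h.mem y hy
  rw [Frame.orient_pos_iff b1.1 hxy b2.2 (h.mem m hm).1 (h.mem m hm).2] at hm0
  rw [Frame.orient_neg_iff b1.1 hxy b2.2 (h.mem m' hm').1 (h.mem m' hm').2] at hm0'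
  have hx0 : x = 0 := by
    obtain ⟨p, hp, q, hq, hp0, hpq, hc, rfl⟩ := mem_fan.1 ht
    simp only [Finset.mem_insert, Finset.mem_singleton] at hxt hyt
    rcases hxt with e | e | e
    · exact h.inj hx h0 e
    · rcases hyt with e' | e' | e'
      · have := h.inj hy h0 e'; linarith
      · have := h.inj hy hp e'; have := h.inj hx hp e; linarith
      · obtain rfl := h.inj hy hq e'
        obtain rfl := h.inj hx hp e
        rcases hc m' hm' with h | h <;> linarith
    · rcases hyt with e' | e' | e'
      · have := h.inj hy h0 e'; linarith
      · have := h.inj hy hp e'; have := h.inj hx hq e; linarith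
      · have := h.inj hy hq e'; have := h.inj hx hq e; linarith
  subst hx0
  exact ⟨rfl, ⟨m', hm', hm0'.1, hm0'.2⟩, m, hm, hm0.resolve_left (h.mem m hm).1.not_gt⟩

end Inscribed

/-- If a shortest diagonal of an optimal triangulation lies beyond the side `a b` of a triangle with
vertices `c`, `a`, `b`, then `c a` and `c b` are not both diagonals: otherwise the fan with
apex `c` is a better triangulation of `c` and the points beyond `a b`. -/
theorem Opt.false_of_shortest_diag {K : Finset Plane} {U : Finset (Finset Plane)} {o : Plane}
    {R : ℝ} (hK : ∀ p ∈ K, dist p o = R) (hU : Opt K U) {a b c p q : Plane} (ht : {c, a, b} ∈ U)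
    (h0 : 0 < orient c a b) (hca : Diag K U c a) (hcb : Diag K U c b) (hpq : Diag K U p q)
    (hp : orient a b p ≤ 0) (hq : orient a b q ≤ 0)
    (hmin : ∀ p' q', Diag K U p' q' → dist p q ≤ dist p' q') : False := by
  obtain ⟨F, X, hs, hI, rfl, h0X, rfl⟩ := exists_inscribed hK
    (Finset.one_lt_card.2 ⟨c, hca.left, a, hca.right, hca.ne⟩) hca.left (one_mul 1) hU.isTri
  obtain ⟨α, hα, rfl⟩ := Finset.mem_image.1 hca.right
  obtain ⟨β, hβ, rfl⟩ := Finset.mem_image.1 hcb.right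
  have hs1 : ∀ u v w, F.s * orient (F.pt u) (F.pt v) (F.pt w) = orient (F.pt u) (F.pt v) (F.pt w) :=
    fun u v w => by rw [hs, one_mul]
  have posI : ∀ x y m, x ∈ X → y ∈ X → m ∈ X → x < y →
      (0 < orient (F.pt x) (F.pt y) (F.pt m) ↔ m < x ∨ y < m) := fun x y m hx hy hm hxy => by
    rw [← hs1]
    exact Frame.orient_pos_iff (hI.mem x hx).1 hxy (hI.mem y hy).2 (hI.mem m hm).1 (hI.mem m hm).2
  have negI : ∀ x y m, x ∈ X → y ∈ X → m ∈ X → x < y →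
      (orient (F.pt x) (F.pt y) (F.pt m) < 0 ↔ x < m ∧ m < y) := fun x y m hx hy hm hxy => by
    rw [← hs1]
    exact Frame.orient_neg_iff (hI.mem x hx).1 hxy (hI.mem y hy).2 (hI.mem m hm).1 (hI.mem m hm).2
  have hα0 : 0 < α := lt_of_le_of_ne (hI.mem α hα).1 fun e => hca.ne (e ▸ rfl)
  have hβ0 : 0 < β := lt_of_le_of_ne (hI.mem β hβ).1 fun e => hcb.ne (e ▸ rfl)
  have hαβ : α < β := ((posI 0 α β h0X hα hβ hα0).1 h0).resolve_left hβ0.not_gt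
  have hrange : ∀ x ∈ X, orient (F.pt α) (F.pt β) (F.pt x) ≤ 0 → α ≤ x ∧ x ≤ β := by
    intro x hx h
    have := (posI α β x hα hβ hx hαβ).not.1 h.not_gt
    simpa using this
  -- the part of the triangulation formed by `c` and the points beyond `a b`
  let Y := X.filter fun m => m = 0 ∨ (α ≤ m ∧ m ≤ β)
  have hY : ∀ m, m ∈ Y ↔ m ∈ X ∧ (m = 0 ∨ (α ≤ m ∧ m ≤ β)) := fun m => Finset.mem_filter
  have hYX : Y ⊆ X := Finset.filter_subset _ _
  have h0Y : 0 ∈ Y := (hY 0).2 ⟨h0X, .inl rfl⟩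
  have hαY : α ∈ Y := (hY α).2 ⟨hα, .inr ⟨le_rfl, hαβ.le⟩⟩
  have hβY : β ∈ Y := (hY β).2 ⟨hβ, .inr ⟨hαβ.le, le_rfl⟩⟩
  obtain ⟨W, hWU, hW, hWt⟩ : ∃ W ⊆ U, IsTri (Y.image F.pt) W ∧
      ∀ t ∈ U, t ⊆ Y.image F.pt → t ∈ W := by
    have h1 := hU.isTri.split_edge hK hca.ne hca.edge
    set K1 := (X.image F.pt).filter fun p => 0 ≤ orient (F.pt 0) (F.pt α) p with hK1
    set U1 := U.filter fun t => t ⊆ K1 with hU1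
    have ht1 : {F.pt 0, F.pt α, F.pt β} ∈ U1 := by
      refine Finset.mem_filter.2 ⟨ht, fun r hr => ?_⟩
      simp only [Finset.mem_insert, Finset.mem_singleton] at hr
      rcases hr with rfl | rfl | rfl
      · exact Finset.mem_filter.2 ⟨hca.left, by simp⟩
      · exact Finset.mem_filter.2 ⟨hca.right, by simp⟩
      · exact Finset.mem_filter.2 ⟨hcb.right, h0.le⟩
    have h2 := h1.split_edge (fun p hp => hK p (Finset.mem_filter.1 hp).1) hcb.ne.symm
      ⟨_, ht1, by simp, by simp⟩
    have e : K1.filter (fun p => 0 ≤ orient (F.pt β) (F.pt 0) p) = Y.image F.pt := by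
      ext r
      simp only [Finset.mem_filter, hK1, Finset.mem_image]
      have e0 : ∀ m ∈ X, (0 ≤ orient (F.pt 0) (F.pt α) (F.pt m) ∧
          0 ≤ orient (F.pt β) (F.pt 0) (F.pt m)) ↔ (m = 0 ∨ (α ≤ m ∧ m ≤ β)) := by
        intro m hm
        have e1 := (negI 0 α m h0X hα hm hα0).not
        have e2 := (posI 0 β m h0X hβ hm hβ0).not
        rw [not_lt] at e1 e2
        rw [e1, orient_swap, neg_nonneg, e2]
        have := (hI.mem m hm).1
        constructor
        · rintro ⟨h1, h2⟩
          push Not at h1 h2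
          rcases this.eq_or_lt with h | h
          · exact .inl h.symm
          · exact .inr ⟨h1 h, h2.2⟩
        · rintro (rfl | ⟨h1, h2⟩)
          · simp [hβ0.le]
          · exact ⟨fun h => by linarith [h.2], fun h => by rcases h with h | h <;> linarith⟩
      constructor
      · rintro ⟨⟨⟨m, hm, rfl⟩, h3⟩, h4⟩
        exact ⟨m, (hY m).2 ⟨hm, (e0 m hm).1 ⟨h3, h4⟩⟩, rfl⟩
      · rintro ⟨m, hm, rfl⟩
        obtain ⟨hm, hm'⟩ := (hY m).1 hm
        obtain ⟨h3, h4⟩ := (e0 m hm).2 hm'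
        exact ⟨⟨⟨m, hm, rfl⟩, h3⟩, h4⟩
    rw [e] at h2
    refine ⟨_, (Finset.filter_subset _ _).trans (Finset.filter_subset _ _), h2, fun t ht htY => ?_⟩
    refine Finset.mem_filter.2 ⟨Finset.mem_filter.2 ⟨ht, htY.trans ?_⟩, htY⟩
    rw [← e]
    exact Finset.filter_subset _ _
  have hKY : Y.image F.pt ⊆ X.image F.pt := Finset.image_subset_image hYX
  have hWopt : Opt (Y.image F.pt) W := hU.sub hKY hWU hW
  have hIW : Inscribed F Y W := ⟨fun x hx => hI.mem x (hYX hx), hW⟩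
  have hIV : Inscribed F Y (fan F Y) :=
    inscribed_fan hs (fun x hx => hI.mem x (hYX hx)) h0Y hαY hβY hα0 hαβ
  have hdiag : ∀ u v, Diag (Y.image F.pt) W u v → Diag (X.image F.pt) U u v := by
    rintro u v ⟨h1, h2, ⟨t, ht, h3⟩, ⟨m, hm, h4⟩, ⟨m', hm', h5⟩⟩
    exact ⟨hKY h1, hKY h2, ⟨t, hWU ht, h3⟩, ⟨m, hKY hm, h4⟩, ⟨m', hKY hm', h5⟩⟩
  have key : ∀ x y, x ∈ X → y ∈ X → x < y → Diag (X.image F.pt) U (F.pt x) (F.pt y) →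
      α ≤ x → y ≤ β → (∀ p' q', Diag (X.image F.pt) U p' q' →
        dist (F.pt x) (F.pt y) ≤ dist p' q') → False := by
    intro x y hx hy hxy hd hαx hyβ hmin
    have hxY : x ∈ Y := (hY x).2 ⟨hx, .inr ⟨hαx, by linarith⟩⟩
    have hyY : y ∈ Y := (hY y).2 ⟨hy, .inr ⟨by linarith, hyβ⟩⟩
    have hlow : ∀ u ∈ X, ∀ v ∈ X, Diag (X.image F.pt) U (F.pt u) (F.pt v) →
        min (y - x) (Real.pi - (y - x)) ≤ Inscribed.oppAngle (u, v) := fun u hu v hv hd =>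
      hI.min_le_oppAngle hx hy hxy hu hv (hmin _ _ hd)
    have hdW : Diag (Y.image F.pt) W (F.pt x) (F.pt y) := by
      obtain ⟨he, -, m, hm, hm0⟩ := (Inscribed.diag_iff hx hy).1 hd
      obtain ⟨d, hdX, hdU, hd0⟩ := hI.apex he.symm hm (by rw [orient_swap]; linarith)
      rw [hs1, orient_swap, neg_pos, negI x y d hx hy hdX hxy] at hd0
      have hdY : d ∈ Y := (hY d).2 ⟨hdX, .inr ⟨by linarith, by linarith⟩⟩
      refine (Inscribed.diag_iff hxY hyY).2 ⟨⟨_, hWt _ hdU ?_, by simp, by simp⟩, ⟨0, h0Y, ?_⟩,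
        ⟨d, hdY, ?_⟩⟩
      · intro r hr
        simp only [Finset.mem_insert, Finset.mem_singleton] at hr
        rcases hr with rfl | rfl | rfl
        exacts [Finset.mem_image_of_mem _ hyY, Finset.mem_image_of_mem _ hxY,
          Finset.mem_image_of_mem _ hdY]
      · rw [hs1]; exact (posI x y 0 hx hy h0X hxy).2 (.inl (by linarith))
      · rw [hs1]; exact (negI x y d hx hy hdX hxy).2 hd0
    refine hWopt.not_better _ hIV.isTri (hIV.card_eq hIW) ?_
    rw [hIW.angleMul_eq, hIV.angleMul_eq, better_add_left]
    refine better_of_forall_lt (l := min (y - x) (Real.pi - (y - x))) ?_ ?_ ?_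
    · intro δ hδ
      obtain ⟨u, hu, v, hv, hd', rfl⟩ := Inscribed.mem_diagAngles.1 hδ
      exact hlow u (hYX hu) v (hYX hv) (hdiag _ _ hd')
    · rw [Inscribed.mem_diagAngles]
      rcases min_choice (y - x) (Real.pi - (y - x)) with h | h <;> rw [h]
      · exact ⟨x, hxY, y, hyY, hdW, by simp [Inscribed.oppAngle, hxy]⟩
      · exact ⟨y, hyY, x, hxY, hdW.symm, by simp [Inscribed.oppAngle, hxy.not_gt]⟩
    · -- the new diagonals join `c` to points strictly between `a` and `b`
      have l1 : min (y - x) (Real.pi - (y - x)) ≤ α := by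
        have := hlow 0 h0X α hα hca
        rwa [Inscribed.oppAngle, if_pos hα0, sub_zero] at this
      have l2 : min (y - x) (Real.pi - (y - x)) ≤ Real.pi - β := by
        have := hlow β hβ 0 h0X hcb.symm
        rwa [Inscribed.oppAngle, if_neg hβ0.not_gt, sub_zero] at this
      have hnew : ∀ v ∈ Y, 0 < v → Diag (Y.image F.pt) (fan F Y) (F.pt 0) (F.pt v) →
          α < v ∧ v < β := by
        intro v hv hv0 hd'
        obtain ⟨-, ⟨m, hm, hm0, hmv⟩, m', hm', hvm⟩ := hIV.diag_fan h0Y h0Y hv hv0 hd'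
        have h1 := ((hY m).1 hm).2.resolve_left hm0.ne'
        have h2 := ((hY m').1 hm').2.resolve_left (by linarith)
        exact ⟨by linarith, by linarith⟩
      intro δ hδ
      obtain ⟨u, hu, v, hv, hd', rfl⟩ := Inscribed.mem_diagAngles.1 hδ
      rcases lt_trichotomy u v with huv | rfl | huv
      · obtain ⟨rfl, -⟩ := hIV.diag_fan h0Y hu hv huv hd'
        have := hnew v hv huv hd'
        rw [Inscribed.oppAngle, if_pos huv]
        linarith
      · exact absurd rfl hd'.ne
      · obtain ⟨rfl, -⟩ := hIV.diag_fan h0Y hv hu huv hd'.symm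
        have := hnew u hu huv hd'.symm
        rw [Inscribed.oppAngle, if_neg huv.not_gt]
        linarith
  obtain ⟨x, hx, rfl⟩ := Finset.mem_image.1 hpq.left
  obtain ⟨y, hy, rfl⟩ := Finset.mem_image.1 hpq.right
  have hx' := hrange x hx hp
  have hy' := hrange y hy hq
  rcases lt_trichotomy x y with hxy | rfl | hxy
  · exact key x y hx hy hxy hpq hx'.1 hy'.2 hmin
  · exact hpq.ne rfl
  · exact key y x hy hx hxy hpq.symm hy'.1 hx'.2 (by rwa [dist_comm])

/-- A triangle of an optimal triangulation of concyclic points has a side on the boundary: a shortest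
diagonal lies beyond one of its three sides. -/
theorem Opt.not_three_diags {K : Finset Plane} {U : Finset (Finset Plane)} {o : Plane}
    {R : ℝ} (hK : ∀ p ∈ K, dist p o = R) (hU : Opt K U) {a b c : Plane} (ht : {a, b, c} ∈ U)
    (hab : Diag K U a b) (hbc : Diag K U b c) (hca : Diag K U c a) : False := by
  have key : ∀ a b c, {a, b, c} ∈ U → 0 < orient a b c → Diag K U a b → Diag K U b c →
      Diag K U c a → False := by
    intro a b c ht h0 hab hbc hca
    obtain ⟨⟨p, q⟩, hpq, hmin⟩ := ((K ×ˢ K).filter fun e => Diag K U e.1 e.2).exists_min_image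
      (fun e => dist e.1 e.2) ⟨(a, b), by simp [hab, hab.left, hab.right]⟩
    have hpq : Diag K U p q := (Finset.mem_filter.1 hpq).2
    have hmin : ∀ p' q', Diag K U p' q' → dist p q ≤ dist p' q' := fun p' q' h =>
      hmin (p', q') (by simp [h, h.left, h.right])
    have e1 : ({c, a, b} : Finset Plane) = {a, b, c} := by ext; simp; tauto
    have e2 : ({b, c, a} : Finset Plane) = {a, b, c} := by ext; simp; tauto
    obtain ⟨t', ht', hpt, hqt⟩ := hpq.edge
    have F1 := hU.false_of_shortest_diag hK (e1 ▸ ht) (by rwa [orient_rot']) hca hbc.symm hpq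
    have F2 := hU.false_of_shortest_diag hK ht h0 hab hca.symm hpq
    have F3 := hU.false_of_shortest_diag hK (e2 ▸ ht) (by rwa [orient_rot]) hbc hab.symm hpq
    have S1 := (hU.isTri.side_of_edge hK hab.ne hab.edge ht').resolve_right
      fun h => F1 (h p hpt) (h q hqt) hmin
    have S2 := (hU.isTri.side_of_edge hK hbc.ne hbc.edge ht').resolve_right
      fun h => F2 (h p hpt) (h q hqt) hmin
    have S3 := (hU.isTri.side_of_edge hK hca.ne hca.edge ht').resolve_right
      fun h => F3 (h p hpt) (h q hqt) hmin
    have hin : ∀ r ∈ t', r = a ∨ r = b ∨ r = c := by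
      intro r hr
      have : r ∈ hull {a, b, c} := by
        rw [hull_triple, mem_triangle h0]
        exact ⟨S1 r hr, S2 r hr, S3 r hr⟩
      simpa using hU.isTri.empty _ ht r (hU.isTri.subset _ ht' hr) this
    rcases hin p hpt with rfl | rfl | rfl <;> rcases hin q hqt with rfl | rfl | rfl
    · exact hpq.ne rfl
    · exact F1 (by simp) (by simp) hmin
    · exact F3 (by simp) (by simp) hmin
    · exact F1 (by simp) (by simp) hmin
    · exact hpq.ne rfl
    · exact F2 (by simp) (by simp) hmin
    · exact F3 (by simp) (by simp) hmin
    · exact F2 (by simp) (by simp) hmin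
    · exact hpq.ne rfl
  obtain h0 | h0 := ((hU.isTri.nondeg _ ht).orient_ne rfl).lt_or_gt
  · exact key b a c (by rwa [Finset.insert_comm]) (by rw [orient_swap]; linarith) hab.symm
      hca.symm hbc.symm
  · exact key a b c ht h0 hab hbc hca

/-! ### Uniqueness for concyclic points -/

namespace Inscribed

variable {F : Frame} {X : Finset ℝ} {U V : Finset (Finset Plane)}

theorem dist_eq (h : Inscribed F X U) {x y : ℝ} (hx : x ∈ X) (hy : y ∈ X) (hxy : x < y) :
    dist (F.pt x) (F.pt y) = √F.d2 * Real.sin (y - x) := by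
  rw [Frame.dist_pt, abs_of_pos (Frame.sin_pos (h.mem x hx).1 hxy (h.mem y hy).2)]

theorem diag_iff_lt (h : Inscribed F X U) {x y : ℝ} (hx : x ∈ X) (hy : y ∈ X) (hxy : x < y) :
    Diag (X.image F.pt) U (F.pt x) (F.pt y) ↔ Edge U (F.pt x) (F.pt y) ∧
      (∃ m ∈ X, x < m ∧ m < y) ∧ ∃ m ∈ X, m < x ∨ y < m := by
  rw [diag_iff hx hy]
  have b1 := (h.mem x hx).1
  have b2 := (h.mem y hy).2
  constructor
  · rintro ⟨h1, ⟨m, hm, h2⟩, ⟨m', hm', h3⟩⟩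
    exact ⟨h1, ⟨m', hm', (Frame.orient_neg_iff b1 hxy b2 (h.mem m' hm').1 (h.mem m' hm').2).1 h3⟩,
      ⟨m, hm, (Frame.orient_pos_iff b1 hxy b2 (h.mem m hm).1 (h.mem m hm).2).1 h2⟩⟩
  · rintro ⟨h1, ⟨m', hm', h3⟩, ⟨m, hm, h2⟩⟩
    exact ⟨h1, ⟨m, hm, (Frame.orient_pos_iff b1 hxy b2 (h.mem m hm).1 (h.mem m hm).2).2 h2⟩,
      ⟨m', hm', (Frame.orient_neg_iff b1 hxy b2 (h.mem m' hm').1 (h.mem m' hm').2).2 h3⟩⟩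

/-- Interlaced chords of the same length give a symmetric quadruple. -/
theorem isSymmetricQuadruple (h : Inscribed F X U) {x y z w : ℝ} (hx : x ∈ X) (hy : y ∈ X)
    (hz : z ∈ X) (hw : w ∈ X) (hxy : x < y) (hyz : y < z) (hzw : z < w)
    (he : min (z - x) (Real.pi - (z - x)) = min (w - y) (Real.pi - (w - y))) :
    IsSymmetricQuadruple (F.pt x) (F.pt y) (F.pt z) (F.pt w) where
  distinct := by
    have n1 : F.pt x ≠ F.pt y := fun e => hxy.ne (h.inj hx hy e)
    have n2 : F.pt x ≠ F.pt z := fun e => (hxy.trans hyz).ne (h.inj hx hz e)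
    have n3 : F.pt x ≠ F.pt w := fun e => (hxy.trans (hyz.trans hzw)).ne (h.inj hx hw e)
    have n4 : F.pt y ≠ F.pt z := fun e => hyz.ne (h.inj hy hz e)
    have n5 : F.pt y ≠ F.pt w := fun e => (hyz.trans hzw).ne (h.inj hy hw e)
    have n6 : F.pt z ≠ F.pt w := fun e => hzw.ne (h.inj hz hw e)
    simp [n1, n2, n3, n4, n5, n6]
  concyclic := by
    refine ⟨F.o, √(F.u 0 ^ 2 + F.u 1 ^ 2), fun p hp => ?_⟩
    simp only [Set.mem_insert_iff, Set.mem_singleton_iff] at hp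
    rcases hp with rfl | rfl | rfl | rfl <;> exact F.dist_center _
  diagonals_meet := by
    obtain ⟨p, h1, h2⟩ :=
      Frame.exists_mem_inter (F := F) (h.mem x hx).1 hxy hyz hzw (h.mem w hw).2
    exact ⟨p, openSegment_subset_segment ℝ _ _ h1, openSegment_subset_segment ℝ _ _ h2⟩
  diagonals_eq := by
    have key : ∀ c, Real.sin c = Real.sin (min c (Real.pi - c)) := by
      intro c
      rcases min_choice c (Real.pi - c) with h | h <;> rw [h]
      rw [Real.sin_pi_sub]
    rw [h.dist_eq hx hz (hxy.trans hyz), h.dist_eq hy hw (hyz.trans hzw), key (z - x), he, ← key]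

end Inscribed

theorem dot_comm (p a b : Plane) : dot p a b = dot p b a := by unfold dot; ring

/-- Two optimal triangulations of the same concyclic points have a common diagonal, if the first one
has any diagonal. Otherwise `false_of_matching` applies to a longest diagonal of the first one, with
parameters that start at a suitable end of it and run along its long side. -/
theorem Opt.exists_common_diag {K : Finset Plane} {U V : Finset (Finset Plane)} {o : Plane}
    {R : ℝ} (hK : ∀ p ∈ K, dist p o = R) (hU : Opt K U) (hV : Opt K V)
    (hsym : ∀ p ∈ K, ∀ q ∈ K, ∀ r ∈ K, ∀ s ∈ K, ¬ IsSymmetricQuadruple p q r s)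
    {p₀ q₀ : Plane} (hd : Diag K U p₀ q₀) : ∃ p q, Diag K U p q ∧ Diag K V p q := by
  by_contra! hcom
  obtain ⟨⟨b, c⟩, hbc, hmax⟩ := ((K ×ˢ K).filter fun e => Diag K U e.1 e.2).exists_max_image
    (fun e => dist e.1 e.2) ⟨(p₀, q₀), by simp [hd, hd.left, hd.right]⟩
  have hbc : Diag K U b c := (Finset.mem_filter.1 hbc).2
  have hmax : ∀ p' q', Diag K U p' q' → dist p' q' ≤ dist b c := fun p' q' h =>
    hmax (p', q') (by simp [h, h.left, h.right])
  have key : ∀ b c e, Diag K U b c → (∀ p' q', Diag K U p' q' → dist p' q' ≤ dist b c) →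
      {b, c, e} ∈ U → 0 ≤ dot e b c → Diag K U b e := by
    intro b c e hbc hmax ht hdot
    by_contra hbe
    -- the parameters start at `b` and run along the arc through `e` to `c`
    have hne := (hU.isTri.nondeg _ ht).orient_ne (show _ = {b, e, c} by ext; simp; tauto)
    obtain ⟨s, hs, hs0⟩ : ∃ s : ℝ, s * s = 1 ∧ 0 < s * orient b e c := by
      rcases hne.lt_or_gt with h | h
      · exact ⟨-1, by norm_num, by linarith⟩
      · exact ⟨1, by norm_num, by linarith⟩
    have heK : e ∈ K := hU.isTri.subset _ ht (by simp)
    obtain ⟨F, X, rfl, hI, rfl, h0, rfl⟩ := exists_inscribed hK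
      (Finset.one_lt_card.2 ⟨b, hbc.left, c, hbc.right, hbc.ne⟩) hbc.left hs hU.isTri
    have hI' : Inscribed F X V := ⟨hI.mem, hV.isTri⟩
    obtain ⟨z, hz, rfl⟩ := Finset.mem_image.1 heK
    obtain ⟨a, ha, rfl⟩ := Finset.mem_image.1 hbc.right
    obtain ⟨n1, n2, n3⟩ := orient_ne hne
    have h0z : 0 < z := lt_of_le_of_ne (hI.mem z hz).1 fun e => n1 (e ▸ rfl)
    have h0a : 0 < a := lt_of_le_of_ne (hI.mem a ha).1 fun e => n3 (e ▸ rfl)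
    obtain ⟨ba, ba'⟩ := hI.mem a ha
    have hza : z < a := ((Frame.orient_pos_iff (F := F) le_rfl h0z (hI.mem z hz).2
      ba ba').1 hs0).resolve_left h0a.not_gt
    have hpa : Real.pi / 2 ≤ a := by
      by_contra! hlt
      rw [Frame.dot_pt, zero_sub, Real.sin_neg, sub_zero] at hdot
      have c1 : 0 < Real.cos a := Real.cos_pos_of_mem_Ioo ⟨by linarith [Real.pi_pos], hlt⟩
      have c2 : 0 < Real.sin z := Real.sin_pos_of_pos_of_lt_pi h0z (hI.mem z hz).2
      have c3 := Frame.sin_pos h0z.le hza ba'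
      have c4 := F.d2_pos
      have : 0 < F.d2 * (Real.sin z * Real.sin (a - z) * Real.cos a) := by positivity
      linarith
    have hmin : ∀ {x y x' y' : ℝ}, x ∈ X → y ∈ X → x' ∈ X → y' ∈ X → x < y → x' < y' →
        dist (F.pt x) (F.pt y) ≤ dist (F.pt x') (F.pt y') →
        min (y - x) (Real.pi - (y - x)) ≤ min (y' - x') (Real.pi - (y' - x')) := by
      intro x y x' y' hx hy hx' hy' hxy hxy' hd
      rw [hI.dist_eq hx hy hxy, hI.dist_eq hx' hy' hxy'] at hd
      have b1 := hI.mem x hx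
      have b2 := hI.mem y hy
      have b3 := hI.mem x' hx'
      have b4 := hI.mem y' hy'
      exact min_le_min_of_sin_le (by linarith) (by linarith) (by linarith) (by linarith)
        (le_of_mul_le_mul_left hd (Real.sqrt_pos.2 F.d2_pos))
    have hmatch : ∀ {U V : Finset (Finset Plane)}, Inscribed F X U → Inscribed F X V →
        Opt (X.image F.pt) U → Opt (X.image F.pt) V → ∀ x ∈ X, ∀ y ∈ X, x < y →
        Diag (X.image F.pt) U (F.pt x) (F.pt y) → ∃ x' ∈ X, ∃ y' ∈ X, x' < y' ∧
        Diag (X.image F.pt) V (F.pt x') (F.pt y') ∧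
        min (y' - x') (Real.pi - (y' - x')) = min (y - x) (Real.pi - (y - x)) := by
      intro U V hI hI' hU hV x hx y hy hxy hd
      obtain ⟨p, q, hd', he⟩ := hI.exists_diag_dist_eq hI' hU hV hd
      obtain ⟨x', hx', rfl⟩ := Finset.mem_image.1 hd'.left
      obtain ⟨y', hy', rfl⟩ := Finset.mem_image.1 hd'.right
      rcases lt_trichotomy x' y' with h | rfl | h
      · exact ⟨x', hx', y', hy', h, hd', le_antisymm (hmin hx' hy' hx hy h hxy he.le)
          (hmin hx hy hx' hy' hxy h he.ge)⟩
      · exact absurd rfl hd'.ne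
      · rw [dist_comm] at he
        exact ⟨y', hy', x', hx', h, hd'.symm, le_antisymm (hmin hy' hx' hx hy h hxy he.le)
          (hmin hx hy hy' hx' hxy h he.ge)⟩
    refine false_of_matching (X := X) (E := fun x y => Edge U (F.pt x) (F.pt y))
      (E' := fun x y => Edge V (F.pt x) (F.pt y))
      (D := fun x y => Diag (X.image F.pt) U (F.pt x) (F.pt y))
      (D' := fun x y => Diag (X.image F.pt) V (F.pt x) (F.pt y)) hI.mem
      (fun x hx y hy z hz w hw => hI.not_cross hx hy hz hw)
      (fun x hx y hy z hz w hw => hI'.not_cross hx hy hz hw)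
      (fun x hx y hy hxy => hI.diag_iff_lt hx hy hxy)
      (fun x hx y hy hxy => hI'.diag_iff_lt hx hy hxy)
      (fun x hx y hy z hz w hw hxy hyz hzw he => hsym _ (Inscribed.pt_mem x hx) _
        (Inscribed.pt_mem y hy) _ (Inscribed.pt_mem z hz) _ (Inscribed.pt_mem w hw)
        (hI.isSymmetricQuadruple hx hy hz hw hxy hyz hzw he))
      (fun x hx y hy _ h h' => hcom _ _ h h')
      (hmatch hI hI' hU hV) (hmatch hI' hI hV hU) h0 hz ha h0z hza hpa hbc ?_ ?_ ?_ ?_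
    · intro x hx y hy hxy hd
      have := (hmin hx hy h0 ha hxy h0a (hmax _ _ hd)).trans (min_le_right _ _)
      rwa [sub_zero] at this
    · exact ⟨_, ht, by simp, by simp⟩
    · intro m hm hm0
      by_contra! hlt
      exact hbe ((hI.diag_iff_lt h0 hz h0z).2
        ⟨⟨_, ht, by simp, by simp⟩, ⟨m, hm, hm0, hlt⟩, a, ha, .inr hza⟩)
    · intro e he h0e hde
      obtain ⟨h1, ⟨m, hm, h2⟩, -⟩ := (Inscribed.diag_iff h0 he).1 hde
      obtain ⟨w, hw, hw1, hw2⟩ := hI'.apex h1 hm h2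
      rw [Frame.orient_pos_iff le_rfl h0e (hI.mem e he).2 (hI.mem w hw).1 (hI.mem w hw).2] at hw2
      refine ⟨w, hw, hw2.resolve_left (hI.mem w hw).1.not_gt, ⟨_, hw1, by simp, by simp⟩,
        ⟨_, hw1, by simp, by simp⟩, fun hh => ?_⟩
      exact hV.not_three_diags hK hw1 hde hh.2 hh.1.symm
  -- a triangle at the longest diagonal with an angle of at most `π / 2` opposite to it
  obtain ⟨e, ht, hdot⟩ : ∃ e, {b, c, e} ∈ U ∧ 0 ≤ dot e b c := by
    obtain ⟨F, X, -, hI, rfl, h0, rfl⟩ := exists_inscribed hK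
      (Finset.one_lt_card.2 ⟨b, hbc.left, c, hbc.right, hbc.ne⟩) hbc.left (one_mul 1) hU.isTri
    obtain ⟨a, ha, rfl⟩ := Finset.mem_image.1 hbc.right
    have h0a : 0 < a := lt_of_le_of_ne (hI.mem a ha).1 fun e => hbc.ne (e ▸ rfl)
    obtain ⟨he, ⟨m, hm, hm0⟩, ⟨m', hm', hm0'⟩⟩ := (Inscribed.diag_iff h0 ha).1 hbc
    have hd := F.d2_pos
    have ha' := (hI.mem a ha).2
    rcases le_total (Real.cos a) 0 with hcos | hcos
    · obtain ⟨d, hdX, hd1, hd2⟩ := hI.apex he.symm hm' (by rw [orient_swap]; linarith)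
      rw [orient_swap, mul_neg, neg_pos,
        Frame.orient_neg_iff le_rfl h0a ha' (hI.mem d hdX).1 (hI.mem d hdX).2] at hd2
      refine ⟨F.pt d, by rwa [Finset.insert_comm], ?_⟩
      rw [Frame.dot_pt, zero_sub, Real.sin_neg, sub_zero]
      have c1 : 0 < Real.sin d := Real.sin_pos_of_pos_of_lt_pi hd2.1 (hI.mem d hdX).2
      have c2 := Frame.sin_pos hd2.1.le hd2.2 ha'
      have : 0 ≤ F.d2 * (Real.sin d * Real.sin (a - d) * -Real.cos a) :=
        mul_nonneg hd.le (mul_nonneg (by positivity) (by linarith))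
      linarith
    · obtain ⟨d, hdX, hd1, hd2⟩ := hI.apex he hm hm0
      rw [Frame.orient_pos_iff le_rfl h0a ha' (hI.mem d hdX).1 (hI.mem d hdX).2] at hd2
      have hd2 := hd2.resolve_left (hI.mem d hdX).1.not_gt
      refine ⟨F.pt d, hd1, ?_⟩
      rw [Frame.dot_pt, zero_sub, Real.sin_neg, sub_zero, ← neg_sub d a, Real.sin_neg]
      have c1 : 0 < Real.sin d := Real.sin_pos_of_pos_of_lt_pi (h0a.trans hd2) (hI.mem d hdX).2
      have c2 := Frame.sin_pos h0a.le hd2 (hI.mem d hdX).2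
      have : 0 ≤ F.d2 * (Real.sin d * Real.sin (d - a) * Real.cos a) := by positivity
      linarith
  have h1 := key b c e hbc hmax ht hdot
  have h2 := key c b e hbc.symm (fun p q h => (hmax p q h).trans (dist_comm b c).le)
    (by rwa [Finset.insert_comm]) (by rwa [dot_comm])
  exact hU.not_three_diags hK ht hbc h2 h1.symm

/-- A triangle without diagonals as sides contains all the points. -/
theorem IsTri.subset_of_no_diag {K : Finset Plane} {U : Finset (Finset Plane)}
    (h : IsTri K U) (hno : ∀ p q, ¬ Diag K U p q) {t : Finset Plane}
    (ht : t ∈ U) : K ⊆ t := by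
  obtain ⟨a, b, c, rfl, h0⟩ := h.nondeg t ht
  have hs := h.subset _ ht
  have haK : a ∈ K := hs (by simp)
  have hbK : b ∈ K := hs (by simp)
  have hcK : c ∈ K := hs (by simp)
  intro p hp
  refine h.empty _ ht p hp ?_
  rw [hull_triple, mem_triangle h0]
  refine ⟨?_, ?_, ?_⟩ <;> by_contra! hlt
  · exact hno a b ⟨haK, hbK, ⟨_, ht, by simp, by simp⟩, ⟨c, hcK, h0⟩, p, hp, hlt⟩
  · exact hno b c ⟨hbK, hcK, ⟨_, ht, by simp, by simp⟩, ⟨a, haK, by rwa [orient_rot]⟩, p, hp, hlt⟩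
  · exact hno c a ⟨hcK, haK, ⟨_, ht, by simp, by simp⟩, ⟨b, hbK, by rwa [orient_rot']⟩, p, hp, hlt⟩

/-- Concyclic points without symmetric quadruples have at most one optimal triangulation. -/
theorem Opt.subset_of_concyclic {o : Plane} {R : ℝ} (K : Finset Plane) :
    (∀ p ∈ K, dist p o = R) →
    (∀ p ∈ K, ∀ q ∈ K, ∀ r ∈ K, ∀ s ∈ K, ¬ IsSymmetricQuadruple p q r s) →
    ∀ U V, Opt K U → Opt K V → U ⊆ V := by
  induction K using Finset.strongInduction with
  | H K ih =>
    intro hK hsym U V hU hV t ht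
    by_cases hno : ∀ p q, ¬ Diag K U p q
    · have hn := hU.isTri.nondeg t ht
      have htK := hU.isTri.subset t ht
      obtain ⟨x, hx⟩ := Finset.card_pos.1 (by rw [hn.card]; norm_num : 0 < t.card)
      obtain ⟨s, hs, -⟩ := hV.isTri.full_cover hn htK (subset_convexHull ℝ _ (htK hx))
      have hst := (hV.isTri.subset s hs).trans (hU.isTri.subset_of_no_diag hno ht)
      rwa [← Finset.eq_of_subset_of_card_le hst (by rw [hn.card, (hV.isTri.nondeg s hs).card])]
    · push Not at hno
      obtain ⟨p₀, q₀, hd⟩ := hno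
      obtain ⟨p, q, h1, h2⟩ := hU.exists_common_diag hK hV hsym hd
      have key : ∀ p q, Diag K U p q → Diag K V p q → (∀ x ∈ t, 0 ≤ orient p q x) → t ∈ V := by
        intro p q h1 h2 ht0
        have hQ := Finset.filter_subset (fun x => 0 ≤ orient p q x) K
        have hUQ := hU.sub hQ (Finset.filter_subset _ _) (hU.isTri.split_edge hK h1.ne h1.edge)
        have hVQ := hV.sub hQ (Finset.filter_subset _ _) (hV.isTri.split_edge hK h2.ne h2.edge)
        have hss : K.filter (fun x => 0 ≤ orient p q x) ⊂ K := by
          refine Finset.filter_ssubset.2 ?_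
          obtain ⟨m, hm, hm0⟩ := h1.exists_neg
          exact ⟨m, hm, hm0.not_ge⟩
        have := ih _ hss (fun x hx => hK x (hQ hx))
          (fun a ha b hb c hc d hd => hsym a (hQ ha) b (hQ hb) c (hQ hc) d (hQ hd)) _ _ hUQ hVQ
          (Finset.mem_filter.2 ⟨ht, fun x hx =>
            Finset.mem_filter.2 ⟨hU.isTri.subset t ht hx, ht0 x hx⟩⟩)
        exact (Finset.mem_filter.1 this).1
      rcases hU.isTri.side_of_edge hK h1.ne h1.edge ht with h | h
      · exact key p q h1 h2 h
      · exact key q p h1.symm h2.symm fun x hx => by rw [orient_swap]; linarith [h x hx]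

/-! ### Max-min angle Delaunay triangulations -/

/-- Two optimal triangulations agree: both triangulate the points on the circumcircle of a triangle
of the first one, and the points of a circle have at most one optimal triangulation. -/
theorem Opt.subset {P : Finset Plane} {T V : Finset (Finset Plane)}
    (hsym : ∀ p ∈ P, ∀ q ∈ P, ∀ r ∈ P, ∀ s ∈ P, ¬ IsSymmetricQuadruple p q r s)
    (hT : Opt P T) (hV : Opt P V) : T ⊆ V := by
  intro t ht
  obtain ⟨a, b, c, rfl, h0⟩ := hT.isTri.nondeg t ht
  set K := P.filter (fun p => incirc a b c p = 0) with hK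
  have hKP : K ⊆ P := Finset.filter_subset _ _
  have hemp : ∀ p ∈ P, incirc a b c p ≤ 0 := fun p hp => hT.delaunay ht h0 hp
  have h1 := hT.sub hKP (Finset.filter_subset _ _)
    (hT.isTri.cell (fun a b c h h' p hp => hT.delaunay h h' hp) h0 hemp hK)
  have h2 := hV.sub hKP (Finset.filter_subset _ _)
    (hV.isTri.cell (fun a b c h h' p hp => hV.delaunay h h' hp) h0 hemp hK)
  obtain ⟨o, R, ho⟩ := exists_center h0.ne'
  have := Opt.subset_of_concyclic K (fun p hp => ho p (Finset.mem_filter.1 hp).2)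
    (fun p hp q hq r hr s hs => hsym p (hKP hp) q (hKP hq) r (hKP hr) s (hKP hs)) _ _ h1 h2
    (Finset.mem_filter.2 ⟨ht, fun p hp =>
      Finset.mem_filter.2 ⟨hT.isTri.subset _ ht hp, incirc_vertex hp⟩⟩)
  exact (Finset.mem_filter.1 this).1

theorem IsMaxMinAngleDelaunay.opt {P : Finset Plane} (hP : Planar P)
    {τ : Geometry.SimplicialComplex ℝ Plane} (h : IsMaxMinAngleDelaunay P τ) :
    Opt P (triangles P τ) := by
  refine ⟨h.isTriangulation.isTri, fun V hV hc hb => ?_⟩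
  have h1 := h.angleList_le _ (hV.isTriangulation hP)
  have h2 := hb.sort_lt (by rw [card_angleMul h.isTriangulation.isTri, card_angleMul hV, hc])
  rw [angleList, angleList, angles, angles, hV.triangles_complex] at h1
  exact absurd h2 (not_lt.2 h1)

theorem exists_isMaxMinAngleDelaunay {P : Finset Plane} (hP : Planar P) :
    ∃ τ, IsMaxMinAngleDelaunay P τ := by
  obtain ⟨T₀, hT₀⟩ := exists_isTri hP
  have hmem : ∀ T, IsTri P T → T ∈ (P.powerset.powerset).filter (IsTri P) := fun T hT =>
    Finset.mem_filter.2 ⟨Finset.mem_powerset.2 fun t ht => Finset.mem_powerset.2 (hT.subset t ht), hT⟩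
  obtain ⟨T, hT, hmax⟩ := ((P.powerset.powerset).filter (IsTri P)).exists_max_image
    (fun T => (angleMul T).sort (· ≤ ·)) ⟨T₀, hmem T₀ hT₀⟩
  have hT := (Finset.mem_filter.1 hT).2
  refine ⟨hT.complex, hT.isTriangulation hP, fun τ' hτ' => ?_⟩
  have := hmax _ (hmem _ hτ'.isTri)
  rw [angleList, angleList, angles, angles, hT.triangles_complex]
  exact this

/-- Points that do not span the plane lie on a line. -/
theorem exists_line_of_not_planar {P : Finset Plane} (hP : ¬ Planar P) :
    ∃ f : Plane → ℝ, IsAff f ∧ (∃ p q, f p ≠ f q) ∧ ∀ x ∈ P, f x = 0 := by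
  by_cases h : ∃ a ∈ P, ∃ b ∈ P, a ≠ b
  · obtain ⟨a, ha, b, hb, hab⟩ := h
    obtain ⟨q, hq⟩ := exists_orient_ne hab
    refine ⟨orient a b, isAff_orient a b, ⟨q, a, by rwa [orient_left]⟩, fun x hx => ?_⟩
    by_contra h0
    refine hP ⟨{a, b, x}, fun y hy => ?_, nondeg_triple h0⟩
    simp only [Finset.mem_insert, Finset.mem_singleton] at hy
    rcases hy with rfl | rfl | rfl <;> assumption
  · push Not at h
    have hf : ∀ k : ℝ, ∃ p q : Plane, p 0 - k ≠ q 0 - k := fun k => ⟨!₂[0, 0], !₂[1, 0], by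
      rw [Ne, sub_left_inj]; simp⟩
    have hf' : ∀ k : ℝ, IsAff fun p => p 0 - k := fun k => ⟨1, 0, -k, fun p => by ring⟩
    rcases P.eq_empty_or_nonempty with rfl | ⟨a, ha⟩
    · exact ⟨_, hf' 0, hf 0, by simp⟩
    · exact ⟨_, hf' (a 0), hf (a 0), fun x hx => by rw [h x hx a ha]; simp⟩

end MaxMinAngle

end

theorem theorem1 (P : Finset MaxMinAngle.Plane)
    (hP : ∀ p ∈ P, ∀ q ∈ P, ∀ r ∈ P, ∀ s ∈ P, ¬ MaxMinAngle.IsSymmetricQuadruple p q r s) :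
    ∃! τ : Geometry.SimplicialComplex ℝ MaxMinAngle.Plane,
      MaxMinAngle.IsMaxMinAngleDelaunay P τ := by
  by_cases hpl : MaxMinAngle.Planar P
  · obtain ⟨τ, hτ⟩ := MaxMinAngle.exists_isMaxMinAngleDelaunay hpl
    refine ⟨τ, hτ, fun τ' hτ' => ?_⟩
    exact hτ'.isTriangulation.eq_of_triangles_eq hτ.isTriangulation hpl
      (Finset.Subset.antisymm ((hτ'.opt hpl).subset hP (hτ.opt hpl))
        ((hτ.opt hpl).subset hP (hτ'.opt hpl)))
  · -- collinear points have a single triangulation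
    obtain ⟨f, hf, ⟨p, q, hpq⟩, h0⟩ := MaxMinAngle.exists_line_of_not_planar hpl
    obtain ⟨τ, hτ⟩ := MaxMinAngle.exists_isTriangulation_of_line hf hpq h0
    have huniq : ∀ τ', MaxMinAngle.IsTriangulation P τ' → τ' = τ := fun τ' hτ' => by
      ext s
      rw [hτ'.faces_eq_of_line hf hpq h0, hτ.faces_eq_of_line hf hpq h0]
    exact ⟨τ, ⟨hτ, fun τ' hτ' => by rw [huniq τ' hτ']⟩, fun τ' hτ' => huniq τ' hτ'.isTriangulation⟩
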